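/- **Conventions.** Fix a universe of small sets; "category over $\mathrm{Set}$" means a locally small category $A$ with a functor $a\mapsto a_0$ to $\mathrm{Set}$. For a category $V$, a *$V$-graph* $X$ is a set $X_0$ of objects with an object $X(a,b)\in V$ for all $a,b\in X_0$; a morphism $f:X\to Y$ is a function $f:X_0\to Y_0$ with maps $X(a,b)\to Y(fa,fb)$. The category of $V$-graphs is $\mathcal GV$; it is over $\mathrm{Set}$ by $X\mapsto X_0$. For a functor $F:V\to W$, $\mathcal GF:\mathcal GV\to\mathcal GW$ applies $F$ to homs. A monad $(T,\eta,\mu)$ on a category over $\mathrm{Set}$ is *over $\mathrm{Set}$* if $(TX)_0= X_0$ naturally, with $\eta$ and $\mu$ identities on underlying sets (up to a specified natural identification $(TX)_0\cong X_0$). *Multimaps and free products.* Let $A$ be a category over $\mathrm{Set}$. A multimap $f:(a_1,\dots,a_n)\to b$ consists of a function $f_0:\prod_i (a_i)_0\to b_0$ and, for every $i$ and every $z\in\prod_{k\neq i}(a_k)_0$, a morphism $f_{i,z}:a_i\to b$ of $A$ whose underlying function is $f_0$ with all variables but the $i$-th fixed at $z$. Multimaps compose by substitution, and form a multicategory. It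 is *representable* if every finite sequence has a universal multimap $(a_1,\dots,a_n)\to\bigotimes_i a_i$ (composition with it is a bijection from morphisms $\bigotimes_ia_i\to c$ to multimaps $(a_1,\dots,a_n)\to c$) and composites of universal multimaps are universal. If $V$ has small coproducts, the multicategory of $\mathcal GV$ is representable: $\bigl(\bigotimes_iX_i\bigr)_0=\prod_i(X_i)_0$, and the hom of $\bigotimes_i X_i$ from $x$ to $y$ is $\coprod_i X_i(x_i,y_i)$ if $x=y$, $X_j(x_j,y_j)$ if $x$ and $y$ differ exactly in position $j$, and initial otherwise. For a monad $T$ over $\mathrm{Set}$ on $\mathcal GV$, the tensor product on the category of algebras $\mathcal G(V)^T$ (over $\mathrm{Set}$ via $\mathcal G(V)^T\to\mathcal GV\to\mathrm{Set}$) given by universal multimaps of $T$-algebras is called the *free product* of $T$-algebras. *Multitensors.* A multitensor (lax monoidal structure) on $V$ consists of functors $E:V^n\to V$, $(X_i)_i\mapsto E_iX_i$, for $n\ge0$, and natural maps $u_X:X\to E_1X$ and $\sigma:E_iE_jX_{ij}\to E_{ij}X_{ij}$ subject to two unit laws and an associative law. Its unary part $E_1$ is a monad on $V$. It is *normal* if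 $u$ is invertible, and *distributive* if it preserves small coproducts in each variable. A tensor product given by universal multimaps is a normal multitensor. An *$E$-category* is a $V$-graph $X$ with maps $E_iX(x_{i-1},x_i)\to X(x_0,x_n)$ for all sequences $x_0,\dots,x_n$ of objects $(n\ge 0)$, compatible with $u$ and $\sigma$; an $E$-functor is a morphism of $V$-graphs commuting with these maps. Through the maps with $n=1$, the homs of an $E$-category are $E_1$-algebras, so there is a forgetful functor $E\text{-}\mathrm{Cat}\to\mathcal G(V^{E_1})$. If $V$ has small coproducts and $E$ is distributive, $\Gamma E$ is the monad on $\mathcal GV$ with $(\Gamma E)(X)_0=X_0$ and $$(\Gamma E)(X)(a,b)=\coprod_{n\ge 0,\ a=x_0,\dots,x_n=b}E_iX(x_{i-1},x_i),$$ with unit induced by $u$ and multiplication by $\sigma$ and concatenation of sequences. A *lifted multitensor* $E'$ of $E$ is a normal distributive multitensor on $V^{E_1}$ such that $E'\text{-}\mathrm{Cat}$ and $E\text{-}\mathrm{Cat}$ are isomorphic categories over $\mathcal G(V^{E_1})$; it is unique up to isomorphism when it exists. *The multitensor $T\otimes$.* Let $T$ be a monad over $\mathrm{Set}$ on $\mathcal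 GV$. It acts on multimaps (as the identity on underlying functions, and as $T$ on the $f_{i,z}$), which gives maps $\varphi:\bigotimes_iTX_i\to T\bigotimes_iX_i$. Write $T\otimes$ for the multitensor $(X_i)_i\mapsto T\bigotimes_iX_i$ on $\mathcal GV$, with unit $X\to\bigotimes X\to T\bigotimes X$ given by the unit of $\otimes$ and $\eta$, and substitution $$T\bigotimes_iT\bigotimes_jX_{ij}\xrightarrow{T\varphi}TT\bigotimes_i\bigotimes_jX_{ij}\xrightarrow{\mu}T\bigotimes_i\bigotimes_jX_{ij}\cong T\bigotimes_{ij}X_{ij}.$$ As $\otimes$ is normal, the unary part of $T\otimes$ is identified with $T$, and its category of algebras with $\mathcal G(V)^T$. **Theorem.** Let $V$ be a locally presentable category and $T$ an accessible monad over $\mathrm{Set}$ on $\mathcal GV$ that preserves small coproducts. Then the multicategory of $T$-algebras is representable, so that the free product of $T$-algebras exists, and the following hold. 1. The free product of $T$-algebras is the lifted multitensor $(T\otimes)'$: it is a normal distributive multitensor on $\mathcal G(V)^T$, whose enriched categories are isomorphic to $(T\otimes)$-categories over $\mathcal G(\mathcal G(V)^T)$, and every lifted multitensor of $T\otimes$ on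 $\mathcal G(V)^T$ is isomorphic to it as a multitensor. 2. $T\otimes$ is distributive, and the monad on $\mathcal G^2V=\mathcal G(\mathcal GV)$ whose algebras are sesqui-$T$-algebras, that is, categories enriched in $\mathcal G(V)^T$ via the free product, is $\Gamma(T\otimes)$: the category of sesqui-$T$-algebras is isomorphic to the category of algebras of $\Gamma(T\otimes)$, compatibly with the forgetful functors to $\mathcal G^2V$. -/

import Mathlib

open CategoryTheory CategoryTheory.Limits

universe w v v' u u'

noncomputable section

namespace EnrichedGraph

/-! ### Concatenation of finite sequences -/

/-- `Blocks m N` exhibits `Fin N` as the concatenation of the `n` blocks `Fin (m 0)`, `Fin (m 1)`,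
and so on: `b i j` is the position, in the concatenated sequence, of the `j`-th entry of the `i`-th
block. Such data exists exactly when `N` is the sum of the `m i`, and is then unique. -/
structure Blocks {n : ℕ} (m : Fin n → ℕ) (N : ℕ) where
  idx : ∀ i : Fin n, Fin (m i) → Fin N
  lt_of_fst : ∀ (i i' : Fin n) (j : Fin (m i)) (j' : Fin (m i')), i < i' → idx i j < idx i' j'
  lt_of_snd : ∀ (i : Fin n) (j j' : Fin (m i)), j < j' → idx i j < idx i j'
  surj : ∀ r : Fin N, ∃ (i : Fin n) (j : Fin (m i)), idx i j = r

namespace Blocks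

variable {n N : ℕ} {m : Fin n → ℕ}

instance : CoeFun (Blocks m N) (fun _ => ∀ i : Fin n, Fin (m i) → Fin N) := ⟨Blocks.idx⟩

/-- The single block. -/
abbrev single (N : ℕ) : Blocks (fun _ : Fin 1 => N) N where
  idx _ j := j
  lt_of_fst i i' _ _ h := by omega
  lt_of_snd _ _ _ h := h
  surj r := ⟨0, r, rfl⟩

/-- All blocks of length one. -/
abbrev ones (n : ℕ) : Blocks (fun _ : Fin n => 1) n where
  idx i _ := i
  lt_of_fst _ _ _ _ h := h
  lt_of_snd _ j j' h := by omega
  surj r := ⟨r, 0, rfl⟩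

theorem idx_lt_iff (b : Blocks m N) (x y : Σ i, Fin (m i)) :
    b x.1 x.2 < b y.1 y.2 ↔ toLex x < toLex y := by
  have key : ∀ x y : Σ i, Fin (m i), toLex x < toLex y → b x.1 x.2 < b y.1 y.2 := by
    rintro ⟨i, j⟩ ⟨i', j'⟩ h
    rcases Sigma.lex_iff.1 h with h | ⟨h, h'⟩
    · exact b.lt_of_fst _ _ _ _ h
    · obtain rfl : i = i' := h
      exact b.lt_of_snd _ _ _ h'
  refine ⟨fun h => ?_, key x y⟩
  rcases lt_trichotomy (toLex x) (toLex y) with h' | h' | h'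
  · exact h'
  · obtain rfl : x = y := h'
    exact absurd h (lt_irrefl _)
  · exact absurd (key _ _ h') (lt_asymm h)

/-- The order isomorphism underlying a block decomposition. -/
def orderIso (b : Blocks m N) : (Σₗ i, Fin (m i)) ≃o Fin N :=
  StrictMono.orderIsoOfSurjective (fun x => b (ofLex x).1 (ofLex x).2)
    (fun x y h => (b.idx_lt_iff (ofLex x) (ofLex y)).2 h)
    (fun r => by obtain ⟨i, j, h⟩ := b.surj r; exact ⟨toLex ⟨i, j⟩, h⟩)

theorem orderIso_apply (b : Blocks m N) (i : Fin n) (j : Fin (m i)) :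
    b.orderIso (toLex ⟨i, j⟩) = b i j := rfl

/-- The block and the position in that block of an entry of the concatenated sequence. -/
def inv (b : Blocks m N) (r : Fin N) : Σ i, Fin (m i) := ofLex (b.orderIso.symm r)

@[simp] theorem idx_inv (b : Blocks m N) (r : Fin N) : b (b.inv r).1 (b.inv r).2 = r :=
  b.orderIso.apply_symm_apply r

@[simp] theorem inv_idx (b : Blocks m N) (i : Fin n) (j : Fin (m i)) : b.inv (b i j) = ⟨i, j⟩ :=
  b.orderIso.symm_apply_apply (toLex ⟨i, j⟩)

theorem idx_inj (b : Blocks m N) {i i' : Fin n} {j : Fin (m i)} {j' : Fin (m i')}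
    (h : b i j = b i' j') : (⟨i, j⟩ : Σ i, Fin (m i)) = ⟨i', j'⟩ := by
  rw [← b.inv_idx, h, b.inv_idx]

theorem fst_ne (b : Blocks m N) {i i' : Fin n} (h : i' ≠ i) (j' : Fin (m i')) (j : Fin (m i)) :
    b i' j' ≠ b i j := fun h' => h (congrArg Sigma.fst (b.idx_inj h'))

theorem snd_ne (b : Blocks m N) {i : Fin n} {j j' : Fin (m i)} (h : j' ≠ j) :
    b i j' ≠ b i j := fun h' => h (by simpa using b.idx_inj h')

instance : Subsingleton (Blocks m N) := ⟨fun b b' => by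
  have h : b.orderIso = b'.orderIso := Subsingleton.elim _ _
  have h' : b.idx = b'.idx := by
    funext i j
    exact congrArg (fun e : (Σₗ i, Fin (m i)) ≃o Fin N => e (toLex ⟨i, j⟩)) h
  cases b; cases b'; cases h'; rfl⟩

/-- The concatenation of blocks of given lengths. -/
def canonical {n : ℕ} (m : Fin n → ℕ) : Blocks m (∑ i, m i) :=
  let e : Fin (∑ i, m i) ≃o (Σₗ i, Fin (m i)) := Fintype.orderIsoFinOfCardEq _ (by
    show Fintype.card (Σ i, Fin (m i)) = _
    simp)
  { idx := fun i j => e.symm (toLex ⟨i, j⟩)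
    lt_of_fst := fun i i' j j' h => e.symm.strictMono (Sigma.lex_iff.2 (Or.inl h))
    lt_of_snd := fun i j j' h => e.symm.strictMono (Sigma.lex_iff.2 (Or.inr ⟨rfl, h⟩))
    surj := fun r => ⟨(ofLex (e r)).1, (ofLex (e r)).2, e.symm_apply_apply r⟩ }

theorem card_eq (b : Blocks m N) : N = ∑ i, m i := by
  have := Fintype.card_congr b.orderIso.toEquiv
  have h2 : Fintype.card (Σₗ i, Fin (m i)) = Fintype.card (Σ i, Fin (m i)) := rfl
  rw [h2] at this
  simpa using this.symm

/-- The two ways of locating an entry of a sequence of sequences of sequences agree. -/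
theorem assoc {K : ℕ} {k : Fin N → ℕ} {l : Fin n → ℕ} (b : Blocks m N) (c : Blocks k K)
    (d : ∀ i, Blocks (fun j => k (b i j)) (l i)) (b' : Blocks l K)
    (i : Fin n) (j : Fin (m i)) (q : Fin (k (b i j))) :
    c (b i j) q = b' i (d i j q) := by
  let f : Fin K → Fin K := fun x =>
    let r := (c.inv x).1
    b' (b.inv r).1 (d (b.inv r).1 (b.inv r).2 (Fin.cast (by rw [b.idx_inv]) (c.inv x).2))
  have hf : ∀ i j q, f (c (b i j) q) = b' i (d i j q) := by
    intro i j q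
    have aux : ∀ (r : Fin N) (q : Fin (k r)) (y : Σ i, Fin (m i)) (hy : b.inv r = y)
        (h : k r = k (b y.1 y.2)),
        f (c r q) = b' y.1 (d y.1 y.2 (Fin.cast h q)) := by
      intro r q y hy h
      subst hy
      have aux2 : ∀ (x : Fin K) (p : Σ r, Fin (k r)) (hp : c.inv x = p)
        (h : k p.1 = k (b (b.inv p.1).1 (b.inv p.1).2)),
        f x = b' (b.inv p.1).1 (d (b.inv p.1).1 (b.inv p.1).2 (Fin.cast h p.2)) := by
        intro x p hp h
        subst hp
        rfl
      exact aux2 _ ⟨r, q⟩ (c.inv_idx r q) h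
    exact aux (b i j) q ⟨i, j⟩ (b.inv_idx i j) rfl
  have hmono : StrictMono f := by
    intro x y hxy
    obtain ⟨r, q, rfl⟩ := c.surj x
    obtain ⟨r', q', rfl⟩ := c.surj y
    obtain ⟨i, j, rfl⟩ := b.surj r
    obtain ⟨i', j', rfl⟩ := b.surj r'
    rw [hf, hf]
    rcases Sigma.lex_iff.1 ((c.idx_lt_iff ⟨_, q⟩ ⟨_, q'⟩).1 hxy) with h | ⟨h, h'⟩
    · rcases Sigma.lex_iff.1 ((b.idx_lt_iff ⟨_, j⟩ ⟨_, j'⟩).1 h) with h2 | ⟨h2, h2'⟩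
      · exact b'.lt_of_fst _ _ _ _ h2
      · obtain rfl : i = i' := h2
        exact b'.lt_of_snd _ _ _ ((d i).lt_of_fst _ _ _ _ h2')
    · have h3 := b.idx_inj h
      obtain ⟨rfl, h4⟩ := Sigma.mk.inj_iff.1 h3
      obtain rfl := eq_of_heq h4
      exact b'.lt_of_snd _ _ _ ((d i).lt_of_snd _ _ _ h')
  have : f = id := by
    have hf' := hmono
    funext x
    have := (StrictMono.range_inj (f := f) (g := id) hmono strictMono_id).1 (by
      rw [Set.range_id]
      exact (Finite.injective_iff_surjective.1 hmono.injective).range_eq)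
    rw [this]
  rw [← hf, this, id]

end Blocks

end EnrichedGraph

namespace EnrichedGraph

/-! ### Graphs enriched in a category -/

instance hasCoproducts_of_isLocallyPresentable (V : Type u) [Category.{w} V]
    [IsLocallyPresentable.{w} V] : HasCoproducts.{w} V := by
  obtain ⟨κ, _, _⟩ := IsLocallyPresentable.exists_cardinal.{w} V
  infer_instance

/-- A graph enriched in `V`, or `V`-graph: a set of objects and, for each pair of objects, a hom
in `V`. -/
structure VGraph (V : Type u) [Category.{w} V] : Type (max u (w + 1)) where
  ob : Type w
  hom : ob → ob → V

namespace VGraph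

variable {V : Type u} [Category.{w} V]

/-- A morphism of `V`-graphs: an object map and hom maps. -/
structure Hom (X Y : VGraph V) : Type w where
  ob : X.ob → Y.ob
  hom : ∀ a b : X.ob, X.hom a b ⟶ Y.hom (ob a) (ob b)

instance : Category.{w} (VGraph V) where
  Hom X Y := Hom X Y
  id X := ⟨fun a => a, fun a b => 𝟙 (X.hom a b)⟩
  comp f g := ⟨fun a => g.ob (f.ob a), fun a b => f.hom a b ≫ g.hom (f.ob a) (f.ob b)⟩
  id_comp f := by simp
  comp_id f := by simp
  assoc f g h := by simp

@[simp] theorem id_ob (X : VGraph V) (a : X.ob) : Hom.ob (𝟙 X) a = a := rfl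
@[simp] theorem id_hom (X : VGraph V) (a b : X.ob) : Hom.hom (𝟙 X) a b = 𝟙 (X.hom a b) := rfl
@[simp] theorem comp_ob {X Y Z : VGraph V} (f : X ⟶ Y) (g : Y ⟶ Z) (a : X.ob) :
    Hom.ob (f ≫ g) a = Hom.ob g (Hom.ob f a) := rfl
@[simp] theorem comp_hom {X Y Z : VGraph V} (f : X ⟶ Y) (g : Y ⟶ Z) (a b : X.ob) :
    Hom.hom (f ≫ g) a b = Hom.hom f a b ≫ Hom.hom g (Hom.ob f a) (Hom.ob f b) := rfl

theorem hom_ext {X Y : VGraph V} {f g : X ⟶ Y} (h : ∀ a, Hom.ob f a = Hom.ob g a)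
    (h' : ∀ a b, Hom.hom f a b ≫ eqToHom (by rw [h, h]) = Hom.hom g a b) : f = g := by
  obtain ⟨fo, fh⟩ := f
  obtain ⟨go, gh⟩ := g
  obtain rfl : fo = go := funext h
  obtain rfl : fh = gh := by
    funext a b
    simpa using h' a b
  rfl

theorem hom_congr {X Y : VGraph V} {f g : X ⟶ Y} (h : f = g) (a b : X.ob) :
    Hom.hom f a b = Hom.hom g a b ≫ eqToHom (by rw [h]) := by
  subst h
  simp

/-- The functor sending an enriched graph to its set of objects. -/
def objects (V : Type u) [Category.{w} V] : VGraph V ⥤ Type w where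
  obj X := X.ob
  map f := TypeCat.ofHom (Hom.ob f)

@[simp] theorem objects_map_apply {X Y : VGraph V} (f : X ⟶ Y) (a : X.ob) :
    (objects V).map f a = Hom.ob f a := rfl

/-- A functor induces a functor between categories of enriched graphs, by acting on homs. -/
def mapHoms {V : Type u} [Category.{w} V] {W : Type u'} [Category.{w} W] (F : V ⥤ W) :
    VGraph V ⥤ VGraph W where
  obj X := ⟨X.ob, fun a b => F.obj (X.hom a b)⟩
  map {X Y} f := ⟨Hom.ob (X := X) (Y := Y) f, fun a b => F.map (Hom.hom (X := X) (Y := Y) f a b)⟩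
  map_id X := by
    refine hom_ext (fun a => rfl) (fun a b => ?_)
    simp
  map_comp f g := by
    refine hom_ext (fun a => rfl) (fun a b => ?_)
    simp

/-- The disjoint union of a family of `V`-graphs; homs between distinct summands are initial. -/
def coprod [HasCoproducts.{w} V] {J : Type w} (X : J → VGraph V) : VGraph V where
  ob := Σ j, (X j).ob
  hom x y := ∐ fun h : PLift (x.1 = y.1) => (X y.1).hom (h.down ▸ x.2) y.2

theorem coprod_isColimit [HasCoproducts.{w} V] {J : Type w} (X : J → VGraph V) :
    HasCoproduct X := by
  let c : Cofan X := Cofan.mk (coprod X) (fun j =>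
    (⟨fun a => ⟨j, a⟩, fun a b => Sigma.ι
      (fun h : PLift (j = j) => (X j).hom (h.down ▸ a) b) ⟨rfl⟩⟩ : Hom (X j) (coprod X)))
  let dh (s : Cofan X) : ∀ x y : Σ j, (X j).ob,
      (coprod X).hom x y ⟶ s.pt.hom ((s.inj x.1).ob x.2) ((s.inj y.1).ob y.2) :=
    fun x y => Sigma.desc (fun h => (Hom.hom (s.inj y.1) _ _) ≫ eqToHom (by
      obtain ⟨j, a⟩ := x
      obtain ⟨j', a'⟩ := y
      obtain ⟨h⟩ := h
      dsimp at h
      subst h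
      rfl))
  let d (s : Cofan X) : coprod X ⟶ s.pt :=
    (⟨fun x : Σ j, (X j).ob => (s.inj x.1).ob x.2, dh s⟩ : Hom (coprod X) s.pt)
  refine ⟨⟨⟨c, Cofan.IsColimit.mk c d (fun s j => ?_) (fun s m hm => ?_)⟩⟩⟩
  · refine hom_ext (fun a => rfl) (fun a b => ?_)
    simp only [c, d, dh, comp_hom]
    dsimp [Cofan.inj]
    erw [Sigma.ι_desc]
    simp
  · have ho : ∀ x, m.ob x = (d s).ob x := fun ⟨j, a⟩ => by
      rw [show (d s).ob ⟨j, a⟩ = (s.inj j).ob a from rfl, ← hm j]; rfl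
    refine hom_ext ho ?_
    rintro ⟨j, a⟩ ⟨j', a'⟩
    refine Sigma.hom_ext _ _ ?_
    rintro ⟨h⟩
    dsimp at h
    subst h
    have h2 := hom_congr (hm j).symm a a'
    simp only [c, d, dh]
    erw [Sigma.ι_desc, h2, comp_hom]
    simp
    rfl

instance [HasCoproducts.{w} V] : HasCoproducts.{w} (VGraph V) := fun J =>
  hasCoproductsOfShape_of_hasCoproduct
where
  hasCoproductsOfShape_of_hasCoproduct {J : Type w} : HasColimitsOfShape (Discrete J) (VGraph V) :=
    ⟨fun K => by
      have := coprod_isColimit (fun j => K.obj ⟨j⟩)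
      exact hasColimit_of_iso (F := Discrete.functor fun j => K.obj ⟨j⟩) Discrete.natIsoFunctor⟩

end VGraph
end EnrichedGraph

namespace EnrichedGraph

/-! ### Multitensors -/

/-- A multitensor (lax monoidal structure) on `V`: for each `n` a functor `V ^ n ⥤ V`, written
`obj` and `map`, together with a unit `X ⟶ E X` and a substitution
`E_i E_j X_ij ⟶ E_ij X_ij`, both natural, subject to two unit laws and an associative law. -/
structure Multitensor (V : Type u) [Category.{w} V] where
  obj : ∀ {n : ℕ}, (Fin n → V) → V
  map : ∀ {n : ℕ} {X Y : Fin n → V}, (∀ i, X i ⟶ Y i) → (obj X ⟶ obj Y)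
  unit : ∀ X : V, X ⟶ obj (fun _ : Fin 1 => X)
  subst : ∀ {n N : ℕ} {m : Fin n → ℕ} (b : Blocks m N) (X : Fin N → V),
    obj (fun i => obj (fun j => X (b i j))) ⟶ obj X
  map_id : ∀ {n : ℕ} (X : Fin n → V), map (fun i => 𝟙 (X i)) = 𝟙 (obj X)
  map_comp : ∀ {n : ℕ} {X Y Z : Fin n → V} (f : ∀ i, X i ⟶ Y i) (g : ∀ i, Y i ⟶ Z i),
    map (fun i => f i ≫ g i) = map f ≫ map g
  unit_naturality : ∀ {X Y : V} (f : X ⟶ Y), unit X ≫ map (fun _ => f) = f ≫ unit Y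
  subst_naturality : ∀ {n N : ℕ} {m : Fin n → ℕ} (b : Blocks m N) {X Y : Fin N → V}
    (f : ∀ r, X r ⟶ Y r),
    map (fun i => map (fun j => f (b i j))) ≫ subst b Y = subst b X ≫ map f
  unit_subst : ∀ {N : ℕ} (X : Fin N → V), unit (obj X) ≫ subst (Blocks.single N) X = 𝟙 (obj X)
  map_unit_subst : ∀ {n : ℕ} (X : Fin n → V),
    map (fun i => unit (X i)) ≫ subst (Blocks.ones n) X = 𝟙 (obj X)
  subst_subst : ∀ {n N K : ℕ} {m : Fin n → ℕ} {k : Fin N → ℕ} {l : Fin n → ℕ} (b : Blocks m N)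
    (c : Blocks k K) (d : ∀ i, Blocks (fun j => k (b i j)) (l i)) (b' : Blocks l K)
    (X : Fin K → V),
    map (fun i => map (fun j => map (fun q => eqToHom (congrArg X (b.assoc c d b' i j q))))) ≫
        map (fun i => subst (d i) (fun r => X (b' i r))) ≫ subst b' X =
      subst b (fun p => obj (fun q => X (c p q))) ≫ subst c X

namespace Multitensor

variable {V : Type u} [Category.{w} V]

/-- An isomorphism of multitensors: natural isomorphisms, in each arity, compatible with units and
substitutions. -/
structure Iso (E E' : Multitensor V) where
  iso : ∀ {n : ℕ} (X : Fin n → V), E.obj X ≅ E'.obj X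
  naturality : ∀ {n : ℕ} {X Y : Fin n → V} (f : ∀ i, X i ⟶ Y i),
    E.map f ≫ (iso Y).hom = (iso X).hom ≫ E'.map f
  unit : ∀ X : V, E.unit X ≫ (iso _).hom = E'.unit X
  subst : ∀ {n N : ℕ} {m : Fin n → ℕ} (b : Blocks m N) (X : Fin N → V),
    E.subst b X ≫ (iso X).hom =
      E.map (fun i => (iso (fun j => X (b i j))).hom) ≫ (iso _).hom ≫ E'.subst b X

/-- A multitensor is normal when its unary part is trivial. -/
def IsNormal (E : Multitensor V) : Prop := ∀ X : V, IsIso (E.unit X)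

/-- A multitensor is distributive when it preserves small coproducts in each variable; equivalently,
when coproduct cocones `Y i j ⟶ C i` in the variables `i` induce a coproduct cocone
`E_i (Y i (f i)) ⟶ E_i (C i)`, indexed by the choices `f` of a summand in each variable. -/
def IsDistributive (E : Multitensor V) : Prop :=
  ∀ {n : ℕ} (J : Fin n → Type w) (Y : ∀ i, J i → V) (c : ∀ i, Cofan (Y i)),
    (∀ i, Nonempty (IsColimit (c i))) →
      Nonempty (IsColimit (Cofan.mk (E.obj (fun i => (c i).pt))
        (fun f : ∀ i, J i => E.map (fun i => (c i).inj (f i)))))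

/-- The unary part of a multitensor is a monad. -/
def unary (E : Multitensor V) : Monad V where
  obj X := E.obj (fun _ : Fin 1 => X)
  map f := E.map (fun _ => f)
  map_id X := E.map_id _
  map_comp f g := E.map_comp _ _
  η := { app := fun X => E.unit X
         naturality := fun X Y f => (E.unit_naturality f).symm }
  μ := { app := fun X => E.subst (Blocks.single 1) (fun _ => X)
         naturality := fun X Y f => E.subst_naturality (Blocks.single 1) (fun _ => f) }
  left_unit X := E.unit_subst (fun _ => X)
  right_unit X := by
    have := E.map_unit_subst (fun _ : Fin 1 => X)
    rwa [Subsingleton.elim (Blocks.ones 1) (Blocks.single 1)] at this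
  assoc X := by
    have := E.subst_subst (Blocks.single 1) (Blocks.single 1) (fun _ => Blocks.single 1)
      (Blocks.single 1) (fun _ => X)
    simpa [E.map_id] using this

/-! ### Categories enriched in a multitensor -/

end Multitensor

/-- The sequence of pairs `(s i, t i)` is of the form `(x 0, x 1), (x 1, x 2), …, (x (n-1), x n)`
for a sequence `x` starting at `a` and finishing at `b`. -/
def IsPath {S : Type w} {n : ℕ} (s t : Fin n → S) (a b : S) : Prop :=
  ∃ x : Fin (n + 1) → S, x 0 = a ∧ x (Fin.last n) = b ∧
    ∀ i : Fin n, s i = x i.castSucc ∧ t i = x i.succ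

theorem IsPath.map {S S' : Type w} {n : ℕ} {s t : Fin n → S} {a b : S} (h : IsPath s t a b)
    (f : S → S') : IsPath (fun i => f (s i)) (fun i => f (t i)) (f a) (f b) := by
  obtain ⟨x, rfl, rfl, hx⟩ := h
  exact ⟨fun i => f (x i), rfl, rfl, fun i => ⟨congrArg f (hx i).1, congrArg f (hx i).2⟩⟩

theorem IsPath.single {S : Type w} (a b : S) : IsPath (fun _ : Fin 1 => a) (fun _ => b) a b :=
  ⟨fun i => if i = 0 then a else b, by simp, by simp, fun i => by
    obtain rfl : i = 0 := Subsingleton.elim _ _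
    simp⟩

/-- A category enriched in a multitensor `E`, or `E`-category: a `V`-graph with composition maps
`E_i X(x (i-1), x i) ⟶ X(x 0, x n)` for all sequences `x 0, …, x n` of objects (`n ≥ 0`), compatible
with the unit and the substitution of `E`. The sequence is recorded through its successive pairs
`(s i, t i) = (x (i-1), x i)` and its ends `a = x 0`, `b = x n`. -/
structure ECat {V : Type u} [Category.{w} V] (E : Multitensor V) where
  graph : VGraph V
  comp : ∀ {n : ℕ} (s t : Fin n → graph.ob) (a b : graph.ob), IsPath s t a b →
    (E.obj (fun i => graph.hom (s i) (t i)) ⟶ graph.hom a b)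
  unit_comp : ∀ a b : graph.ob,
    E.unit (graph.hom a b) ≫ comp (fun _ => a) (fun _ => b) a b (IsPath.single a b) = 𝟙 _
  subst_comp : ∀ {n N : ℕ} {m : Fin n → ℕ} (β : Blocks m N) (s t : Fin N → graph.ob)
    (s' t' : Fin n → graph.ob) (a b : graph.ob) (h : IsPath s t a b) (h' : IsPath s' t' a b)
    (hβ : ∀ i, IsPath (fun j => s (β i j)) (fun j => t (β i j)) (s' i) (t' i)),
    E.map (fun i => comp _ _ _ _ (hβ i)) ≫ comp s' t' a b h' =
      E.subst β (fun r => graph.hom (s r) (t r)) ≫ comp s t a b h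

namespace ECat

variable {V : Type u} [Category.{w} V] {E : Multitensor V}

/-- Morphisms of `E`-categories, or `E`-functors. -/
@[ext]
structure Hom (X Y : ECat E) : Type w where
  toHom : X.graph ⟶ Y.graph
  comp_hom : ∀ {n : ℕ} (s t : Fin n → X.graph.ob) (a b : X.graph.ob) (h : IsPath s t a b),
    E.map (fun i => VGraph.Hom.hom toHom (s i) (t i)) ≫
        Y.comp _ _ _ _ (h.map (VGraph.Hom.ob toHom)) =
      X.comp s t a b h ≫ VGraph.Hom.hom toHom a b

instance : Category.{w} (ECat E) where
  Hom X Y := Hom X Y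
  id X := ⟨𝟙 X.graph, fun s t a b h => by
    simp only [VGraph.id_hom, Category.comp_id]
    erw [E.map_id, Category.id_comp]
    rfl⟩
  comp {X Y Z} f g := ⟨f.toHom ≫ g.toHom, fun s t a b h => by
    simp only [VGraph.comp_hom]
    have h1 := f.comp_hom s t a b h
    have h2 := g.comp_hom _ _ _ _ (h.map (VGraph.Hom.ob f.toHom))
    rw [E.map_comp, Category.assoc, ← Category.assoc (X.comp s t a b h), ← h1, Category.assoc,
      ← h2]
    rfl⟩
  id_comp f := Hom.ext (Category.id_comp _)
  comp_id f := Hom.ext (Category.comp_id _)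
  assoc f g h := Hom.ext (Category.assoc _ _ _)

/-- The underlying `V`-graph of an `E`-category. -/
def forget (E : Multitensor V) : ECat E ⥤ VGraph V where
  obj X := X.graph
  map f := Hom.toHom f

/-- The homs of an `E`-category are algebras of the unary part of `E`, through the unary
composition maps. -/
def homAlgebra (X : ECat E) (a b : X.graph.ob) : E.unary.Algebra where
  A := X.graph.hom a b
  a := X.comp (fun _ => a) (fun _ => b) a b (IsPath.single a b)
  unit := X.unit_comp a b
  assoc := (X.subst_comp (Blocks.single 1) (fun _ => a) (fun _ => b) (fun _ => a) (fun _ => b) a b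
    (IsPath.single a b) (IsPath.single a b) (fun _ => IsPath.single a b)).symm

/-- The underlying graph of an `E`-category, enriched in the algebras of the unary part of `E`. -/
def forgetToUnary (E : Multitensor V) : ECat E ⥤ VGraph E.unary.Algebra where
  obj X := ⟨X.graph.ob, fun a b => X.homAlgebra a b⟩
  map {X Y} f :=
    VGraph.Hom.mk (X := ⟨X.graph.ob, fun a b => X.homAlgebra a b⟩)
      (Y := ⟨Y.graph.ob, fun a b => Y.homAlgebra a b⟩) 
        (VGraph.Hom.ob (X := X.graph) (Y := Y.graph) (Hom.toHom f)) (fun a b =>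
        Monad.Algebra.Hom.mk (A := X.homAlgebra a b) (B := Y.homAlgebra _ _)
          (VGraph.Hom.hom (X := X.graph) (Y := Y.graph) (Hom.toHom f) a b)
          (Hom.comp_hom f (fun _ => a) (fun _ => b) a b (IsPath.single a b)))
  map_id _ := rfl
  map_comp _ _ := rfl

end ECat

/-- A functor is an isomorphism of categories when it has a strict inverse. -/
def IsIsoOfCategories {C : Type u} [Category.{v} C] {D : Type u'} [Category.{v'} D] (F : C ⥤ D) :
    Prop := ∃ G : D ⥤ C, F ⋙ G = 𝟭 C ∧ G ⋙ F = 𝟭 D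

end EnrichedGraph

namespace EnrichedGraph

/-! ### Concatenation of paths -/

namespace Blocks

variable {n N : ℕ} {m : Fin n → ℕ}

/-- A family indexed by the entries of the blocks is a family indexed by the concatenation. -/
def lift (b : Blocks m N) {P : Fin N → Sort*} (f : ∀ i j, P (b i j)) (r : Fin N) : P r :=
  cast (congrArg P (b.idx_inv r)) (f (b.inv r).1 (b.inv r).2)

@[simp] theorem lift_idx (b : Blocks m N) {P : Fin N → Sort*} (f : ∀ i j, P (b i j))
    (i : Fin n) (j : Fin (m i)) : b.lift f (b i j) = f i j := by
  have aux : ∀ (y : Σ i, Fin (m i)) (_ : y = ⟨i, j⟩) (h : P (b y.1 y.2) = P (b i j)),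
      cast h (f y.1 y.2) = f i j := by
    rintro _ rfl h
    rfl
  exact aux _ (b.inv_idx i j) _

/-- Concatenation of lists, in terms of finite sequences. -/
theorem ofFn_eq_flatten (b : Blocks m N) {α : Type*} (f : Fin N → α) :
    List.ofFn f = (List.ofFn fun i => List.ofFn fun j => f (b i j)).flatten := by
  have key : List.finRange N = (List.ofFn fun i => List.ofFn fun j => b i j).flatten := by
    have h1 : (List.ofFn fun i => List.ofFn fun j => b i j).flatten.Pairwise (· < ·) := by
      rw [List.pairwise_flatten]
      constructor
      · intro l hl
        obtain ⟨i, rfl⟩ := (List.mem_ofFn' _ _).1 hl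
        rw [List.pairwise_ofFn]
        exact fun _ _ h => b.lt_of_snd _ _ _ h
      · rw [List.pairwise_ofFn]
        intro i i' h x hx y hy
        obtain ⟨j, rfl⟩ := (List.mem_ofFn' _ _).1 hx
        obtain ⟨j', rfl⟩ := (List.mem_ofFn' _ _).1 hy
        exact b.lt_of_fst _ _ _ _ h
    have h2 : (List.finRange N).Pairwise (· < ·) := List.pairwise_lt_finRange N
    refine List.Perm.eq_of_pairwise (le := (· < ·))
      (fun a b _ _ h h' => absurd h (lt_asymm h')) h2 h1 ?_
    refine (List.perm_ext_iff_of_nodup (List.nodup_finRange N) (h1.imp fun h => ne_of_lt h)).2 ?_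
    intro r
    obtain ⟨i, j, rfl⟩ := b.surj r
    simp only [List.mem_finRange, List.mem_flatten, true_iff]
    exact ⟨_, (List.mem_ofFn' _ _).2 ⟨i, rfl⟩, (List.mem_ofFn' _ _).2 ⟨j, rfl⟩⟩
  rw [List.ofFn_eq_map, key, List.map_flatten, List.map_ofFn]
  congr 2
  funext i
  simp [List.map_ofFn, Function.comp_def]

end Blocks

/-- Paths in the form of lists of pairs. -/
def ListPath {S : Type w} : List (S × S) → S → S → Prop
  | [], a, b => a = b
  | (s, t) :: l, a, b => s = a ∧ ListPath l t b

theorem isPath_iff {S : Type w} {n : ℕ} (s t : Fin n → S) (a b : S) :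
    IsPath s t a b ↔ ListPath (List.ofFn fun i => (s i, t i)) a b := by
  induction n generalizing a with
  | zero =>
    simp only [List.ofFn_zero, ListPath]
    constructor
    · rintro ⟨x, rfl, rfl, -⟩
      rfl
    · rintro rfl
      exact ⟨fun _ => a, rfl, rfl, fun i => i.elim0⟩
  | succ n ih =>
    rw [List.ofFn_succ, ListPath, ← ih]
    constructor
    · rintro ⟨x, rfl, rfl, hx⟩
      exact ⟨(hx 0).1, fun i => x i.succ, (hx 0).2.symm, rfl, fun i => hx i.succ⟩
    · rintro ⟨rfl, x, hx, rfl, hx'⟩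
      refine ⟨Fin.cons (s 0) x, rfl, rfl, fun i => ?_⟩
      refine Fin.cases ?_ (fun i => ?_) i
      · exact ⟨rfl, hx.symm⟩
      · exact hx' i

theorem ListPath.append {S : Type w} {l l' : List (S × S)} {a b c : S} (h : ListPath l a b)
    (h' : ListPath l' b c) : ListPath (l ++ l') a c := by
  induction l generalizing a with
  | nil => cases h; exact h'
  | cons p l ih => exact ⟨h.1, ih h.2⟩

theorem ListPath.flatten {S : Type w} {n : ℕ} (s t : Fin n → S) (L : Fin n → List (S × S))
    (a b : S) (h : IsPath s t a b) (hL : ∀ i, ListPath (L i) (s i) (t i)) :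
    ListPath (List.ofFn L).flatten a b := by
  rw [isPath_iff] at h
  induction n generalizing a with
  | zero => simpa using h
  | succ n ih =>
    rw [List.ofFn_succ] at h ⊢
    obtain ⟨rfl, h⟩ := h
    rw [List.flatten_cons]
    exact (hL 0).append (ih _ _ (fun i => L i.succ) _ h (fun i => hL i.succ))

/-- Concatenation of paths. -/
theorem IsPath.concat {S : Type w} {n N : ℕ} {m : Fin n → ℕ} (β : Blocks m N) {s t : Fin N → S}
    {s' t' : Fin n → S} {a b : S} (h' : IsPath s' t' a b)
    (hβ : ∀ i, IsPath (fun j => s (β i j)) (fun j => t (β i j)) (s' i) (t' i)) :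
    IsPath s t a b := by
  rw [isPath_iff, β.ofFn_eq_flatten]
  exact ListPath.flatten s' t' _ a b h' (fun i => (isPath_iff _ _ _ _).1 (hβ i))

/-- The set of paths from `a` to `b`, that is, of sequences `a = x 0, …, x n = b`. -/
structure GPath (S : Type w) (a b : S) : Type w where
  {n : ℕ}
  s : Fin n → S
  t : Fin n → S
  isPath : IsPath s t a b

namespace Multitensor

variable {V : Type u} [Category.{w} V] (E : Multitensor V)

theorem map_map {n : ℕ} {X Y Z : Fin n → V} (f : ∀ i, X i ⟶ Y i) (g : ∀ i, Y i ⟶ Z i) {W : V}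
    (h : E.obj Z ⟶ W) : E.map f ≫ E.map g ≫ h = E.map (fun i => f i ≫ g i) ≫ h := by
  rw [E.map_comp, Category.assoc]

theorem subst_naturality_assoc {n N : ℕ} {m : Fin n → ℕ} (b : Blocks m N) {X Y : Fin N → V}
    (f : ∀ r, X r ⟶ Y r) {W : V} (h : E.obj Y ⟶ W) :
    E.subst b X ≫ E.map f ≫ h = E.map (fun i => E.map (fun j => f (b i j))) ≫ E.subst b Y ≫ h := by
  rw [← Category.assoc, ← E.subst_naturality, Category.assoc]

theorem unit_naturality_assoc {X Y : V} (f : X ⟶ Y) {W : V} (h : E.obj (fun _ => Y) ⟶ W) :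
    f ≫ E.unit Y ≫ h = E.unit X ≫ E.map (fun _ => f) ≫ h := by
  rw [← Category.assoc, ← E.unit_naturality, Category.assoc]

theorem unit_subst_assoc {N : ℕ} (X : Fin N → V) {W : V} (h : E.obj X ⟶ W) :
    E.unit (E.obj X) ≫ E.subst (Blocks.single N) X ≫ h = h := by
  rw [← Category.assoc, E.unit_subst, Category.id_comp]

theorem map_unit_subst_assoc {n : ℕ} (X : Fin n → V) {W : V} (h : E.obj X ⟶ W) :
    E.map (fun i => E.unit (X i)) ≫ E.subst (Blocks.ones n) X ≫ h = h := by
  rw [← Category.assoc, E.map_unit_subst, Category.id_comp]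

end Multitensor

/-! ### The monad associated to a distributive multitensor -/

namespace Multitensor

variable {V : Type u} [Category.{w} V] [HasCoproducts.{w} V] (E : Multitensor V)

/-- The `V`-graph with the same objects as `X` and homs given by the coproducts
`∐ E_i X(x (i-1), x i)` over the sequences `a = x 0, …, x n = b`. -/
abbrev gammaObj (X : VGraph V) : VGraph V where
  ob := X.ob
  hom a b := ∐ fun p : GPath X.ob a b => E.obj (fun i => X.hom (p.s i) (p.t i))

/-- The coproduct inclusions. -/
def gammaInj (X : VGraph V) {n : ℕ} (s t : Fin n → X.ob) (a b : X.ob) (h : IsPath s t a b) :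
    E.obj (fun i => X.hom (s i) (t i)) ⟶ (E.gammaObj X).hom a b :=
  Sigma.ι (fun p : GPath X.ob a b => E.obj (fun i => X.hom (p.s i) (p.t i))) ⟨s, t, h⟩

variable {E}

theorem gamma_hom_ext {X : VGraph V} {a b : X.ob} {Z : V} {f g : (E.gammaObj X).hom a b ⟶ Z}
    (h : ∀ {n : ℕ} (s t : Fin n → X.ob) (h : IsPath s t a b),
      E.gammaInj X s t a b h ≫ f = E.gammaInj X s t a b h ≫ g) : f = g :=
  Sigma.hom_ext _ _ fun p => h p.s p.t p.isPath

/-- Maps out of the homs of `gammaObj`. -/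
def gammaDesc {X : VGraph V} {a b : X.ob} {Z : V}
    (f : ∀ {n : ℕ} (s t : Fin n → X.ob), IsPath s t a b →
      (E.obj (fun i => X.hom (s i) (t i)) ⟶ Z)) : (E.gammaObj X).hom a b ⟶ Z :=
  Sigma.desc fun p => f p.s p.t p.isPath

theorem gammaInj_desc {X : VGraph V} {a b : X.ob} {Z : V}
    (f : ∀ {n : ℕ} (s t : Fin n → X.ob), IsPath s t a b →
      (E.obj (fun i => X.hom (s i) (t i)) ⟶ Z))
    {n : ℕ} (s t : Fin n → X.ob) (h : IsPath s t a b) :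
    E.gammaInj X s t a b h ≫ gammaDesc f = f s t h :=
  Sigma.ι_desc _ _

theorem gammaInj_congr {X : VGraph V} {a b : X.ob} {n : ℕ} {s t s' t' : Fin n → X.ob}
    (hs : ∀ i, s i = s' i) (ht : ∀ i, t i = t' i) (h : IsPath s t a b) (h' : IsPath s' t' a b) :
    E.gammaInj X s t a b h =
      E.map (fun i => eqToHom (congrArg₂ X.hom (hs i) (ht i))) ≫ E.gammaInj X s' t' a b h' := by
  obtain rfl : s = s' := funext hs
  obtain rfl : t = t' := funext ht
  simp [E.map_id]

/-- The universal property of `E_i (∐ …)` for a distributive multitensor. -/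
theorem isColimit_gamma (hE : E.IsDistributive) (X : VGraph V) {n : ℕ} (s' t' : Fin n → X.ob) :
    Nonempty (IsColimit (Cofan.mk (E.obj fun i => (E.gammaObj X).hom (s' i) (t' i))
      (fun p : ∀ i, GPath X.ob (s' i) (t' i) =>
        E.map (fun i => E.gammaInj X (p i).s (p i).t _ _ (p i).isPath)))) :=
  hE (fun i => GPath X.ob (s' i) (t' i)) (fun _ p => E.obj (fun j => X.hom (p.s j) (p.t j)))
    (fun _ => colimit.cocone _) (fun _ => ⟨colimit.isColimit _⟩)

theorem exists_blocks {S : Type w} {n : ℕ} {s' t' : Fin n → S}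
    (p : ∀ i, GPath S (s' i) (t' i)) :
    ∃ (N : ℕ) (m : Fin n → ℕ) (β : Blocks m N) (s t : Fin N → S)
      (h : ∀ i, IsPath (fun j => s (β i j)) (fun j => t (β i j)) (s' i) (t' i)),
      p = fun i => ⟨fun j => s (β i j), fun j => t (β i j), h i⟩ := by
  let β := Blocks.canonical (fun i => (p i).n)
  let s : Fin (∑ i, (p i).n) → S := β.lift fun i j => (p i).s j
  let t : Fin (∑ i, (p i).n) → S := β.lift fun i j => (p i).t j
  have hs : ∀ i, (fun j => s (β i j)) = (p i).s := fun i => by simp [s]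
  have ht : ∀ i, (fun j => t (β i j)) = (p i).t := fun i => by simp [t]
  refine ⟨_, _, β, s, t, fun i => by rw [hs, ht]; exact (p i).isPath, ?_⟩
  funext i
  simp only [hs, ht]

theorem gamma_tensor_hom_ext (hE : E.IsDistributive) {X : VGraph V} {n : ℕ} {s' t' : Fin n → X.ob}
    {Z : V} {f g : E.obj (fun i => (E.gammaObj X).hom (s' i) (t' i)) ⟶ Z}
    (h : ∀ {N : ℕ} {m : Fin n → ℕ} (β : Blocks m N) (s t : Fin N → X.ob)
      (hβ : ∀ i, IsPath (fun j => s (β i j)) (fun j => t (β i j)) (s' i) (t' i)),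
      E.map (fun i => E.gammaInj X _ _ _ _ (hβ i)) ≫ f =
        E.map (fun i => E.gammaInj X _ _ _ _ (hβ i)) ≫ g) : f = g := by
  obtain ⟨hc⟩ := isColimit_gamma hE X s' t'
  refine Cofan.IsColimit.hom_ext hc _ _ fun p => ?_
  obtain ⟨N, m, β, s, t, hβ, rfl⟩ := exists_blocks p
  exact h β s t hβ

theorem gamma_tensor_tensor_hom_ext (hE : E.IsDistributive) {X : VGraph V} {n N : ℕ}
    {m : Fin n → ℕ} (β : Blocks m N) {s' t' : Fin N → X.ob} {Z : V}
    {f g : E.obj (fun i => E.obj fun j => (E.gammaObj X).hom (s' (β i j)) (t' (β i j))) ⟶ Z}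
    (h : ∀ {K : ℕ} {k : Fin N → ℕ} (γ : Blocks k K) (s t : Fin K → X.ob)
      (hγ : ∀ r, IsPath (fun j => s (γ r j)) (fun j => t (γ r j)) (s' r) (t' r)),
      E.map (fun i => E.map fun j => E.gammaInj X _ _ _ _ (hγ (β i j))) ≫ f =
        E.map (fun i => E.map fun j => E.gammaInj X _ _ _ _ (hγ (β i j))) ≫ g) : f = g := by
  have hc := fun i => isColimit_gamma hE X (fun j => s' (β i j)) (fun j => t' (β i j))
  obtain ⟨hc'⟩ := hE (fun i => ∀ j, GPath X.ob (s' (β i j)) (t' (β i j))) _ (fun _ => _) hc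
  refine Cofan.IsColimit.hom_ext hc' _ _ fun p => ?_
  obtain ⟨q, rfl⟩ : ∃ q : ∀ r, GPath X.ob (s' r) (t' r), p = fun i j => q (β i j) :=
    ⟨β.lift p, by funext i j; simp⟩
  obtain ⟨K, k, γ, s, t, hγ, rfl⟩ := exists_blocks q
  exact h γ s t hγ

variable (E)

/-- The multiplication of `gamma`: concatenation of paths, and substitution in `E`. -/
def gammaMul (hE : E.IsDistributive) (X : VGraph V) (a b : X.ob) :
    (E.gammaObj (E.gammaObj X)).hom a b ⟶ (E.gammaObj X).hom a b :=
  gammaDesc (X := E.gammaObj X) fun s' t' h' =>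
    Cofan.IsColimit.desc (isColimit_gamma hE X s' t').some fun p =>
      let β := Blocks.canonical fun i => (p i).n
      let s : Fin (∑ i, (p i).n) → X.ob := β.lift fun i j => (p i).s j
      let t : Fin (∑ i, (p i).n) → X.ob := β.lift fun i j => (p i).t j
      E.map (fun i => E.map fun j => eqToHom (by simp only [s, t, Blocks.lift_idx])) ≫
        E.subst β (fun r => X.hom (s r) (t r)) ≫
          E.gammaInj X s t a b (IsPath.concat β h' fun i => by
            simpa only [s, t, Blocks.lift_idx] using (p i).isPath)

theorem gammaMul_spec (hE : E.IsDistributive) (X : VGraph V) {n N : ℕ} {m : Fin n → ℕ}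
    (β : Blocks m N) (s t : Fin N → X.ob) (s' t' : Fin n → X.ob) (a b : X.ob)
    (h' : IsPath s' t' a b)
    (hβ : ∀ i, IsPath (fun j => s (β i j)) (fun j => t (β i j)) (s' i) (t' i))
    (h : IsPath s t a b) :
    E.map (fun i => E.gammaInj X _ _ _ _ (hβ i)) ≫
        E.gammaInj (E.gammaObj X) s' t' a b h' ≫ E.gammaMul hE X a b =
      E.subst β (fun r => X.hom (s r) (t r)) ≫ E.gammaInj X s t a b h := by
  refine (congrArg (E.map (fun i => E.gammaInj X _ _ _ _ (hβ i)) ≫ ·)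
    (gammaInj_desc (X := E.gammaObj X) _ s' t' h')).trans ?_
  have := Cofan.IsColimit.fac (isColimit_gamma hE X s' t').some
    (fun p =>
      let β := Blocks.canonical fun i => (p i).n
      let s : Fin (∑ i, (p i).n) → X.ob := β.lift fun i j => (p i).s j
      let t : Fin (∑ i, (p i).n) → X.ob := β.lift fun i j => (p i).t j
      E.map (fun i => E.map fun j => eqToHom (by simp only [s, t, Blocks.lift_idx])) ≫
        E.subst β (fun r => X.hom (s r) (t r)) ≫
          E.gammaInj X s t a b (IsPath.concat β h' fun i => by
            simpa only [s, t, Blocks.lift_idx] using (p i).isPath))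
    (fun i => ⟨fun j => s (β i j), fun j => t (β i j), hβ i⟩)
  refine this.trans ?_
  obtain rfl := β.card_eq
  obtain rfl : β = Blocks.canonical m := Subsingleton.elim _ _
  dsimp only
  have hs : (Blocks.canonical m).lift (fun i j => s ((Blocks.canonical m) i j)) = s := by
    funext r
    obtain ⟨i, j, rfl⟩ := (Blocks.canonical m).surj r
    simp
  have ht : (Blocks.canonical m).lift (fun i j => t ((Blocks.canonical m) i j)) = t := by
    funext r
    obtain ⟨i, j, rfl⟩ := (Blocks.canonical m).surj r
    simp
  have aux : ∀ (s₂ t₂ : Fin (∑ i, m i) → X.ob) (hs : s₂ = s) (ht : t₂ = t)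
      (h₂ : IsPath s₂ t₂ a b),
      E.map (fun i => E.map fun j => eqToHom
        (show X.hom (s (Blocks.canonical m i j)) (t (Blocks.canonical m i j)) =
          X.hom (s₂ (Blocks.canonical m i j)) (t₂ (Blocks.canonical m i j)) by rw [hs, ht])) ≫
        E.subst (Blocks.canonical m) (fun r => X.hom (s₂ r) (t₂ r)) ≫ E.gammaInj X s₂ t₂ a b h₂ =
      E.subst (Blocks.canonical m) (fun r => X.hom (s r) (t r)) ≫ E.gammaInj X s t a b h := by
    rintro _ _ rfl rfl h₂
    simp [E.map_id]
  exact aux _ _ hs ht _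

theorem gammaMul_spec' (hE : E.IsDistributive) (X : VGraph V) {n N : ℕ} {m : Fin n → ℕ}
    (β : Blocks m N) (s t : Fin N → X.ob) (s' t' : Fin n → X.ob) (a b : X.ob)
    (h' : IsPath s' t' a b)
    (hβ : ∀ i, IsPath (fun j => s (β i j)) (fun j => t (β i j)) (s' i) (t' i))
    (h : IsPath s t a b) {Z : V} (g : (E.gammaObj X).hom a b ⟶ Z) :
    E.map (fun i => E.gammaInj X _ _ _ _ (hβ i)) ≫
        E.gammaInj (E.gammaObj X) s' t' a b h' ≫ E.gammaMul hE X a b ≫ g =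
      E.subst β (fun r => X.hom (s r) (t r)) ≫ E.gammaInj X s t a b h ≫ g := by
  have := congrArg (· ≫ g) (E.gammaMul_spec hE X β s t s' t' a b h' hβ h)
  simpa only [Category.assoc] using this

variable {E}

/-- The action of `gamma` on morphisms of `V`-graphs. -/
def gammaMapHom {X Y : VGraph V} (f : VGraph.Hom X Y) (a b : X.ob) :
    (E.gammaObj X).hom a b ⟶ (E.gammaObj Y).hom (f.ob a) (f.ob b) :=
  gammaDesc (X := X) fun s t h =>
    E.map (fun i => f.hom (s i) (t i)) ≫ E.gammaInj Y _ _ _ _ (h.map f.ob)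

theorem gammaInj_mapHom {X Y : VGraph V} (f : VGraph.Hom X Y) {n : ℕ} (s t : Fin n → X.ob)
    (a b : X.ob) (h : IsPath s t a b) :
    E.gammaInj X s t a b h ≫ gammaMapHom f a b =
      E.map (fun i => f.hom (s i) (t i)) ≫ E.gammaInj Y _ _ _ _ (h.map f.ob) :=
  gammaInj_desc (X := X) _ s t h

theorem gammaInj_mapHom' {X Y : VGraph V} (f : VGraph.Hom X Y) {n : ℕ} (s t : Fin n → X.ob)
    (a b : X.ob) (h : IsPath s t a b) {Z : V} (g : (E.gammaObj Y).hom (f.ob a) (f.ob b) ⟶ Z) :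
    E.gammaInj X s t a b h ≫ gammaMapHom f a b ≫ g =
      E.map (fun i => f.hom (s i) (t i)) ≫ E.gammaInj Y _ _ _ _ (h.map f.ob) ≫ g := by
  rw [← Category.assoc, gammaInj_mapHom, Category.assoc]

theorem gammaMul_natural (hE : E.IsDistributive) {X Y : VGraph V} (f : VGraph.Hom X Y)
    (a b : X.ob) :
    gammaMapHom (X := E.gammaObj X) (Y := E.gammaObj Y) ⟨f.ob, gammaMapHom f⟩ a b ≫
        E.gammaMul hE Y (f.ob a) (f.ob b) =
      E.gammaMul hE X a b ≫ gammaMapHom f a b := by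
  refine gamma_hom_ext (X := E.gammaObj X) fun s' t' h' => ?_
  refine gamma_tensor_hom_ext hE fun β s t hβ => ?_
  have h := IsPath.concat β h' hβ
  rw [E.gammaMul_spec' hE X β s t s' t' a b h' hβ h, gammaInj_mapHom, subst_naturality_assoc,
    gammaInj_mapHom', map_map]
  simp only [gammaInj_mapHom, E.map_comp, Category.assoc]
  exact congrArg (E.map (fun i => E.map fun j => f.hom (s (β i j)) (t (β i j))) ≫ ·)
    (E.gammaMul_spec hE Y β _ _ _ _ _ _ (h'.map f.ob) (fun i => (hβ i).map f.ob) (h.map f.ob))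

theorem gammaMul_assoc (hE : E.IsDistributive) (X : VGraph V) (a b : X.ob) :
    gammaMapHom (X := E.gammaObj (E.gammaObj X)) (Y := E.gammaObj X)
        ⟨fun a => a, E.gammaMul hE X⟩ a b ≫ E.gammaMul hE X a b =
      E.gammaMul hE (E.gammaObj X) a b ≫ E.gammaMul hE X a b := by
  refine gamma_hom_ext (X := E.gammaObj (E.gammaObj X)) fun {n} s₁ t₁ h₁ => ?_
  refine gamma_tensor_hom_ext (X := E.gammaObj X) hE fun {N m} β s₂ t₂ hβ => ?_
  refine gamma_tensor_tensor_hom_ext (X := X) hE β fun {K k} γ s t hγ => ?_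
  have h₂ : IsPath s₂ t₂ a b := IsPath.concat β h₁ hβ
  have h : IsPath s t a b := IsPath.concat γ h₂ hγ
  let δ := fun i => Blocks.canonical (fun j => k (β i j))
  obtain ⟨β', hβ'⟩ : ∃ β' : Blocks (fun i => ∑ j, k (β i j)) K, True := by
    have : K = ∑ i, ∑ j, k (β i j) := by
      rw [γ.card_eq, ← Fintype.sum_sigma' (fun i j => k (β i j))]
      exact (Fintype.sum_equiv β.orderIso.toEquiv _ _ (fun x => rfl)).symm
    subst this
    exact ⟨Blocks.canonical _, trivial⟩
  have hidx := Blocks.assoc β γ δ β'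
  have hi : ∀ i, IsPath (fun r => s (β' i r)) (fun r => t (β' i r)) (s₁ i) (t₁ i) := by
    intro i
    refine IsPath.concat (δ i) (hβ i) (fun j => ?_)
    simpa only [← hidx] using hγ (β i j)
  have hij : ∀ i j, IsPath (fun q => s (β' i (δ i j q))) (fun q => t (β' i (δ i j q)))
      (s₂ (β i j)) (t₂ (β i j)) := by
    intro i j
    simpa only [← hidx] using hγ (β i j)
  rw [E.gammaMul_spec' hE (E.gammaObj X) β s₂ t₂ s₁ t₁ a b h₁ hβ h₂]
  have e1 := E.subst_naturality_assoc β
    (X := fun r => E.obj fun q => X.hom (s (γ r q)) (t (γ r q)))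
    (fun r => E.gammaInj X _ _ (s₂ r) (t₂ r) (hγ r))
    (E.gammaInj (E.gammaObj X) s₂ t₂ a b h₂ ≫ E.gammaMul hE X a b)
  rw [← e1, E.gammaMul_spec hE X γ s t s₂ t₂ a b h₂ hγ h, gammaInj_mapHom', map_map, map_map]
  have e2 : ∀ i, (E.map fun j => E.gammaInj X _ _ _ _ (hγ (β i j))) ≫
      E.gammaInj (E.gammaObj X) _ _ _ _ (hβ i) ≫ E.gammaMul hE X _ _ =
      (E.map fun j => E.map fun q => eqToHom (congrArg (fun r => X.hom (s r) (t r))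
        (hidx i j q))) ≫ E.subst (δ i) (fun r => X.hom (s (β' i r)) (t (β' i r))) ≫
        E.gammaInj X _ _ _ _ (hi i) := by
    intro i
    rw [← E.gammaMul_spec hE X (δ i) (fun r => s (β' i r)) (fun r => t (β' i r)) _ _ _ _ (hβ i)
      (hij i) (hi i), map_map]
    congr 2
    funext j
    exact gammaInj_congr (fun q => congrArg s (hidx i j q)) (fun q => congrArg t (hidx i j q)) _ _
  simp only [e2, E.map_comp, Category.assoc]
  rw [E.gammaMul_spec hE X β' s t s₁ t₁ a b h₁ hi h]
  have e3 := E.subst_subst β γ δ β' (fun r => X.hom (s r) (t r))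
  rw [← Category.assoc (E.subst β _), ← e3]
  simp only [Category.assoc]

theorem gamma_left_unit (hE : E.IsDistributive) (X : VGraph V) (a b : X.ob) :
    (E.unit _ ≫ E.gammaInj (E.gammaObj X) _ _ a b (IsPath.single a b)) ≫ E.gammaMul hE X a b =
      𝟙 ((E.gammaObj X).hom a b) := by
  refine gamma_hom_ext (X := X) fun s t h => ?_
  rw [Category.comp_id, Category.assoc, unit_naturality_assoc]
  refine (congrArg (E.unit _ ≫ ·) (E.gammaMul_spec hE X (Blocks.single _) s t _ _ a b
    (IsPath.single a b) (fun _ => h) h)).trans ?_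
  exact E.unit_subst_assoc _ _

theorem gamma_right_unit (hE : E.IsDistributive) (X : VGraph V) (a b : X.ob) :
    gammaMapHom (X := X) (Y := E.gammaObj X)
        ⟨fun a => a, fun a b => E.unit _ ≫ E.gammaInj X _ _ a b (IsPath.single a b)⟩ a b ≫
        E.gammaMul hE X a b = 𝟙 ((E.gammaObj X).hom a b) := by
  refine gamma_hom_ext (X := X) fun s t h => ?_
  rw [Category.comp_id, gammaInj_mapHom', E.map_comp, Category.assoc]
  refine (congrArg (E.map (fun i => E.unit _) ≫ ·) (E.gammaMul_spec hE X (Blocks.ones _) s t s t a b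
    h (fun i => IsPath.single (s i) (t i)) h)).trans ?_
  exact E.map_unit_subst_assoc _ _

variable (E)

/-- The functor part of `gamma`. -/
def gammaFunctor : VGraph V ⥤ VGraph V where
  obj X := E.gammaObj X
  map {X Y} f := VGraph.Hom.mk (X := E.gammaObj X) (Y := E.gammaObj Y) f.ob (gammaMapHom f)
  map_id X := by
    refine VGraph.hom_ext (fun _ => rfl) (fun a b => ?_)
    refine gamma_hom_ext (X := X) fun s t h => ?_
    dsimp only
    rw [← Category.assoc, gammaInj_mapHom]
    simp [E.map_id]
  map_comp {X Y Z} f g := by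
    refine VGraph.hom_ext (fun _ => rfl) (fun a b => ?_)
    refine gamma_hom_ext (X := X) fun s t h => ?_
    dsimp only [VGraph.comp_hom]
    rw [← Category.assoc, gammaInj_mapHom, ← Category.assoc, gammaInj_mapHom, Category.assoc,
      Category.assoc, gammaInj_mapHom]
    simp [E.map_comp]

/-- The monad `Γ E` on `V`-graphs associated to a distributive multitensor `E`:
`(Γ E)(X)` has the objects of `X` and homs `∐ E_i X(x (i-1), x i)`, the coproduct being over all
sequences `a = x 0, …, x n = b`. -/
def gamma (hE : E.IsDistributive) : Monad (VGraph V) where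
  toFunctor := E.gammaFunctor
  η :=
    { app := fun X => VGraph.Hom.mk (X := X) (Y := E.gammaObj X) (fun a => a)
        (fun a b => E.unit _ ≫ E.gammaInj X _ _ a b (IsPath.single a b))
      naturality := fun X Y f => by
        refine VGraph.hom_ext (fun _ => rfl) (fun a b => ?_)
        refine (Category.comp_id _).trans ?_
        change f.hom a b ≫ E.unit _ ≫ E.gammaInj Y _ _ _ _ _ =
          (E.unit _ ≫ E.gammaInj X _ _ a b _) ≫ gammaMapHom f a b
        rw [Category.assoc, gammaInj_mapHom, unit_naturality_assoc] }
  μ :=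
    { app := fun X => VGraph.Hom.mk (X := E.gammaObj (E.gammaObj X)) (Y := E.gammaObj X)
        (fun a => a) (E.gammaMul hE X)
      naturality := fun X Y f => by
        refine VGraph.hom_ext (fun _ => rfl) (fun a b => ?_)
        exact (Category.comp_id _).trans (gammaMul_natural hE f a b) }
  left_unit X := by
    refine VGraph.hom_ext (fun _ => rfl) (fun a b => ?_)
    exact (Category.comp_id _).trans (gamma_left_unit hE X a b)
  right_unit X := by
    refine VGraph.hom_ext (fun _ => rfl) (fun a b => ?_)
    exact (Category.comp_id _).trans (gamma_right_unit hE X a b)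
  assoc X := by
    refine VGraph.hom_ext (fun _ => rfl) (fun a b => ?_)
    exact (Category.comp_id _).trans (gammaMul_assoc hE X a b)

end Multitensor
end EnrichedGraph

namespace EnrichedGraph

/-! ### Multimaps in a category over `Set` -/

variable {A : Type u} [Category.{w} A]

/-- For a category `A` over sets, through `U : A ⥤ Type w`, a multimap `(a 0, …, a (n-1)) ⟶ b`
consists of an underlying multifunction `fn` and of linear parts: for each variable `i` and each
choice `z` of elements in all the other variables, a morphism `lin i z : a i ⟶ b`. The underlying
function of a linear part is obtained from `fn` by fixing the other variables at `z`. -/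
structure MultiMap (U : A ⥤ Type w) {n : ℕ} (a : Fin n → A) (b : A) : Type w where
  fn : (∀ i, U.obj (a i)) → U.obj b
  lin : ∀ i : Fin n, (∀ k : {k // k ≠ i}, U.obj (a k)) → (a i ⟶ b)
  map_lin : ∀ (x : ∀ i, U.obj (a i)) (i : Fin n), U.map (lin i (fun k => x k)) (x i) = fn x

namespace MultiMap

variable {U : A ⥤ Type w}

theorem ext {n : ℕ} {a : Fin n → A} {b : A} {f g : MultiMap U a b} (h : ∀ x, f.fn x = g.fn x)
    (h' : ∀ i z, f.lin i z = g.lin i z) : f = g := by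
  obtain ⟨f, f', hf⟩ := f
  obtain ⟨g, g', hg⟩ := g
  obtain rfl : f = g := funext h
  obtain rfl : f' = g' := funext fun i => funext (h' i)
  rfl

theorem lin_congr {n : ℕ} {a : Fin n → A} {b : A} (f : MultiMap U a b) {i i' : Fin n} (h : i = i')
    (z : ∀ k : {k // k ≠ i}, U.obj (a k)) :
    f.lin i z = eqToHom (congrArg a h) ≫ f.lin i' (fun k => z ⟨k.1, h ▸ k.2⟩) := by
  subst h
  simp

theorem map_eqToHom_apply {S : Type*} {X : S → A} (w : ∀ r, U.obj (X r)) {r r' : S} (h : r = r') :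
    U.map (eqToHom (congrArg X h)) (w r) = w r' := by
  subst h
  simp

/-- Composition with a morphism after a multimap. -/
def post {n : ℕ} {a : Fin n → A} {b c : A} (f : MultiMap U a b) (h : b ⟶ c) : MultiMap U a c where
  fn x := U.map h (f.fn x)
  lin i z := f.lin i z ≫ h
  map_lin x i := by rw [← f.map_lin x i]; simp

/-- Composition with morphisms before a multimap. -/
def pre {n : ℕ} {a a' : Fin n → A} {b : A} (f : MultiMap U a' b) (h : ∀ i, a i ⟶ a' i) :
    MultiMap U a b where
  fn x := f.fn (fun i => U.map (h i) (x i))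
  lin i z := h i ≫ f.lin i (fun k => U.map (h k) (z k))
  map_lin x i := by rw [← f.map_lin _ i]; simp

/-- Composition of multimaps: the sequence `X` is the concatenation, along `β`, of the domains of
the `g i`. -/
def comp {n N : ℕ} {m : Fin n → ℕ} (β : Blocks m N) {X : Fin N → A} {a : Fin n → A} {b : A}
    (f : MultiMap U a b) (g : ∀ i, MultiMap U (fun j => X (β i j)) (a i)) : MultiMap U X b where
  fn x := f.fn (fun i => (g i).fn (fun j => x (β i j)))
  lin := β.lift (P := fun r => (∀ k : {k // k ≠ r}, U.obj (X k)) → (X r ⟶ b)) fun i j z =>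
    (g i).lin j (fun j' => z ⟨β i j', β.snd_ne j'.2⟩) ≫
      f.lin i (fun i' => (g i').fn (fun j' => z ⟨β i' j', β.fst_ne i'.2 j' j⟩))
  map_lin x r := by
    obtain ⟨i, j, rfl⟩ := β.surj r
    rw [Blocks.lift_idx, ← f.map_lin _ i, ← (g i).map_lin _ j]
    simp

section

variable {n N : ℕ} {m : Fin n → ℕ} (β : Blocks m N) {X : Fin N → A} {a : Fin n → A} {b : A}

theorem comp_lin (f : MultiMap U a b) (g : ∀ i, MultiMap U (fun j => X (β i j)) (a i))
    (i : Fin n) (j : Fin (m i)) (z : ∀ k : {k // k ≠ β i j}, U.obj (X k)) :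
    (comp β f g).lin (β i j) z = (g i).lin j (fun j' => z ⟨β i j', β.snd_ne j'.2⟩) ≫
      f.lin i (fun i' => (g i').fn (fun j' => z ⟨β i' j', β.fst_ne i'.2 j' j⟩)) :=
  congrFun (β.lift_idx (P := fun r => (∀ k : {k // k ≠ r}, U.obj (X k)) → (X r ⟶ b))
    (fun i j z => (g i).lin j (fun j' => z ⟨β i j', β.snd_ne j'.2⟩) ≫
      f.lin i (fun i' => (g i').fn (fun j' => z ⟨β i' j', β.fst_ne i'.2 j' j⟩))) i j) z

theorem ext_along {f g : MultiMap U X b} (h : ∀ x, f.fn x = g.fn x)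
    (h' : ∀ i j z, f.lin (β i j) z = g.lin (β i j) z) : f = g :=
  ext h fun r z => by
    obtain ⟨i, j, rfl⟩ := β.surj r
    exact h' i j z

theorem comp_post (f : MultiMap U a b) (g : ∀ i, MultiMap U (fun j => X (β i j)) (a i)) {c : A}
    (h : b ⟶ c) : (comp β f g).post h = comp β (f.post h) g :=
  ext_along β (fun _ => rfl) fun i j z => by
    show (comp β f g).lin (β i j) z ≫ h = _
    rw [comp_lin, comp_lin]
    simp [post]

theorem comp_pre {a' : Fin n → A} (f : MultiMap U a' b) (h : ∀ i, a i ⟶ a' i)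
    (g : ∀ i, MultiMap U (fun j => X (β i j)) (a i)) :
    comp β (f.pre h) g = comp β f (fun i => (g i).post (h i)) :=
  ext_along β (fun _ => rfl) fun i j z => by
    rw [comp_lin, comp_lin]
    simp [post, pre]

theorem pre_comp {X' : Fin N → A} (h : ∀ r, X r ⟶ X' r) (f : MultiMap U a b)
    (g : ∀ i, MultiMap U (fun j => X' (β i j)) (a i)) :
    (comp β f g).pre h = comp β f (fun i => (g i).pre (fun j => h (β i j))) :=
  ext_along β (fun _ => rfl) fun i j z => by
    show h (β i j) ≫ (comp β f g).lin (β i j) _ = _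
    rw [comp_lin, comp_lin]
    simp [pre]

theorem comp_comp {K : ℕ} {k : Fin N → ℕ} {l : Fin n → ℕ} (γ : Blocks k K)
    (δ : ∀ i, Blocks (fun j => k (β i j)) (l i)) (β' : Blocks l K) {Y : Fin K → A}
    (f : MultiMap U a b) (g : ∀ i, MultiMap U (fun j => X (β i j)) (a i))
    (h : ∀ r, MultiMap U (fun q => Y (γ r q)) (X r)) :
    comp γ (comp β f g) h = comp β' f (fun i => comp (δ i) (g i) (fun j => (h (β i j)).pre
      (fun q => eqToHom (congrArg Y (β.assoc γ δ β' i j q).symm)))) := by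
  have key : ∀ (w : ∀ r, U.obj (Y r)) i j q,
      U.map (eqToHom (congrArg Y (β.assoc γ δ β' i j q).symm)) (w (β' i (δ i j q))) =
        w (γ (β i j) q) := fun w i j q =>
    map_eqToHom_apply w (β.assoc γ δ β' i j q).symm
  refine ext_along γ (fun x => ?_) fun r q z => ?_
  · simp only [comp, pre, key]
  · obtain ⟨i, j, rfl⟩ := β.surj r
    have key' : ∀ (i' j' q') (h1 : β' i' (δ i' j' q') ≠ γ (β i j) q),
      U.map (eqToHom (congrArg Y (β.assoc γ δ β' i' j' q').symm)) (z ⟨β' i' (δ i' j' q'), h1⟩) =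
        z ⟨γ (β i' j') q', fun h => h1 ((β.assoc γ δ β' i' j' q').symm.trans h)⟩ := by
      intro i' j' q' h1
      exact map_eqToHom_apply (X := fun k : {k // k ≠ γ (β i j) q} => Y k) z
        (r := ⟨_, h1⟩) (r' := ⟨_, fun h => h1 ((β.assoc γ δ β' i' j' q').symm.trans h)⟩) (Subtype.ext (β.assoc γ δ β' i' j' q').symm)
    rw [comp_lin, comp_lin, lin_congr _ (β.assoc γ δ β' i j q), comp_lin, comp_lin]
    simp only [pre, comp, key', Category.assoc, eqToHom_trans_assoc, eqToHom_refl,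
      Category.id_comp]

end

/-- A multimap is universal when composing with it is a bijection from morphisms out of its target
to multimaps out of its source. -/
def IsUniversal {n : ℕ} {a : Fin n → A} {b : A} (f : MultiMap U a b) : Prop :=
  ∀ c : A, Function.Bijective (fun h : b ⟶ c => f.post h)

theorem post_id {n : ℕ} {a : Fin n → A} {b : A} (f : MultiMap U a b) : f.post (𝟙 b) = f :=
  ext (fun x => by simp [post]) (fun i z => by simp [post])

theorem post_post {n : ℕ} {a : Fin n → A} {b c d : A} (f : MultiMap U a b) (h : b ⟶ c)
    (h' : c ⟶ d) : (f.post h).post h' = f.post (h ≫ h') :=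
  ext (fun x => by simp [post]) (fun i z => by simp [post])

theorem pre_id {n : ℕ} {a : Fin n → A} {b : A} (f : MultiMap U a b) :
    f.pre (fun i => 𝟙 (a i)) = f :=
  ext (fun x => by simp [pre]) (fun i z => by simp [pre])

theorem pre_pre {n : ℕ} {a a' a'' : Fin n → A} {b : A} (f : MultiMap U a'' b)
    (h : ∀ i, a i ⟶ a' i) (h' : ∀ i, a' i ⟶ a'' i) :
    (f.pre h').pre h = f.pre (fun i => h i ≫ h' i) :=
  ext (fun x => by simp [pre]) (fun i z => by simp [pre])

theorem pre_post {n : ℕ} {a a' : Fin n → A} {b c : A} (f : MultiMap U a' b)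
    (h : ∀ i, a i ⟶ a' i) (k : b ⟶ c) : (f.pre h).post k = (f.post k).pre h :=
  ext (fun x => by simp [pre, post]) (fun i z => by simp [pre, post])

end MultiMap

/-- The multicategory of multimaps of a category over `Set` is representable: every finite
sequence of objects has a universal multimap out of it, and universal multimaps are closed under
composition. The structure records a choice of universal multimaps. -/
structure Representation (U : A ⥤ Type w) where
  tens : ∀ {n : ℕ}, (Fin n → A) → A
  univ : ∀ {n : ℕ} (X : Fin n → A), MultiMap U X (tens X)
  universal : ∀ {n : ℕ} (X : Fin n → A), (univ X).IsUniversal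
  comp_universal : ∀ {n N : ℕ} {m : Fin n → ℕ} (β : Blocks m N) (X : Fin N → A),
    (MultiMap.comp β (univ fun i => tens fun j => X (β i j))
      (fun i => univ fun j => X (β i j))).IsUniversal

namespace Representation

variable {U : A ⥤ Type w} (R : Representation U)

theorem hom_ext {n : ℕ} {X : Fin n → A} {c : A} {f g : R.tens X ⟶ c}
    (h : (R.univ X).post f = (R.univ X).post g) : f = g := (R.universal X c).1 h

/-- The morphism out of the tensor product corresponding to a multimap. -/
def desc {n : ℕ} {X : Fin n → A} {c : A} (f : MultiMap U X c) : R.tens X ⟶ c :=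
  ((R.universal X c).2 f).choose

theorem univ_desc {n : ℕ} {X : Fin n → A} {c : A} (f : MultiMap U X c) :
    (R.univ X).post (R.desc f) = f := ((R.universal X c).2 f).choose_spec

/-- The map `⊗_i X i ⟶ ⊗_i Y i` induced by a family of morphisms. -/
def map {n : ℕ} {X Y : Fin n → A} (f : ∀ i, X i ⟶ Y i) : R.tens X ⟶ R.tens Y :=
  R.desc ((R.univ Y).pre f)

theorem univ_map {n : ℕ} {X Y : Fin n → A} (f : ∀ i, X i ⟶ Y i) :
    (R.univ X).post (R.map f) = (R.univ Y).pre f := R.univ_desc _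

/-- The map `X ⟶ ⊗ X` into the unary tensor product. -/
def unit (X : A) : X ⟶ R.tens (fun _ : Fin 1 => X) :=
  (R.univ (fun _ : Fin 1 => X)).lin 0 (fun k => absurd (Subsingleton.elim _ _) k.2)

theorem univ_lin (X : A) (i : Fin 1) (z : ∀ k : {k // k ≠ i}, U.obj X) :
    (R.univ (fun _ : Fin 1 => X)).lin i z = R.unit X := by
  obtain rfl : i = 0 := Subsingleton.elim _ _
  unfold unit
  congr 1
  funext k
  exact absurd (Subsingleton.elim _ _) k.2

theorem univ_fn (X : A) (x : Fin 1 → U.obj X) :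
    (R.univ (fun _ : Fin 1 => X)).fn x = U.map (R.unit X) (x 0) := by
  rw [← (R.univ (fun _ : Fin 1 => X)).map_lin x 0, univ_lin]

/-- The map `⊗_i ⊗_j X_ij ⟶ ⊗_ij X_ij` corresponding to the universal multimap out of `X`. -/
def subst {n N : ℕ} {m : Fin n → ℕ} (β : Blocks m N) (X : Fin N → A) :
    R.tens (fun i => R.tens fun j => X (β i j)) ⟶ R.tens X :=
  ((R.comp_universal β X _).2 (R.univ X)).choose

theorem comp_subst {n N : ℕ} {m : Fin n → ℕ} (β : Blocks m N) (X : Fin N → A) :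
    (MultiMap.comp β (R.univ fun i => R.tens fun j => X (β i j))
      (fun i => R.univ fun j => X (β i j))).post (R.subst β X) = R.univ X :=
  ((R.comp_universal β X _).2 (R.univ X)).choose_spec

theorem multi_ext {n N : ℕ} {m : Fin n → ℕ} (β : Blocks m N) (X : Fin N → A) {c : A}
    {f g : MultiMap U (fun i => R.tens fun j => X (β i j)) c}
    (h : MultiMap.comp β f (fun i => R.univ fun j => X (β i j)) =
      MultiMap.comp β g (fun i => R.univ fun j => X (β i j))) : f = g := by
  rw [← R.univ_desc f, ← R.univ_desc g, ← MultiMap.comp_post, ← MultiMap.comp_post] at h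
  rw [← R.univ_desc f, ← R.univ_desc g, (R.comp_universal β X c).1 h]

theorem comp_single {N : ℕ} {X : Fin N → A} {c : A} (f : MultiMap U X c) :
    MultiMap.comp (Blocks.single N) (R.univ fun _ : Fin 1 => c) (fun _ => f) =
      f.post (R.unit c) :=
  MultiMap.ext_along (Blocks.single N) (fun x => R.univ_fn c _) fun i j z => by
    rw [MultiMap.comp_lin, univ_lin]
    rfl

theorem comp_ones {n : ℕ} {X : Fin n → A} {c : A}
    (f : MultiMap U (fun i => R.tens fun _ : Fin 1 => X i) c) :
    MultiMap.comp (X := X) (Blocks.ones n) f (fun i => R.univ fun _ : Fin 1 => X i) =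
      f.pre (fun i => R.unit (X i)) :=
  MultiMap.ext_along (Blocks.ones n) (fun x => by simp [MultiMap.comp, MultiMap.pre, univ_fn])
    fun i j z => by
      rw [MultiMap.comp_lin, univ_lin]
      simp [MultiMap.pre, univ_fn]

theorem map_id {n : ℕ} (X : Fin n → A) : R.map (fun i => 𝟙 (X i)) = 𝟙 (R.tens X) :=
  R.hom_ext (by rw [univ_map, MultiMap.pre_id, MultiMap.post_id])

theorem map_comp {n : ℕ} {X Y Z : Fin n → A} (f : ∀ i, X i ⟶ Y i) (g : ∀ i, Y i ⟶ Z i) :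
    R.map (fun i => f i ≫ g i) = R.map f ≫ R.map g :=
  R.hom_ext (by
    rw [univ_map, ← MultiMap.post_post, univ_map, MultiMap.pre_post, univ_map, MultiMap.pre_pre])

/-- The multitensor induced by a choice of universal multimaps. -/
def multitensor : Multitensor A where
  obj X := R.tens X
  map f := R.map f
  unit X := R.unit X
  subst β X := R.subst β X
  map_id := R.map_id
  map_comp := R.map_comp
  unit_naturality {X Y} f := by
    have h := congrArg (fun g => g.lin 0 (fun k => absurd (Subsingleton.elim _ _) k.2))
      (R.univ_map (fun _ : Fin 1 => f))
    simpa [MultiMap.post, MultiMap.pre, univ_lin] using h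
  subst_naturality {_ _ _} β {X Y} f := by
    refine (R.comp_universal β X _).1 ?_
    dsimp only
    rw [← MultiMap.post_post, ← MultiMap.post_post, comp_subst, univ_map, MultiMap.comp_post,
      univ_map, MultiMap.comp_pre]
    simp only [univ_map]
    rw [← MultiMap.pre_comp β f, MultiMap.pre_post, comp_subst]
  unit_subst X := R.hom_ext (by
    rw [← MultiMap.post_post, ← comp_single]
    exact (R.comp_subst (Blocks.single _) X).trans (MultiMap.post_id _).symm)
  map_unit_subst X := R.hom_ext (by
    rw [← MultiMap.post_post, univ_map, ← comp_ones]
    exact (R.comp_subst (Blocks.ones _) X).trans (MultiMap.post_id _).symm)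
  subst_subst {n N K m k l} β γ δ β' X := by
    refine (R.comp_universal β (fun r => R.tens fun q => X (γ r q)) _).1 ?_
    refine R.multi_ext γ X ?_
    have h1 : ∀ i, ((R.univ fun j => R.tens fun q => X (γ (β i j) q)).comp (δ i)
        (fun j => (R.univ fun q => X (γ (β i j) q)).pre
          (fun q => eqToHom (congrArg X (β.assoc γ δ β' i j q).symm)))).post
        (R.map (fun j => R.map fun q => eqToHom (congrArg X (β.assoc γ δ β' i j q))) ≫
          R.subst (δ i) (fun r => X (β' i r))) = R.univ (fun r => X (β' i r)) := by
      intro i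
      rw [← MultiMap.post_post, MultiMap.comp_post, univ_map, MultiMap.comp_pre]
      simp only [MultiMap.pre_post, univ_map, MultiMap.pre_pre, eqToHom_trans, eqToHom_refl]
      simp only [MultiMap.pre_id]
      exact R.comp_subst (δ i) (fun r => X (β' i r))
    have h2 := R.comp_subst β (fun r => R.tens fun q => X (γ r q))
    have h3 := R.comp_subst γ X
    have h4 := R.comp_subst β' X
    refine (MultiMap.comp_post γ _ _ _).symm.trans (Eq.trans (b := R.univ X) ?_ ?_)
    · rw [MultiMap.comp_comp β γ δ β', ← Category.assoc, ← map_comp, ← MultiMap.post_post,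
        MultiMap.comp_post β', univ_map, MultiMap.comp_pre]
      simp only [h1]
      exact h4
    · beta_reduce
      rw [← MultiMap.post_post, h2, ← MultiMap.comp_post γ]
      exact h3.symm

end Representation
end EnrichedGraph

namespace EnrichedGraph

namespace MultiMap

variable {A : Type u} [Category.{w} A] {U : A ⥤ Type w}

section

variable {n N : ℕ} {m : Fin n → ℕ} (β : Blocks m N) {X : Fin N → A} {a : Fin n → A} {b c : A}

theorem comp_cancel {p p' : MultiMap U a c} {g : ∀ i, MultiMap U (fun j => X (β i j)) (a i)}
    (hg : ∀ i, (g i).IsUniversal) (hs : ∀ i, Function.Surjective (g i).fn)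
    (h : comp β p g = comp β p' g) : p = p' := by
  have hfn : ∀ x, p.fn x = p'.fn x := by
    intro x
    choose y hy using fun i => hs i (x i)
    have h1 := congrFun (congrArg fn h) (β.lift (P := fun r => U.obj (X r)) y)
    simpa [comp, Blocks.lift_idx, hy] using h1
  refine ext hfn fun i z => (hg i c).1 (ext (fun y => ?_) fun j w => ?_)
  · choose y' hy' using fun k : {k // k ≠ i} => hs k (z k)
    have key : ∀ (q : MultiMap U a c), U.map (q.lin i z) ((g i).fn y) =
        q.fn (fun k => if h : k = i then (by subst h; exact (g k).fn y) else z ⟨k, h⟩) := by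
      intro q
      rw [← q.map_lin _ i]
      congr
      · funext k
        simp [k.2]
      · simp
    simp only [post]
    rw [key, key, hfn]
  · choose y' hy' using fun k : {k // k ≠ i} => hs k (z k)
    let W : ∀ k : {k // k ≠ β i j}, U.obj (X k) := fun k =>
      β.lift (P := fun r => r ≠ β i j → U.obj (X r)) (fun i' j' hne =>
        if h : i' = i then (by subst h; exact w ⟨j', fun h => hne (by rw [h])⟩)
          else y' ⟨i', h⟩ j') k.1 k.2
    have h1 := congrArg (fun q : MultiMap U X c => q.lin (β i j) W) h
    have h2 : (fun j' : {k // k ≠ j} => W ⟨β i j', β.snd_ne j'.2⟩) = w := by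
      funext j'
      simp [W, Blocks.lift_idx]
    have h3 : ∀ k : {k // k ≠ i}, (fun j' => W ⟨β k j', β.fst_ne k.2 j' j⟩) = y' k := by
      intro k
      funext j'
      simp [W, Blocks.lift_idx, k.2]
    simp only [comp_lin, h2, h3, hy'] at h1
    exact h1

theorem comp_surj {g : ∀ i, MultiMap U (fun j => X (β i j)) (a i)}
    (hg : ∀ i, (g i).IsUniversal) (hb : ∀ i, Function.Bijective (g i).fn)
    (q : MultiMap U X c) : ∃ p : MultiMap U a c, comp β p g = q := by
  let v : ∀ i, U.obj (a i) → ∀ j, U.obj (X (β i j)) := fun i => (Equiv.ofBijective _ (hb i)).symm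
  have hv : ∀ i x, (g i).fn (v i x) = x := fun i => (Equiv.ofBijective _ (hb i)).apply_symm_apply
  have hv' : ∀ i y, v i ((g i).fn y) = y := fun i => (Equiv.ofBijective _ (hb i)).symm_apply_apply
  let Y : ∀ (i : Fin n) (z : ∀ k : {k // k ≠ i}, U.obj (a k)) (y : ∀ j, U.obj (X (β i j))),
      ∀ r, U.obj (X r) := fun i z y =>
    β.lift (P := fun r => U.obj (X r)) (fun i' j' =>
      if h : i' = i then (by subst h; exact y j') else v i' (z ⟨i', h⟩) j')
  let W : ∀ (i : Fin n) (z : ∀ k : {k // k ≠ i}, U.obj (a k)) (j : Fin (m i))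
      (w : ∀ k : {k // k ≠ j}, U.obj (X (β i k))), ∀ k : {k // k ≠ β i j}, U.obj (X k) :=
    fun i z j w k =>
      β.lift (P := fun r => r ≠ β i j → U.obj (X r)) (fun i' j' hne =>
        if h : i' = i then (by subst h; exact w ⟨j', fun h => hne (by rw [h])⟩)
          else v i' (z ⟨i', h⟩) j') k.1 k.2
  have hYW : ∀ i z j y, (fun k : {k // k ≠ β i j} => Y i z y k) = W i z j (fun k => y k) := by
    intro i z j y
    funext ⟨k, hk⟩
    obtain ⟨i', j', rfl⟩ := β.surj k
    by_cases h : i' = i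
    · subst h
      simp [Y, W, Blocks.lift_idx]
    · simp [Y, W, Blocks.lift_idx, h]
  have hY : ∀ i z y j, Y i z y (β i j) = y j := by
    intro i z y j
    simp [Y, Blocks.lift_idx]
  let s : ∀ (i : Fin n) (z : ∀ k : {k // k ≠ i}, U.obj (a k)),
      MultiMap U (fun j => X (β i j)) c := fun i z =>
    { fn := fun y => q.fn (Y i z y)
      lin := fun j w => q.lin (β i j) (W i z j w)
      map_lin := fun y j => by
        rw [← hYW, ← q.map_lin _ (β i j), hY] }
  choose l hl using fun (i : Fin n) (z : ∀ k : {k // k ≠ i}, U.obj (a k)) => (hg i c).2 (s i z)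
  let p : MultiMap U a c :=
    { fn := fun x => q.fn (β.lift (P := fun r => U.obj (X r)) (fun i j => v i (x i) j))
      lin := l
      map_lin := fun x i => by
        have h1 := congrFun (congrArg fn (hl i (fun k => x k))) (v i (x i))
        simp only [post, hv, s] at h1
        rw [h1]
        congr 1
        funext r
        obtain ⟨i', j', rfl⟩ := β.surj r
        by_cases h : i' = i
        · subst h
          simp [Y, Blocks.lift_idx]
        · simp [Y, Blocks.lift_idx, h] }
  refine ⟨p, ext_along β (fun x => ?_) fun i j z => ?_⟩
  · simp only [comp, p, hv']
    congr 1
    funext r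
    obtain ⟨i', j', rfl⟩ := β.surj r
    simp [Blocks.lift_idx]
  · rw [comp_lin]
    have h1 := congrArg (fun q => q.lin j (fun j' => z ⟨β i j', β.snd_ne j'.2⟩))
      (hl i (fun i' => (g i').fn (fun j' => z ⟨β i' j', β.fst_ne i'.2 j' j⟩)))
    refine h1.trans ?_
    simp only [s]
    congr 1
    funext ⟨k, hk⟩
    obtain ⟨i', j', rfl⟩ := β.surj k
    by_cases h : i' = i
    · subst h
      simp [W, Blocks.lift_idx]
    · simp [W, Blocks.lift_idx, h, hv']

/-- Universal multimaps that are bijective on elements are closed under composition. -/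
theorem comp_isUniversal {f : MultiMap U a b} {g : ∀ i, MultiMap U (fun j => X (β i j)) (a i)}
    (hf : f.IsUniversal) (hg : ∀ i, (g i).IsUniversal) (hb : ∀ i, Function.Bijective (g i).fn) :
    (comp β f g).IsUniversal := by
  refine fun c => ⟨fun h h' e => ?_, fun q => ?_⟩
  · simp only [comp_post] at e
    exact (hf c).1 (comp_cancel β hg (fun i => (hb i).2) e)
  · obtain ⟨p, rfl⟩ := comp_surj β hg hb q
    obtain ⟨h, rfl⟩ := (hf c).2 p
    exact ⟨h, comp_post β f g h⟩

end

end MultiMap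

/-! ### The free product of enriched graphs -/

namespace VGraph

variable {V : Type u} [Category.{w} V]

/-- Insert `a` at position `i`. -/
def insertAt {n : ℕ} {S : Fin n → Type w} (i : Fin n) (z : ∀ k : {k // k ≠ i}, S k) (a : S i) :
    ∀ k, S k := fun k => if h : k = i then cast (congrArg S h.symm) a else z ⟨k, h⟩

theorem insertAt_self {n : ℕ} {S : Fin n → Type w} (i : Fin n) (z : ∀ k : {k // k ≠ i}, S k)
    (a : S i) : insertAt i z a i = a := by simp [insertAt]

theorem insertAt_ne {n : ℕ} {S : Fin n → Type w} (i : Fin n) (z : ∀ k : {k // k ≠ i}, S k)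
    (a : S i) (k : Fin n) (h : k ≠ i) : insertAt i z a k = z ⟨k, h⟩ := by simp [insertAt, h]

theorem insertAt_eq {n : ℕ} {S : Fin n → Type w} (i : Fin n) (x : ∀ k, S k) :
    insertAt i (fun k => x k) (x i) = x := by
  funext k
  by_cases h : k = i
  · subst h
    exact insertAt_self _ _ _
  · exact insertAt_ne _ _ _ _ h

theorem lin_ob {n : ℕ} {X : Fin n → VGraph V} {c : VGraph V} (F : MultiMap (objects V) X c)
    (x : ∀ i, (X i).ob) (i : Fin n) : Hom.ob (F.lin i (fun k => x k)) (x i) = F.fn x :=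
  F.map_lin x i

theorem lin_ob' {n : ℕ} {X : Fin n → VGraph V} {c : VGraph V} (F : MultiMap (objects V) X c)
    (x y : ∀ i, (X i).ob) (i : Fin n) (h : ∀ k, k ≠ i → x k = y k) :
    Hom.ob (F.lin i (fun k => x k)) (y i) = F.fn y := by
  have : (fun k : {k // k ≠ i} => x k) = fun k : {k // k ≠ i} => y k := funext fun k => h k k.2
  exact (congrArg (fun z : ∀ k : {k // k ≠ i}, (X k).ob => Hom.ob (F.lin i z) (y i)) this).trans
    (lin_ob F y i)

theorem lin_hom_congr {n : ℕ} {X : Fin n → VGraph V} {c : VGraph V} (F : MultiMap (objects V) X c)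
    (i : Fin n) {z z' : ∀ k : {k // k ≠ i}, (objects V).obj (X k)} (hz : z = z')
    {a a' b b' : (X i).ob} (ha : a = a') (hb : b = b') :
    Hom.hom (F.lin i z) a b = eqToHom (by rw [ha, hb]) ≫ Hom.hom (F.lin i z') a' b' ≫
      eqToHom (by rw [hz, ha, hb]) := by
  subst hz ha hb
  simp

variable [HasCoproducts.{w} V]

/-- The free product of `V`-graphs. Its objects are the families of objects, and its hom from `x` to
`y` is the coproduct of the `X_i (x i, y i)` over the positions `i` such that `x` and `y` agree
outside of `i`: all positions if `x = y`, the position `j` only if `x` and `y` differ exactly at `j`,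
and no position otherwise. -/
def freeProd {n : ℕ} (X : Fin n → VGraph V) : VGraph V where
  ob := ∀ i, (X i).ob
  hom x y := ∐ fun i : ULift.{w} {i : Fin n // ∀ k, k ≠ i → x k = y k} =>
    (X i.down.1).hom (x i.down.1) (y i.down.1)

/-- The inclusion of a hom of one of the graphs in a hom of the free product. -/
def freeProdInj {n : ℕ} (X : Fin n → VGraph V) (x y : ∀ i, (X i).ob) (i : Fin n)
    (h : ∀ k, k ≠ i → x k = y k) : (X i).hom (x i) (y i) ⟶ (freeProd X).hom x y :=
  Sigma.ι (fun i : ULift.{w} {i : Fin n // ∀ k, k ≠ i → x k = y k} =>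
    (X i.down.1).hom (x i.down.1) (y i.down.1)) ⟨⟨i, h⟩⟩

theorem freeProd_hom_ext {n : ℕ} {X : Fin n → VGraph V} {x y : ∀ i, (X i).ob} {v : V}
    {f g : (freeProd X).hom x y ⟶ v}
    (h : ∀ i hi, freeProdInj X x y i hi ≫ f = freeProdInj X x y i hi ≫ g) : f = g :=
  Sigma.hom_ext _ _ fun i => h i.down.1 i.down.2

/-- The inclusion of one of the graphs in the free product, at objects `z` of the other graphs. -/
def freeProdLin {n : ℕ} (X : Fin n → VGraph V) (i : Fin n) (z : ∀ k : {k // k ≠ i}, (X k).ob) :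
    X i ⟶ freeProd X :=
  (⟨fun a => insertAt i z a, fun a b =>
    eqToHom (by rw [insertAt_self, insertAt_self]) ≫
      freeProdInj X (insertAt i z a) (insertAt i z b) i
        (fun k hk => by rw [insertAt_ne _ _ _ _ hk, insertAt_ne _ _ _ _ hk])⟩ :
    Hom (X i) (freeProd X))

/-- The multimap from a sequence of graphs to its free product: the identity on objects, and a
coproduct inclusion on homs. -/
def freeProdUniv {n : ℕ} (X : Fin n → VGraph V) : MultiMap (objects V) X (freeProd X) where
  fn x := x
  lin i z := freeProdLin X i z
  map_lin x i := insertAt_eq (S := fun i => (X i).ob) i x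

theorem freeProdUniv_isUniversal {n : ℕ} (X : Fin n → VGraph V) :
    (freeProdUniv X).IsUniversal := by
  have hx : ∀ (x y : ∀ i, (X i).ob) (i : Fin n) (h : ∀ k, k ≠ i → x k = y k),
      insertAt i (fun k => x k) (y i) = y := fun x y i h => by
    have : (fun k : {k // k ≠ i} => x k) = fun k : {k // k ≠ i} => y k :=
      funext fun k => h k k.2
    rw [this, insertAt_eq]
  refine fun c => ⟨fun G G' e => ?_, fun F => ?_⟩
  · have hob : ∀ x, Hom.ob G x = Hom.ob G' x := fun x => congrFun (congrArg MultiMap.fn e) x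
    refine hom_ext hob fun (x y : ∀ i, (X i).ob) => freeProd_hom_ext fun i hi => ?_
    have e1 : freeProdLin X i (fun k => x k) ≫ G = freeProdLin X i (fun k => x k) ≫ G' :=
      congrArg (fun q : MultiMap (objects V) X c => q.lin i (fun k => x k)) e
    have e2 := hom_congr e1 (x i) (y i)
    have aux : ∀ (x' y' : ∀ i, (X i).ob) (ex : x' = x) (ey : y' = y) (hi' : ∀ k, k ≠ i → x' k = y' k)
        (v : V) (p : v = (X i).hom (x' i) (y' i)) (q : c.hom (Hom.ob G' x') (Hom.ob G' y') =
          c.hom (Hom.ob G x') (Hom.ob G y')),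
        (eqToHom p ≫ freeProdInj X x' y' i hi') ≫ Hom.hom G x' y' =
          ((eqToHom p ≫ freeProdInj X x' y' i hi') ≫ Hom.hom G' x' y') ≫ eqToHom q →
        freeProdInj X x y i hi ≫ Hom.hom G x y ≫ eqToHom (congrArg₂ c.hom (hob x) (hob y)) =
          freeProdInj X x y i hi ≫ Hom.hom G' x y := by
      intro x' y' ex ey hi' v p q h
      subst ex ey p
      simp only [eqToHom_refl, Category.id_comp] at h
      rw [← Category.assoc, h]
      simp
    exact aux _ _ (insertAt_eq i x) (hx x y i hi) _ _ _ _ e2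
  · let G : freeProd X ⟶ c := (⟨F.fn, fun (x y : ∀ i, (X i).ob) => Sigma.desc fun i =>
      Hom.hom (F.lin i.down.1 (fun k => x k)) (x i.down.1) (y i.down.1) ≫ eqToHom (congrArg₂ c.hom
        (lin_ob F x i.down.1) (lin_ob' F x y i.down.1 i.down.2))⟩ : Hom (freeProd X) c)
    have hG : ∀ (x y : ∀ i, (X i).ob) i hi, freeProdInj X x y i hi ≫ Hom.hom G x y = 
        Hom.hom (F.lin i (fun k => x k)) (x i) (y i) ≫ eqToHom (congrArg₂ c.hom
          (lin_ob F x i) (lin_ob' F x y i hi)) := fun x y i hi => Sigma.ι_desc _ _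
    refine ⟨G, MultiMap.ext (fun x => rfl) fun i z => ?_⟩
    have hz : ∀ a, (fun k : {k // k ≠ i} => insertAt (S := fun i => (X i).ob) i z a k) = z :=
      fun a => funext fun k => insertAt_ne (S := fun i => (X i).ob) i z a k k.2
    have ha := insertAt_self (S := fun i => (X i).ob) i z
    show freeProdLin X i z ≫ G = F.lin i z
    refine hom_ext (fun a => ?_) fun a b => ?_
    · show F.fn (insertAt i z a) = _
      refine (lin_ob F (insertAt (S := fun i => (X i).ob) i z a) i).symm.trans ?_
      exact congrArg₂ (fun (z : ∀ k : {k // k ≠ i}, (X k).ob) a => Hom.ob (F.lin i z) a)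
        (hz a) (ha a)
    · simp only [comp_hom, freeProdLin, Category.assoc]
      rw [← Category.assoc (freeProdInj _ _ _ _ _), hG, lin_hom_congr F i (hz a) (ha a) (ha b)]
      simp only [Category.assoc, eqToHom_trans_assoc, eqToHom_refl, Category.id_comp]
      erw [eqToHom_trans, eqToHom_refl, Category.comp_id]

/-- The multicategory of multimaps of `V`-graphs is representable, through free products. -/
def representation (V : Type u) [Category.{w} V] [HasCoproducts.{w} V] :
    Representation (objects V) where
  tens := freeProd
  univ X := freeProdUniv X
  universal X := freeProdUniv_isUniversal X
  comp_universal β _ := MultiMap.comp_isUniversal β (freeProdUniv_isUniversal _)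
    (fun _ => freeProdUniv_isUniversal _) (fun _ => Function.bijective_id)

end VGraph

end EnrichedGraph

namespace EnrichedGraph

/-! ### Monads over `Set` and the multitensor `T⊗` -/

section

variable {A : Type u} [Category.{w} A]

/-- The component `X ⟶ T X` of the unit of a monad. -/
def unitAt (T : Monad A) (X : A) : X ⟶ T.obj X := T.η.app X

/-- The component `T T X ⟶ T X` of the multiplication of a monad. -/
def multAt (T : Monad A) (X : A) : T.obj (T.obj X) ⟶ T.obj X := T.μ.app X

theorem unitAt_naturality (T : Monad A) {X Y : A} (f : X ⟶ Y) :
    f ≫ unitAt T Y = unitAt T X ≫ T.map f := T.η.naturality f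

theorem multAt_naturality (T : Monad A) {X Y : A} (f : X ⟶ Y) :
    T.map (T.map f) ≫ multAt T Y = multAt T X ≫ T.map f := T.μ.naturality f

theorem unitAt_multAt (T : Monad A) (X : A) : unitAt T (T.obj X) ≫ multAt T X = 𝟙 (T.obj X) :=
  T.left_unit X

theorem map_unitAt_multAt (T : Monad A) (X : A) :
    T.map (unitAt T X) ≫ multAt T X = 𝟙 (T.obj X) := T.right_unit X

theorem map_multAt_multAt (T : Monad A) (X : A) :
    T.map (multAt T X) ≫ multAt T X = multAt T (T.obj X) ≫ multAt T X := T.assoc X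

namespace MultiMap

/-- The identity multimap. -/
def ofId (U : A ⥤ Type w) (X : A) : MultiMap U (fun _ : Fin 1 => X) X where
  fn x := x 0
  lin _ _ := 𝟙 X
  map_lin x i := by
    obtain rfl : i = 0 := Subsingleton.elim _ _
    simp

end MultiMap

namespace Representation

variable {U : A ⥤ Type w} (R : Representation U)

/-- The inverse `⊗ X ⟶ X` of the map into the unary tensor product. -/
def unitInv (X : A) : R.tens (fun _ : Fin 1 => X) ⟶ X := R.desc (MultiMap.ofId U X)

theorem unit_unitInv (X : A) : R.unit X ≫ R.unitInv X = 𝟙 X := by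
  have h := congrArg (fun g => g.lin 0 (fun k => absurd (Subsingleton.elim _ _) k.2))
    (R.univ_desc (MultiMap.ofId U X))
  simp only [MultiMap.post, R.univ_lin] at h
  exact h

theorem unitInv_unit (X : A) : R.unitInv X ≫ R.unit X = 𝟙 (R.tens fun _ : Fin 1 => X) :=
  R.hom_ext (by
    rw [← MultiMap.post_post, unitInv, R.univ_desc, MultiMap.post_id]
    refine MultiMap.ext (fun x => (R.univ_fn X x).symm) fun i z => ?_
    rw [R.univ_lin]
    exact Category.id_comp _)

theorem unitInv_naturality {X Y : A} (f : X ⟶ Y) :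
    R.map (fun _ : Fin 1 => f) ≫ R.unitInv Y = R.unitInv X ≫ f := by
  have h : R.unit X ≫ R.map (fun _ => f) = f ≫ R.unit Y := R.multitensor.unit_naturality f
  rw [← Category.id_comp (R.map _), ← R.unitInv_unit, Category.assoc, Category.assoc,
    ← Category.assoc (R.unit X), h, Category.assoc, R.unit_unitInv, Category.comp_id]

end Representation

/-- A monad over `Set`, on a category over `Set`: the underlying sets of `T X` and of `X` are
identified, naturally, and under these identifications the unit and the multiplication of `T` are
identities on underlying sets. -/
structure OverSet (U : A ⥤ Type w) (T : Monad A) where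
  iso : T.toFunctor ⋙ U ≅ U
  map_η : ∀ X : A, U.map (unitAt T X) ≫ iso.hom.app X = 𝟙 (U.obj X)
  map_μ : ∀ X : A,
    U.map (multAt T X) ≫ iso.hom.app X = iso.hom.app (T.obj X) ≫ iso.hom.app X

namespace OverSet

variable {U : A ⥤ Type w} {T : Monad A} (θ : OverSet U T)

/-- The identification of the elements of `T X` with the elements of `X`. -/
def out {X : A} (x : U.obj (T.obj X)) : U.obj X := θ.iso.hom.app X x

/-- The identification of the elements of `X` with the elements of `T X`. -/
def into {X : A} (x : U.obj X) : U.obj (T.obj X) := θ.iso.inv.app X x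

@[simp] theorem out_into {X : A} (x : U.obj X) : θ.out (θ.into x) = x := by
  simp [out, into]

@[simp] theorem into_out {X : A} (x : U.obj (T.obj X)) : θ.into (θ.out x) = x :=
  congrArg (fun f => f x) (θ.iso.hom_inv_id_app X)

theorem out_map {X Y : A} (f : X ⟶ Y) (x : U.obj (T.obj X)) :
    θ.out (U.map (T.map f) x) = U.map f (θ.out x) :=
  congrArg (fun f => f x) (θ.iso.hom.naturality f)

theorem map_into {X Y : A} (f : X ⟶ Y) (x : U.obj X) :
    U.map (T.map f) (θ.into x) = θ.into (U.map f x) := by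
  rw [← θ.into_out (U.map (T.map f) (θ.into x)), out_map, out_into]

@[simp] theorem out_η {X : A} (x : U.obj X) : θ.out (U.map (unitAt T X) x) = x :=
  congrArg (fun f => f x) (θ.map_η X)

theorem map_η_eq {X : A} (x : U.obj X) : U.map (unitAt T X) x = θ.into x := by
  rw [← θ.into_out (U.map (unitAt T X) x), out_η]

theorem out_μ {X : A} (x : U.obj (T.obj (T.obj X))) :
    θ.out (U.map (multAt T X) x) = θ.out (θ.out x) :=
  congrArg (fun f => f x) (θ.map_μ X)

/-- The action of a monad over `Set` on multimaps: the identity on underlying multifunctions, and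
the action of `T` on linear parts. -/
def mapMulti {n : ℕ} {a : Fin n → A} {b : A} (f : MultiMap U a b) :
    MultiMap U (fun i => T.obj (a i)) (T.obj b) where
  fn x := θ.into (f.fn (fun i => θ.out (x i)))
  lin i z := T.map (f.lin i (fun k => θ.out (z k)))
  map_lin x i := by
    rw [← f.map_lin _ i, ← θ.map_into, into_out]

theorem mapMulti_post {n : ℕ} {a : Fin n → A} {b c : A} (f : MultiMap U a b) (k : b ⟶ c) :
    (θ.mapMulti f).post (T.map k) = θ.mapMulti (f.post k) :=
  MultiMap.ext (fun x => by simp [MultiMap.post, mapMulti, map_into])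
    (fun i z => by simp [MultiMap.post, mapMulti])

theorem mapMulti_pre {n : ℕ} {a a' : Fin n → A} {b : A} (f : MultiMap U a' b)
    (k : ∀ i, a i ⟶ a' i) :
    (θ.mapMulti f).pre (fun i => T.map (k i)) = θ.mapMulti (f.pre k) :=
  MultiMap.ext (fun x => by simp [MultiMap.pre, mapMulti, out_map])
    (fun i z => by simp [MultiMap.pre, mapMulti, out_map])

theorem mapMulti_comp {n N : ℕ} {m : Fin n → ℕ} (β : Blocks m N) {X : Fin N → A} {a : Fin n → A}
    {b : A} (f : MultiMap U a b) (g : ∀ i, MultiMap U (fun j => X (β i j)) (a i)) :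
    MultiMap.comp β (θ.mapMulti f) (fun i => θ.mapMulti (g i)) =
      θ.mapMulti (MultiMap.comp β f g) :=
  MultiMap.ext_along β (fun x => by simp [MultiMap.comp, mapMulti])
    (fun i j z => by
      show _ = T.map _
      rw [MultiMap.comp_lin, MultiMap.comp_lin]
      simp [mapMulti])

theorem mapMulti_η {n : ℕ} {a : Fin n → A} {b : A} (f : MultiMap U a b) :
    (θ.mapMulti f).pre (fun i => unitAt T (a i)) = f.post (unitAt T b) :=
  MultiMap.ext (fun x => by
      simp only [MultiMap.pre, MultiMap.post, mapMulti, out_η]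
      exact (θ.map_η_eq _).symm)
    (fun i z => by
      simp only [MultiMap.pre, MultiMap.post, mapMulti, out_η]
      exact (unitAt_naturality T _).symm)

theorem mapMulti_μ {n : ℕ} {a : Fin n → A} {b : A} (f : MultiMap U a b) :
    (θ.mapMulti f).pre (fun i => multAt T (a i)) =
      (θ.mapMulti (θ.mapMulti f)).post (multAt T b) :=
  MultiMap.ext (fun x => by
      simp only [MultiMap.pre, MultiMap.post, mapMulti, out_μ]
      rw [← θ.into_out (U.map (multAt T b) _), out_μ, out_into, out_into])
    (fun i z => by
      simp only [MultiMap.pre, MultiMap.post, mapMulti, out_μ]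
      exact (multAt_naturality T _).symm)

variable (R : Representation U)

/-- The coherence `⊗_i T X_i ⟶ T ⊗_i X_i` making `T` a monoidal monad. -/
def φ {n : ℕ} (X : Fin n → A) : R.tens (fun i => T.obj (X i)) ⟶ T.obj (R.tens X) :=
  R.desc (θ.mapMulti (R.univ X))

theorem univ_φ {n : ℕ} (X : Fin n → A) :
    (R.univ (fun i => T.obj (X i))).post (θ.φ R X) = θ.mapMulti (R.univ X) := R.univ_desc _

theorem φ_naturality {n : ℕ} {X Y : Fin n → A} (f : ∀ i, X i ⟶ Y i) :
    R.map (fun i => T.map (f i)) ≫ θ.φ R Y = θ.φ R X ≫ T.map (R.map f) :=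
  R.hom_ext (by
    rw [← MultiMap.post_post, ← MultiMap.post_post, univ_φ, R.univ_map, MultiMap.pre_post, univ_φ,
      mapMulti_pre, mapMulti_post, R.univ_map])

theorem map_η_φ {n : ℕ} (X : Fin n → A) :
    R.map (fun i => unitAt T (X i)) ≫ θ.φ R X = unitAt T (R.tens X) :=
  R.hom_ext (by
    rw [← MultiMap.post_post, R.univ_map, MultiMap.pre_post, univ_φ, mapMulti_η])

theorem map_μ_φ {n : ℕ} (X : Fin n → A) :
    R.map (fun i => multAt T (X i)) ≫ θ.φ R X =
      θ.φ R (fun i => T.obj (X i)) ≫ T.map (θ.φ R X) ≫ multAt T (R.tens X) :=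
  R.hom_ext (by
    rw [← MultiMap.post_post, R.univ_map, ← MultiMap.post_post, ← MultiMap.post_post, univ_φ,
      mapMulti_post, univ_φ, MultiMap.pre_post, univ_φ, mapMulti_μ])

theorem unit_φ (X : A) :
    R.unit (T.obj X) ≫ θ.φ R (fun _ : Fin 1 => X) = T.map (R.unit X) := by
  have h := congrArg (fun g => g.lin 0 (fun k => absurd (Subsingleton.elim _ _) k.2))
    (θ.univ_φ R (fun _ : Fin 1 => X))
  simpa [MultiMap.post, mapMulti, R.univ_lin] using h

theorem subst_φ {n N : ℕ} {m : Fin n → ℕ} (β : Blocks m N) (X : Fin N → A) :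
    R.subst β (fun r => T.obj (X r)) ≫ θ.φ R X =
      R.map (fun i => θ.φ R (fun j => X (β i j))) ≫
        θ.φ R (fun i => R.tens (fun j => X (β i j))) ≫ T.map (R.subst β X) := by
  refine (R.comp_universal β (fun r => T.obj (X r)) _).1 ?_
  beta_reduce
  rw [← MultiMap.post_post, R.comp_subst, univ_φ, ← MultiMap.post_post, MultiMap.comp_post,
    R.univ_map, MultiMap.comp_pre, ← MultiMap.post_post, MultiMap.comp_post, univ_φ]
  simp only [univ_φ]
  rw [mapMulti_comp, mapMulti_post, R.comp_subst]

theorem kleisli_aux {W Z Y Y' Y'' : A} (P : W ⟶ T.obj Z) (Q : Z ⟶ T.obj Y) (s : Y ⟶ Y')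
    (t : Y' ⟶ Y'') :
    T.map (P ≫ T.map Q ≫ multAt T Y ≫ T.map s) ≫ multAt T Y' ≫ T.map t =
      (T.map P ≫ multAt T Z) ≫ T.map Q ≫ multAt T Y ≫ T.map (s ≫ t) := by
  simp only [T.map_comp, Category.assoc]
  rw [← Category.assoc (T.map (T.map s)), multAt_naturality, Category.assoc,
    ← Category.assoc (T.map (multAt T Y)), map_multAt_multAt,
    ← Category.assoc (multAt T Z), ← multAt_naturality]
  simp only [Category.assoc]

/-- The multitensor `T⊗`, with objects `T (⊗_i X_i)`. -/
def multitensor : Multitensor A where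
  obj X := T.obj (R.tens X)
  map f := T.map (R.map f)
  unit X := R.unit X ≫ unitAt T (R.tens fun _ => X)
  subst β X := T.map (θ.φ R (fun i => R.tens (fun j => X (β i j)))) ≫
    multAt T (R.tens (fun i => R.tens (fun j => X (β i j)))) ≫ T.map (R.subst β X)
  map_id X := by rw [R.map_id, T.map_id]
  map_comp f g := by rw [R.map_comp, T.map_comp]
  unit_naturality {X Y} f := by
    have h : R.unit X ≫ R.map (fun _ => f) = f ≫ R.unit Y := R.multitensor.unit_naturality f
    rw [Category.assoc, ← unitAt_naturality, ← Category.assoc, h, Category.assoc]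
  subst_naturality {_ _ _} β {X Y} f := by
    have h : R.map (fun i => R.map (fun j => f (β i j))) ≫ R.subst β Y = R.subst β X ≫ R.map f :=
      R.multitensor.subst_naturality β f
    rw [← Category.assoc, ← T.map_comp, φ_naturality, T.map_comp, Category.assoc, Category.assoc,
      Category.assoc, ← Category.assoc (T.map (T.map _)), multAt_naturality, Category.assoc,
      ← T.map_comp, h, T.map_comp]
  unit_subst X := by
    have h : R.unit (R.tens X) ≫ R.subst (Blocks.single _) X = 𝟙 (R.tens X) :=
      R.multitensor.unit_subst X
    have h2 := θ.unit_φ R (R.tens X)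
    rw [Category.assoc, ← Category.assoc (unitAt T _), ← unitAt_naturality, Category.assoc,
      ← Category.assoc (unitAt T _), unitAt_multAt, Category.id_comp, ← Category.assoc]
    erw [h2]
    rw [← T.map_comp]
    erw [h]
    rw [T.map_id]
  map_unit_subst {n} X := by
    have h : R.map (fun i => R.unit (X i)) ≫ R.subst (Blocks.ones n) X = 𝟙 (R.tens X) :=
      R.multitensor.map_unit_subst X
    rw [R.map_comp, ← Category.assoc, ← T.map_comp, Category.assoc, map_η_φ, T.map_comp,
      Category.assoc, ← Category.assoc (T.map (unitAt T _)), map_unitAt_multAt, Category.id_comp,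
      ← T.map_comp, h, T.map_id]
  subst_subst {n N K m k l} β γ δ β' X := by
    have h := R.multitensor.subst_subst β γ δ β' X
    change R.map (fun i => R.map fun j => R.map fun q =>
      eqToHom (congrArg X (β.assoc γ δ β' i j q))) ≫ R.map (fun i =>
        R.subst (δ i) fun r => X (β' i r)) ≫ R.subst _ _ = R.subst _ _ ≫ R.subst _ _ at h
    have h1 : ∀ i, T.map (R.map fun j => T.map (R.map fun q =>
        eqToHom (congrArg X (β.assoc γ δ β' i j q)))) ≫
        T.map (θ.φ R fun j => R.tens fun q => X (β' i (δ i j q))) ≫ multAt T _ ≫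
          T.map (R.subst (δ i) fun r => X (β' i r)) =
        T.map (θ.φ R fun j => R.tens fun q => X (γ (β i j) q)) ≫ multAt T _ ≫
          T.map (R.map (fun j => R.map fun q => eqToHom (congrArg X (β.assoc γ δ β' i j q))) ≫
            R.subst (δ i) fun r => X (β' i r)) := by
      intro i
      rw [← Category.assoc, ← T.map_comp, φ_naturality, T.map_comp, T.map_comp, Category.assoc,
        ← Category.assoc (T.map (T.map _)), multAt_naturality, Category.assoc]
    have h2 := θ.φ_naturality R (fun i => 
      R.map (fun j => R.map fun q => eqToHom (congrArg X (β.assoc γ δ β' i j q))) ≫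
        R.subst (δ i) fun r => X (β' i r))
    have h3 := θ.map_μ_φ R (fun i => R.tens fun j => R.tens fun q => X (γ (β i j) q))
    have h4 := θ.φ_naturality R (fun i => θ.φ R fun j => R.tens fun q => X (γ (β i j) q))
    have h5 := θ.subst_φ R β (fun r => R.tens fun q => X (γ r q))
    have hL := kleisli_aux (T := T) 
      (θ.φ R fun i => R.tens fun j => T.obj (R.tens fun q => X (γ (β i j) q)))
      (R.map (fun i => θ.φ R fun j => R.tens fun q => X (γ (β i j) q)) ≫ θ.φ R _)
      (R.map (fun i => R.map (fun j => R.map fun q => eqToHom (congrArg X (β.assoc γ δ β' i j q))) ≫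
        R.subst (δ i) fun r => X (β' i r))) (R.subst β' X)
    rw [← Category.assoc, ← T.map_comp, ← R.map_comp]
    simp only [h1]
    rw [← Category.assoc, ← T.map_comp, R.map_comp, R.map_comp, Category.assoc, Category.assoc, h2,
      ← Category.assoc (R.map fun i => multAt T _), h3]
    simp only [Category.assoc]
    rw [← Category.assoc (R.map _) (θ.φ R _), h4]
    simp only [Category.assoc, T.map_comp] at hL ⊢
    rw [hL, ← T.map_comp (R.map _) (R.subst β' X), R.map_comp, Category.assoc, h, T.map_comp,
      ← Category.assoc (T.map (R.subst β _)) (T.map (θ.φ R _)), ← T.map_comp (R.subst β _) (θ.φ R _), h5]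
    simp only [Category.assoc, T.map_comp]
    rw [← Category.assoc (T.map (T.map _)) (multAt T _), multAt_naturality, Category.assoc]

/-- The unary part of `T⊗` is identified with `T`, since the unary part of `⊗` is trivial. -/
def unaryHom : (θ.multitensor R).unary ⟶ T where
  app X := T.map (R.unitInv X)
  naturality X Y f := by
    show T.map (R.map fun _ => f) ≫ T.map (R.unitInv Y) = T.map (R.unitInv X) ≫ T.map f
    rw [← T.map_comp, ← T.map_comp, R.unitInv_naturality]
  app_η X := by
    show (R.unit X ≫ unitAt T _) ≫ T.map (R.unitInv X) = unitAt T X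
    rw [Category.assoc, ← unitAt_naturality, ← Category.assoc, R.unit_unitInv, Category.id_comp]
  app_μ X := by
    show (T.map (θ.φ R (fun _ : Fin 1 => R.tens fun _ : Fin 1 => X)) ≫ multAt T _ ≫
      T.map (R.subst (Blocks.single 1) fun _ => X)) ≫ T.map (R.unitInv X) =
        (T.map (R.map fun _ : Fin 1 => T.map (R.unitInv X)) ≫ T.map (R.unitInv (T.obj X))) ≫
          multAt T X
    have h1 : R.subst (Blocks.single 1) (fun _ => X) = R.unitInv (R.tens fun _ : Fin 1 => X) := by
      have : R.unit (R.tens fun _ : Fin 1 => X) ≫ R.subst (Blocks.single 1) (fun _ => X) = 𝟙 _ :=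
        R.multitensor.unit_subst (fun _ : Fin 1 => X)
      rw [← Category.id_comp (R.subst _ _), ← R.unitInv_unit, Category.assoc, this,
        Category.comp_id]
    have h2 : ∀ Y, θ.φ R (fun _ : Fin 1 => Y) = R.unitInv (T.obj Y) ≫ T.map (R.unit Y) := by
      intro Y
      rw [← θ.unit_φ R Y, ← Category.assoc, R.unitInv_unit, Category.id_comp]
    rw [h1, h2, ← T.map_comp, R.unitInv_naturality]
    simp only [T.map_comp, Category.assoc]
    rw [multAt_naturality, ← Category.assoc (T.map (T.map _)), multAt_naturality, Category.assoc,
      ← Category.assoc (T.map (R.unit _)), ← T.map_comp, R.unit_unitInv, T.map_id,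
      Category.id_comp]

/-- The identification of `T`-algebras with algebras of the unary part of `T⊗`; it is the identity
on underlying objects. -/
def toUnaryAlgebra : T.Algebra ⥤ (θ.multitensor R).unary.Algebra :=
  Monad.algebraFunctorOfMonadHom (θ.unaryHom R)

end OverSet

end

/-! ### Lifted multitensors -/

/-- A multitensor `E'` on a category `B`, identified by `K` with the category of algebras of the
unary part `E_1` of a multitensor `E`, is a lifted multitensor of `E` when it is normal, distributive
and has the same enriched categories: the category of `E'`-categories is isomorphic to the category
of `E`-categories, over the category of graphs enriched in the algebras of `E_1`. -/
def IsLift {V : Type u} [Category.{w} V] (E : Multitensor V) {B : Type u'} [Category.{w} B]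
    (K : B ⥤ E.unary.Algebra) (E' : Multitensor B) : Prop :=
  E'.IsNormal ∧ E'.IsDistributive ∧ ∃ Φ : ECat E' ⥤ ECat E, IsIsoOfCategories Φ ∧
    Φ ⋙ ECat.forgetToUnary E = ECat.forget E' ⋙ VGraph.mapHoms K

end EnrichedGraph

end

open EnrichedGraph

/-! Composites below are in diagram order. Since `T` does nothing to objects, a multimap of graphs
underlies a multimap of algebras `(B_i) → C` exactly when the corresponding `p : ⊗B_i ⟶ C` satisfies
`φ ≫ T p ≫ c = ⊗b_i ≫ p` (`OverSet.φ_desc_under`, `OverSet.exists_under`). Such `p` are the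
morphisms to `C` from a partial algebra `T A ⟶ B`, with `A = ⊗B_i` and `B` the pushout of `φ` and
`⊗b_i`. A universal multimap is therefore a reflection of this partial algebra into algebras.
Partial algebras form a cocomplete category, and each maps to a successor that algebras cannot
distinguish from it (`PreAlg.toSucc_bijective`). Iterating along a regular cardinal for which `T` is
accessible makes the two components converge to the same object, where the structure map becomes an
algebra structure (`PreAlg.exists_reflection`).

Closure of universal multimaps under composition, and distributivity, both come from one property:
objects can be pulled back along functions to their underlying sets. Graphs have it, and algebras
inherit it (`OverSet.hasInverseImages`). It forces universal multimaps and coproduct cocones to be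
bijective on elements, after which multimaps can be assembled piece by piece
(`MultiMap.comp_isUniversal`, `Representation.isDistributive`). For `T⊗`, distributivity also uses
that `T` preserves coproducts.

For enriched categories, a multimap of algebras extends along the unit of `T` to a map out of `T
⊗B_i`, and composition of multimaps becomes substitution in `T⊗` (`OverSet.extend_comp`).
Conversely, the axioms of a `T⊗`-category for a single block and for blocks of length one say that
its composition maps are such extensions (`OverSet.exists_extend_eq`). Hence the two kinds of
enriched category agree, strictly and over graphs of algebras. Composing with the description of
`E`-categories as `Γ E`-algebras gives the monad for sesqui-algebras.

For uniqueness, two lifts have isomorphic enriched categories over graphs, hence isomorphic monads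
`Γ`. A distributive multitensor is recovered from its monad: `E_i X_i` is the end-to-end hom of `Γ
E` on the graph of a path with edges `X_i` (`Multitensor.isIso_pathInj`). The isomorphism of monads
thus restricts to one of multitensors (`Multitensor.nonempty_iso_of_gamma`). -/

noncomputable section

namespace EnrichedGraph

/-! ### Colimits of enriched graphs -/

namespace VGraph

variable {V : Type u} [Category.{w} V]

/-! ### Coequalizers of enriched graphs -/

section

variable {X Y : VGraph V} (f g : X ⟶ Y)

/-- The object set of a coequalizer of enriched graphs. -/
def CoeqOb : Type w := Quot fun y y' => ∃ x : X.ob, Hom.ob f x = y ∧ Hom.ob g x = y'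

/-- The projection onto the object set of a coequalizer. -/
def coeqProj (y : Y.ob) : CoeqOb f g := Quot.mk _ y

theorem coeqProj_eq (x : X.ob) : coeqProj f g (Hom.ob f x) = coeqProj f g (Hom.ob g x) :=
  Quot.sound ⟨x, rfl, rfl⟩

/-- The pairs of objects over a pair of objects of the coequalizer. -/
def CoeqTarget (a b : CoeqOb f g) : Type w :=
  {p : Y.ob × Y.ob // coeqProj f g p.1 = a ∧ coeqProj f g p.2 = b}

/-- The pairs of objects of the source over a pair of objects of the coequalizer. -/
def CoeqSource (a b : CoeqOb f g) : Type w :=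
  {p : X.ob × X.ob // coeqProj f g (Hom.ob f p.1) = a ∧ coeqProj f g (Hom.ob f p.2) = b}

variable [HasCoproducts.{w} V]

/-- The first of the two parallel maps whose coequalizer is a hom of the coequalizer. -/
def coeqFst (a b : CoeqOb f g) :
    (∐ fun p : CoeqSource f g a b => X.hom p.1.1 p.1.2) ⟶
      ∐ fun p : CoeqTarget f g a b => Y.hom p.1.1 p.1.2 :=
  Sigma.desc fun p => Hom.hom f p.1.1 p.1.2 ≫
    Sigma.ι (fun p : CoeqTarget f g a b => Y.hom p.1.1 p.1.2)
      ⟨(Hom.ob f p.1.1, Hom.ob f p.1.2), p.2⟩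

/-- The second of the two parallel maps whose coequalizer is a hom of the coequalizer. -/
def coeqSnd (a b : CoeqOb f g) :
    (∐ fun p : CoeqSource f g a b => X.hom p.1.1 p.1.2) ⟶
      ∐ fun p : CoeqTarget f g a b => Y.hom p.1.1 p.1.2 :=
  Sigma.desc fun p => Hom.hom g p.1.1 p.1.2 ≫
    Sigma.ι (fun p : CoeqTarget f g a b => Y.hom p.1.1 p.1.2)
      ⟨(Hom.ob g p.1.1, Hom.ob g p.1.2), by
        rw [← coeqProj_eq, ← coeqProj_eq]; exact p.2⟩

variable [HasCoequalizers V]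

/-- The homs of a coequalizer of enriched graphs. -/
abbrev coeqHom (a b : CoeqOb f g) : V := coequalizer (coeqFst f g a b) (coeqSnd f g a b)

/-- The coequalizer of two morphisms of enriched graphs. -/
abbrev coeq : VGraph V where
  ob := CoeqOb f g
  hom a b := coeqHom f g a b

/-- The inclusion of a hom of the target in a hom of the coequalizer. -/
def coeqInj {a b : CoeqOb f g} (p : CoeqTarget f g a b) :
    Y.hom p.1.1 p.1.2 ⟶ coeqHom f g a b :=
  Sigma.ι (fun p : CoeqTarget f g a b => Y.hom p.1.1 p.1.2) p ≫ coequalizer.π _ _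

theorem coeqInj_condition {a b : CoeqOb f g} (p : CoeqSource f g a b) :
    Hom.hom f p.1.1 p.1.2 ≫ coeqInj f g (a := a) (b := b)
        ⟨(Hom.ob f p.1.1, Hom.ob f p.1.2), p.2⟩ =
      Hom.hom g p.1.1 p.1.2 ≫ coeqInj f g (a := a) (b := b) ⟨(Hom.ob g p.1.1, Hom.ob g p.1.2), by
        rw [← coeqProj_eq, ← coeqProj_eq]; exact p.2⟩ := by
  have h := congrArg (Sigma.ι (fun p : CoeqSource f g a b => X.hom p.1.1 p.1.2) p ≫ ·)
    (coequalizer.condition (coeqFst f g a b) (coeqSnd f g a b))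
  simp only [coeqFst, coeqSnd, Sigma.ι_desc_assoc, Category.assoc] at h
  exact h

theorem coeq_hom_ext {a b : CoeqOb f g} {Z : V} {h h' : coeqHom f g a b ⟶ Z}
    (e : ∀ p, coeqInj f g p ≫ h = coeqInj f g p ≫ h') : h = h' :=
  coequalizer.hom_ext (Sigma.hom_ext _ _ fun p => by simpa [coeqInj] using e p)

variable {f g} in
/-- Maps out of the homs of a coequalizer. -/
def coeqDesc {a b : CoeqOb f g} {Z : V} (k : ∀ p : CoeqTarget f g a b, Y.hom p.1.1 p.1.2 ⟶ Z)
    (hk : ∀ p : CoeqSource f g a b,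
      Hom.hom f p.1.1 p.1.2 ≫ k ⟨(Hom.ob f p.1.1, Hom.ob f p.1.2), p.2⟩ =
      Hom.hom g p.1.1 p.1.2 ≫ k ⟨(Hom.ob g p.1.1, Hom.ob g p.1.2), by
        rw [← coeqProj_eq, ← coeqProj_eq]; exact p.2⟩) : coeqHom f g a b ⟶ Z :=
  coequalizer.desc (Sigma.desc k)
    (Sigma.hom_ext _ _ fun p => by simpa [coeqFst, coeqSnd] using hk p)

variable {f g} in
theorem coeqInj_desc {a b : CoeqOb f g} {Z : V}
    (k : ∀ p : CoeqTarget f g a b, Y.hom p.1.1 p.1.2 ⟶ Z) (hk) (p : CoeqTarget f g a b) :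
    coeqInj f g p ≫ coeqDesc k hk = k p := by
  simp [coeqInj, coeqDesc]

/-- The projection onto the coequalizer. -/
def coeqπ : Y ⟶ coeq f g :=
  (⟨coeqProj f g, fun y y' => coeqInj f g ⟨(y, y'), rfl, rfl⟩⟩ : Hom Y (coeq f g))

theorem coeq_condition : f ≫ coeqπ f g = g ≫ coeqπ f g := by
  refine hom_ext (fun x => coeqProj_eq f g x) fun x x' => ?_
  have h := coeqInj_condition f g (a := coeqProj f g (Hom.ob g x))
    (b := coeqProj f g (Hom.ob g x')) ⟨(x, x'), coeqProj_eq f g x, coeqProj_eq f g x'⟩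
  refine Eq.trans ?_ h
  -- The objects `f x` and `g x` name the same class only propositionally; transport between the two
  -- hom objects is absorbed by changing the proofs stored in the index of the inclusion.
  have aux : ∀ (a b : CoeqOb f g) (y y' : Y.ob) (ha : coeqProj f g y = a)
      (hb : coeqProj f g y' = b) (e : (coeq f g).hom (coeqProj f g y) (coeqProj f g y') =
        (coeq f g).hom a b),
      coeqInj f g ⟨(y, y'), rfl, rfl⟩ ≫ eqToHom e = coeqInj f g ⟨(y, y'), ha, hb⟩ := by
    rintro _ _ y y' rfl rfl e
    simp
  have := aux _ _ _ _ (coeqProj_eq f g x) (coeqProj_eq f g x')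
    (by rw [coeqProj_eq, coeqProj_eq])
  simp only [comp_hom, Category.assoc]
  exact congrArg (Hom.hom f x x' ≫ ·) this

/-- Graphs have no composition, so identifying objects creates no new paths to account for. A hom of
the quotient only has to receive all homs of `Y` lying over it, subject to the identifications
imposed by the homs of `X`. -/
theorem hasColimit_parallelPair : HasColimit (parallelPair f g) := by
  refine ⟨⟨⟨Cofork.ofπ (coeqπ f g) (coeq_condition f g), Cofork.IsColimit.mk' _ fun s => ?_⟩⟩⟩
  have hob : ∀ x, Hom.ob s.π (Hom.ob f x) = Hom.ob s.π (Hom.ob g x) := fun x =>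
    congrArg (fun k : X ⟶ s.pt => Hom.ob k x) s.condition
  let d : CoeqOb f g → s.pt.ob := Quot.lift (Hom.ob s.π) (by
    rintro _ _ ⟨x, rfl, rfl⟩
    exact hob x)
  have hhom : ∀ x x', Hom.hom f x x' ≫ Hom.hom s.π _ _ =
      Hom.hom g x x' ≫ Hom.hom s.π _ _ ≫ eqToHom (by rw [hob, hob]) := fun x x' => by
    have := hom_congr s.condition x x'
    simpa using this
  have hd : ∀ {a b : CoeqOb f g} (p : CoeqTarget f g a b),
      s.pt.hom (Hom.ob s.π p.1.1) (Hom.ob s.π p.1.2) = s.pt.hom (d a) (d b) := by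
    rintro _ _ ⟨⟨y, y'⟩, rfl, rfl⟩
    rfl
  have hk : ∀ {a b : CoeqOb f g} (p : CoeqSource f g a b),
      Hom.hom f p.1.1 p.1.2 ≫ Hom.hom s.π _ _ ≫
        eqToHom (hd (a := a) (b := b) ⟨(Hom.ob f p.1.1, Hom.ob f p.1.2), p.2⟩) =
      Hom.hom g p.1.1 p.1.2 ≫ Hom.hom s.π _ _ ≫
        eqToHom (hd (a := a) (b := b) ⟨(Hom.ob g p.1.1, Hom.ob g p.1.2), by
          rw [← coeqProj_eq, ← coeqProj_eq]; exact p.2⟩) := fun p => by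
    rw [← Category.assoc, hhom]
    simp
  let D : coeq f g ⟶ s.pt := (⟨d, fun a b =>
    coeqDesc (fun p => Hom.hom s.π p.1.1 p.1.2 ≫ eqToHom (hd p)) hk⟩ : Hom (coeq f g) s.pt)
  have hD : ∀ {a b : CoeqOb f g} (p : CoeqTarget f g a b), coeqInj f g p ≫ Hom.hom D a b =
      Hom.hom s.π p.1.1 p.1.2 ≫ eqToHom (hd p) := fun p => coeqInj_desc _ hk p
  refine ⟨D, ?_, fun {m} hm => ?_⟩
  · refine hom_ext (fun y => rfl) fun y y' => ?_
    exact (Category.comp_id _).trans ((hD ⟨(y, y'), rfl, rfl⟩).trans (Category.comp_id _))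
  · have hm' : coeqπ f g ≫ m = s.π := hm
    have ho : ∀ q, Hom.ob m q = Hom.ob D q := by
      rintro ⟨y⟩
      exact congrArg (fun k : Y ⟶ s.pt => Hom.ob k y) hm'
    refine hom_ext ho fun a b => ?_
    refine coeq_hom_ext f g ?_
    rintro ⟨⟨y, y'⟩, rfl, rfl⟩
    refine Eq.trans ?_ (hD ⟨(y, y'), rfl, rfl⟩).symm
    have h2 := hom_congr hm'.symm y y'
    refine Eq.trans ?_ ((Category.comp_id _).trans h2).symm
    exact (Category.assoc _ _ _).symm

end

instance [HasColimitsOfSize.{w, w} V] : HasColimitsOfSize.{w, w} (VGraph V) := by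
  have : HasCoproducts.{w} V := fun J => inferInstance
  have : HasFiniteColimits V := hasFiniteColimits_of_hasColimitsOfSize.{w, w} V
  have : HasCoequalizers (VGraph V) := by
    have := fun {X Y : VGraph V} {f g : X ⟶ Y} => hasColimit_parallelPair f g
    exact hasCoequalizers_of_hasColimit_parallelPair _
  have : HasCoproducts.{w} (VGraph V) := inferInstance
  exact has_colimits_of_hasCoequalizers_and_coproducts

end VGraph

end EnrichedGraph

namespace EnrichedGraph

/-! ### Reflection into the category of algebras of an accessible monad -/

section

variable {C : Type u} [Category.{v} C]

/-- A partial algebra of a monad `T`: a morphism `T A ⟶ B`. -/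
structure PreAlg (T : Monad C) where
  A : C
  B : C
  a : T.obj A ⟶ B

namespace PreAlg

variable {T : Monad C}

/-- Morphisms of partial algebras. -/
@[ext]
structure Hom (X Y : PreAlg T) where
  f : X.A ⟶ Y.A
  g : X.B ⟶ Y.B
  w : T.map f ≫ Y.a = X.a ≫ g

instance : Category (PreAlg T) where
  Hom := Hom
  id X := ⟨𝟙 _, 𝟙 _, by simp⟩
  comp {X Y Z} p q := ⟨p.f ≫ q.f, p.g ≫ q.g, by
    rw [T.map_comp, Category.assoc, q.w, ← Category.assoc, p.w, Category.assoc]⟩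
  id_comp p := by ext <;> simp
  comp_id p := by ext <;> simp
  assoc p q r := by ext <;> simp

theorem hom_ext {X Y : PreAlg T} {p q : X ⟶ Y} (h : Hom.f p = Hom.f q) (h' : Hom.g p = Hom.g q) :
    p = q := Hom.ext h h'

@[simp] theorem comp_g {X Y Z : PreAlg T} (p : X ⟶ Y) (q : Y ⟶ Z) :
    Hom.g (p ≫ q) = Hom.g p ≫ Hom.g q := rfl

theorem unit_square {A A' B B' : C} {f : A ⟶ A'} {a : T.obj A ⟶ B} {a' : T.obj A' ⟶ B'}
    {g : B ⟶ B'} (h : T.map f ≫ a' = a ≫ g) :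
    f ≫ unitAt T A' ≫ a' = (unitAt T A ≫ a) ≫ g := by
  rw [← Category.assoc, unitAt_naturality, Category.assoc, h, Category.assoc]

variable (T)

/-- The functor sending a partial algebra `T A ⟶ B` to `A`. -/
def fst : PreAlg T ⥤ C where
  obj X := X.A
  map p := Hom.f p

/-- The functor sending a partial algebra `T A ⟶ B` to `B`. -/
def snd : PreAlg T ⥤ C where
  obj X := X.B
  map p := Hom.g p

/-- The structure maps of partial algebras, as a natural transformation. -/
def act : fst T ⋙ T.toFunctor ⟶ snd T where
  app X := X.a
  naturality _ _ p := Hom.w p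


variable {T}

/-- An algebra is a partial algebra. -/
abbrev ofAlgebra (Y : T.Algebra) : PreAlg T := ⟨Y.A, Y.A, Y.a⟩

/-- A morphism of algebras is a morphism of partial algebras. -/
def ofAlgebraHom {Y Z : T.Algebra} (h : Y ⟶ Z) : ofAlgebra Y ⟶ ofAlgebra Z :=
  (⟨h.f, h.f, h.h⟩ : Hom (ofAlgebra Y) (ofAlgebra Z))

theorem unitAt_act (Y : T.Algebra) : unitAt T Y.A ≫ Y.a = 𝟙 Y.A := Y.unit

theorem multAt_act (Y : T.Algebra) : multAt T Y.A ≫ Y.a = T.map Y.a ≫ Y.a := Y.assoc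

/-- Morphisms to an algebra are determined by their second component. -/
theorem hom_f {X : PreAlg T} {Y : T.Algebra} (p : X ⟶ ofAlgebra Y) :
    Hom.f p = unitAt T X.A ≫ X.a ≫ Hom.g p := by
  have h : Hom.f p ≫ unitAt T Y.A ≫ Y.a = (unitAt T X.A ≫ X.a) ≫ Hom.g p :=
    unit_square (Hom.w p)
  rw [← Category.assoc, ← h, unitAt_act]
  exact (Category.comp_id _).symm

/-- By `hom_f` the first component is `η ≫ a ≫ g`, and `η ≫ a` is the identity on an algebra, so the
two components coincide. -/
theorem ofAlgebraHom_surjective {Y Z : T.Algebra} (p : ofAlgebra Y ⟶ ofAlgebra Z) :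
    ∃ h : Y ⟶ Z, ofAlgebraHom h = p := by
  have h : Hom.f p = Hom.g p := by
    have := hom_f p
    rw [this]
    exact (Category.assoc _ _ _).symm.trans
      ((congrArg (· ≫ Hom.g p) (unitAt_act Y)).trans (Category.id_comp _))
  refine ⟨Monad.Algebra.Hom.mk (Hom.f p) ((Hom.w p).trans ?_), hom_ext rfl h⟩
  exact congrArg (Y.a ≫ ·) h.symm

/-! #### Colimits of partial algebras -/

section

variable {J : Type u'} [Category.{v'} J] [HasColimitsOfShape J C]
  (F : J ⥤ PreAlg T)

/-- The comparison of `T` with the colimit of first components. -/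
def colimComparison : colimit ((F ⋙ fst T) ⋙ T.toFunctor) ⟶ T.obj (colimit (F ⋙ fst T)) :=
  colimit.post (F ⋙ fst T) T.toFunctor

/-- The map between colimits induced by the structure maps. -/
def colimAct : colimit ((F ⋙ fst T) ⋙ T.toFunctor) ⟶ colimit (F ⋙ snd T) :=
  colimMap (Functor.whiskerLeft F (act T))

theorem ι_comparison (j : J) : colimit.ι ((F ⋙ fst T) ⋙ T.toFunctor) j ≫ colimComparison F =
    T.map (colimit.ι (F ⋙ fst T) j) := colimit.ι_post _ _ _

theorem ι_act (j : J) : colimit.ι ((F ⋙ fst T) ⋙ T.toFunctor) j ≫ colimAct F =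
    (F.obj j).a ≫ colimit.ι (F ⋙ snd T) j := ι_colimMap _ _

variable [HasPushouts C]

/-- The colimit of a diagram of partial algebras. -/
abbrev colim : PreAlg T where
  A := colimit (F ⋙ fst T)
  B := pushout (colimComparison F) (colimAct F)
  a := pushout.inl _ _

/-- The colimit cocone of a diagram of partial algebras. -/
def colimι (j : J) : F.obj j ⟶ colim F :=
  (⟨colimit.ι (F ⋙ fst T) j, colimit.ι (F ⋙ snd T) j ≫ pushout.inr _ _, by
    refine (congrArg (· ≫ pushout.inl _ _) (ι_comparison F j).symm).trans ?_
    refine Eq.trans ?_ (Category.assoc _ _ _)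
    refine Eq.trans ?_ (congrArg (· ≫ pushout.inr _ _) (ι_act F j))
    rw [Category.assoc, Category.assoc, pushout.condition]⟩ :
    Hom (F.obj j) (colim F))

/-- First components are formed by a plain colimit. As `T` need not preserve it, the structure map
out of `colim T A_j` must be extended along the comparison to `T (colim A_j)`, and the pushout does
this universally. -/
theorem hasColimit : HasColimit F := by
  let c : Cocone F := ⟨colim F, colimι F, fun i j f => by
    refine (hom_ext ?_ ?_ : F.map f ≫ colimι F j = colimι F i) |>.trans (Category.comp_id _).symm
    · exact colimit.w (F ⋙ fst T) f
    · exact (Category.assoc _ _ _).symm.trans (congrArg (· ≫ _) (colimit.w (F ⋙ snd T) f))⟩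
  refine ⟨⟨⟨c, ?_⟩⟩⟩
  let c1 (s : Cocone F) : Cocone (F ⋙ fst T) := (fst T).mapCocone s
  let c2 (s : Cocone F) : Cocone (F ⋙ snd T) := (snd T).mapCocone s
  have hw (s : Cocone F) : colimComparison F ≫ T.map (colimit.desc _ (c1 s)) ≫ s.pt.a =
      colimAct F ≫ colimit.desc _ (c2 s) := by
    refine colimit.hom_ext fun j => ?_
    have h1 : T.map (colimit.ι (F ⋙ fst T) j) ≫ T.map (colimit.desc _ (c1 s)) =
        T.map (Hom.f (s.ι.app j)) := by
      rw [← T.map_comp, colimit.ι_desc]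
      rfl
    have h2 : colimit.ι (F ⋙ snd T) j ≫ colimit.desc _ (c2 s) = Hom.g (s.ι.app j) :=
      colimit.ι_desc _ _
    refine (Category.assoc _ _ _).symm.trans ?_
    refine (congrArg (· ≫ _) (ι_comparison F j)).trans ?_
    refine (Category.assoc _ _ _).symm.trans ?_
    refine (congrArg (· ≫ s.pt.a) h1).trans ?_
    refine (Hom.w (s.ι.app j)).trans ?_
    refine (congrArg ((F.obj j).a ≫ ·) h2.symm).trans ?_
    refine Eq.trans ?_ (Category.assoc _ _ _)
    refine Eq.trans ?_ (congrArg (· ≫ _) (ι_act F j).symm)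
    exact (Category.assoc _ _ _).symm
  let d (s : Cocone F) : colim F ⟶ s.pt :=
    (⟨colimit.desc _ (c1 s), pushout.desc _ _ (hw s), (pushout.inl_desc _ _ _).symm⟩ :
      Hom (colim F) s.pt)
  refine ⟨d, fun s j => hom_ext ?_ ?_, fun s m hm => hom_ext ?_ ?_⟩
  · exact colimit.ι_desc (c1 s) j
  · refine (Category.assoc _ _ _).trans ?_
    refine (congrArg (_ ≫ ·) (pushout.inr_desc _ _ _)).trans ?_
    exact colimit.ι_desc (c2 s) j
  · refine colimit.hom_ext fun j => ?_
    exact (congrArg Hom.f (hm j)).trans (colimit.ι_desc (c1 s) j).symm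
  · have h1 : Hom.f m = colimit.desc _ (c1 s) := by
      refine colimit.hom_ext fun j => ?_
      exact (congrArg Hom.f (hm j)).trans (colimit.ι_desc (c1 s) j).symm
    refine pushout.hom_ext ?_ ?_
    · refine (Hom.w m).symm.trans ?_
      rw [h1]
      exact (pushout.inl_desc _ _ (hw s)).symm
    · refine Eq.trans ?_ (pushout.inr_desc _ _ (hw s)).symm
      refine colimit.hom_ext fun j => ?_
      refine (Category.assoc _ _ _).symm.trans ?_
      exact (congrArg Hom.g (hm j)).trans (colimit.ι_desc (c2 s) j).symm

end

instance {J : Type u'} [Category.{v'} J] [HasColimitsOfShape J C] [HasPushouts C] :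
    HasColimitsOfShape J (PreAlg T) := ⟨fun F => hasColimit F⟩

/-! #### The successor of a partial algebra -/

section

variable [HasCoequalizers C]

/-- The first of the two maps `T T A ⟶ T B` coequalized in the successor. -/
def succFst (X : PreAlg T) : T.obj (T.obj X.A) ⟶ T.obj X.B := T.map X.a

/-- The second of the two maps `T T A ⟶ T B` coequalized in the successor. -/
def succSnd (X : PreAlg T) : T.obj (T.obj X.A) ⟶ T.obj X.B :=
  multAt T X.A ≫ X.a ≫ unitAt T X.B

/-- The successor of a partial algebra `a : T A ⟶ B`: a quotient of `T B` on which the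
two composites out of `T T A` agree. -/
abbrev succ (X : PreAlg T) : PreAlg T where
  A := X.B
  B := coequalizer (succFst X) (succSnd X)
  a := coequalizer.π _ _

theorem succ_condition (X : PreAlg T) :
    T.map X.a ≫ (succ X).a = multAt T X.A ≫ X.a ≫ unitAt T X.B ≫ (succ X).a :=
  (coequalizer.condition (succFst X) (succSnd X)).trans (by
    simp only [succSnd, Category.assoc])

/-- The map from a partial algebra to its successor. -/
def toSucc (X : PreAlg T) : X ⟶ succ X :=
  (⟨unitAt T X.A ≫ X.a, unitAt T X.B ≫ (succ X).a, by
    rw [T.map_comp, Category.assoc, succ_condition, ← Category.assoc, map_unitAt_multAt,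
      Category.id_comp]⟩ : Hom X (succ X))

/-- The first component of a map out of the successor is the second component of its restriction to
`X`, which gives uniqueness. For existence, the second component `q` of a map from `X` extends to `T
q ≫ y` on `T B`, and associativity of `y` makes this factor through the coequalizer. -/
theorem toSucc_bijective (X : PreAlg T) (Y : T.Algebra) :
    Function.Bijective fun p : succ X ⟶ ofAlgebra Y => toSucc X ≫ p := by
  have hf : ∀ p : succ X ⟶ ofAlgebra Y, Hom.f p = Hom.g (toSucc X ≫ p) := fun p =>
    (hom_f p).trans (Category.assoc _ _ _).symm
  refine ⟨fun p q h => ?_, fun p => ?_⟩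
  · have h1 : Hom.f p = Hom.f q := by rw [hf, hf]; exact congrArg Hom.g h
    refine hom_ext h1 ?_
    have hp : T.map (Hom.f p) ≫ Y.a = (succ X).a ≫ Hom.g p := Hom.w p
    have hq : T.map (Hom.f q) ≫ Y.a = (succ X).a ≫ Hom.g q := Hom.w q
    refine coequalizer.hom_ext ?_
    exact hp.symm.trans ((congrArg (fun k => T.map k ≫ Y.a) h1).trans hq)
  · have hp : T.map (Hom.f p) ≫ Y.a = X.a ≫ Hom.g p := Hom.w p
    let q : X.B ⟶ Y.A := Hom.g p
    have hq : q ≫ unitAt T Y.A ≫ Y.a = q :=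
      (congrArg (q ≫ ·) (unitAt_act Y)).trans (Category.comp_id _)
    have e1 : unitAt T X.B ≫ T.map q ≫ Y.a = q := by
      rw [← Category.assoc, ← unitAt_naturality, Category.assoc, hq]
    -- Since `X.a ≫ q = T f ≫ y`, the left side is `T T f ≫ T y ≫ y = μ ≫ T f ≫ y = μ ≫ X.a ≫ q`. By
    -- `e1` this is the right side.
    have e2 : succFst X ≫ T.map q ≫ Y.a = succSnd X ≫ T.map q ≫ Y.a := by
      replace hp : T.map (Hom.f p) ≫ Y.a = X.a ≫ q := hp
      have h3 : T.map X.a ≫ T.map q ≫ Y.a = multAt T X.A ≫ X.a ≫ q := by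
        rw [← Category.assoc, ← T.map_comp, ← hp, T.map_comp, Category.assoc, ← multAt_act,
          ← Category.assoc, multAt_naturality, Category.assoc]
      refine h3.trans ?_
      simp only [succSnd, Category.assoc]
      rw [e1]
    refine ⟨(⟨q, coequalizer.desc _ e2, (coequalizer.π_desc _ _).symm⟩ :
      Hom (succ X) (ofAlgebra Y)), hom_ext ?_ ?_⟩
    · exact (Category.assoc _ _ _).trans (hom_f p).symm
    · refine (Category.assoc _ _ _).trans ?_
      exact (congrArg (unitAt T X.B ≫ ·) (coequalizer.π_desc _ e2)).trans e1

end

/-! #### Transfinite iteration of successors -/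

section

variable {J : Type w} [LinearOrder J] [SuccOrder J] {F : J ⥤ PreAlg T}
  (s : ∀ j, (F.obj j).B ⟶ (F.obj (Order.succ j)).A)
  (hs : ∀ j, (unitAt T (F.obj j).A ≫ (F.obj j).a) ≫ s j =
    Hom.f (F.map (homOfLE (Order.le_succ j))))
  (hs' : ∀ j, Hom.g (F.map (homOfLE (Order.le_succ j))) =
    s j ≫ unitAt T (F.obj (Order.succ j)).A ≫ (F.obj (Order.succ j)).a)

include hs hs'

/-- The maps `s j : B_j ⟶ A_{j+1}` interleave the chain of second components with that of first
components, so a cocone on the `A_j` yields one on the `B_j`. For `i < j` the comparison passes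
through `succ i`. -/
theorem chain_naturality {D : C} {α : ∀ j, (F.obj j).A ⟶ D}
    (hα : ∀ {i j : J} (h : i ≤ j), Hom.f (F.map (homOfLE h)) ≫ α j = α i) {i j : J} (h : i ≤ j) :
    Hom.g (F.map (homOfLE h)) ≫ s j ≫ α (Order.succ j) = s i ≫ α (Order.succ i) := by
  rcases h.eq_or_lt with rfl | h'
  · have : homOfLE h = 𝟙 i := rfl
    rw [this, F.map_id]
    exact Category.id_comp _
  · have h2 : Order.succ i ≤ j := Order.succ_le_of_lt h'
    have : homOfLE h = homOfLE (Order.le_succ i) ≫ homOfLE h2 := rfl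
    have h3 := unit_square (Hom.w (F.map (homOfLE h2)))
    have h4 := congrArg (· ≫ α (Order.succ j)) (hs j)
    rw [hα] at h4
    simp only [Category.assoc] at h4
    rw [this, F.map_comp, comp_g, hs', Category.assoc, Category.assoc, ← Category.assoc (_ ≫ _)
      (Hom.g _), ← h3]
    simp only [Category.assoc]
    rw [h4, hα]

omit hs' in
theorem unit_chain {D : C} {α : ∀ j, (F.obj j).A ⟶ D}
    (hα : ∀ {i j : J} (h : i ≤ j), Hom.f (F.map (homOfLE h)) ≫ α j = α i) (j : J) :
    unitAt T (F.obj j).A ≫ (F.obj j).a ≫ s j ≫ α (Order.succ j) = α j := by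
  have h4 := congrArg (· ≫ α (Order.succ j)) (hs j)
  rw [hα] at h4
  simpa only [Category.assoc] using h4

variable (hs'' : ∀ j, T.map (F.obj j).a ≫ T.map (s j) ≫ (F.obj (Order.succ j)).a =
    multAt T (F.obj j).A ≫ (F.obj j).a ≫ Hom.g (F.map (homOfLE (Order.le_succ j))))
  [PreservesColimitsOfShape J T.toFunctor]

-- The colimit of the first components, together with its images under `T` and `T T`, which remain
-- colimits because `T` preserves them. It is stated by equations so that later computations involve
-- no cocones.
omit [SuccOrder J] hs hs' in
theorem exists_colimit_fst [HasColimitsOfShape J C] :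
    ∃ (D : C) (α : ∀ j, (F.obj j).A ⟶ D),
      (∀ {i j : J} (h : i ≤ j), Hom.f (F.map (homOfLE h)) ≫ α j = α i) ∧
      (∀ {E : C} {p q : D ⟶ E}, (∀ j, α j ≫ p = α j ≫ q) → p = q) ∧
      (∀ {E : C} (γ : ∀ j, (F.obj j).A ⟶ E),
        (∀ {i j : J} (h : i ≤ j), Hom.f (F.map (homOfLE h)) ≫ γ j = γ i) →
        ∃ l : D ⟶ E, ∀ j, α j ≫ l = γ j) ∧
      (∀ {E : C} {p q : T.obj D ⟶ E}, (∀ j, T.map (α j) ≫ p = T.map (α j) ≫ q) → p = q) ∧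
      (∀ {E : C} (γ : ∀ j, T.obj (F.obj j).A ⟶ E),
        (∀ {i j : J} (h : i ≤ j), T.map (Hom.f (F.map (homOfLE h))) ≫ γ j = γ i) →
        ∃ l : T.obj D ⟶ E, ∀ j, T.map (α j) ≫ l = γ j) ∧
      (∀ {E : C} {p q : T.obj (T.obj D) ⟶ E},
        (∀ j, T.map (T.map (α j)) ≫ p = T.map (T.map (α j)) ≫ q) → p = q) := by
  let c := colimit.cocone (F ⋙ fst T)
  have hc : IsColimit c := colimit.isColimit _
  have hTc : IsColimit (T.toFunctor.mapCocone c) := isColimitOfPreserves _ hc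
  have hTTc : IsColimit (T.toFunctor.mapCocone (T.toFunctor.mapCocone c)) :=
    isColimitOfPreserves _ hTc
  refine ⟨c.pt, fun j => c.ι.app j, fun h => c.w (homOfLE h), fun h => hc.hom_ext h,
    fun γ hγ => ?_, fun h => hTc.hom_ext h, fun γ hγ => ?_, fun h => hTTc.hom_ext h⟩
  · exact ⟨hc.desc ⟨_, { app := γ, naturality := fun _ _ f =>
      (hγ (leOfHom f)).trans (Category.comp_id _).symm }⟩, fun j => hc.fac _ j⟩
  · exact ⟨hTc.desc ⟨_, { app := γ, naturality := fun _ _ f =>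
      (hγ (leOfHom f)).trans (Category.comp_id _).symm }⟩, fun j => hTc.fac _ j⟩

include hs''

/-- By interleaving, the chains `A_j` and `B_j` have the same colimit `D`, so the structure maps
converge to `T D ⟶ D`. The connecting maps give its unit law, and the relation imposed in each
successor, `hs''`, gives associativity. -/
theorem exists_isColimit_chain [HasColimitsOfShape J C] :
    ∃ (Z : T.Algebra) (ρ : ∀ j, F.obj j ⟶ ofAlgebra Z)
      (hρ : ∀ {i j : J} (f : i ⟶ j), F.map f ≫ ρ j = ρ i ≫ 𝟙 (ofAlgebra Z)),
      Nonempty (IsColimit (⟨ofAlgebra Z, { app := ρ, naturality := fun _ _ f => hρ f }⟩ :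
        Cocone F)) := by
  obtain ⟨D, α, hα, ext, desc, Text, Tdesc, TText⟩ := exists_colimit_fst (F := F)
  have hb := fun {i j : J} (h : i ≤ j) => chain_naturality s hs hs' hα h
  have hub := unit_chain s hs hα
  obtain ⟨β, hβ⟩ : ∃ β : ∀ j, (F.obj j).B ⟶ D, ∀ j, β j = s j ≫ α (Order.succ j) :=
    ⟨_, fun _ => rfl⟩
  simp only [← hβ] at hb hub
  -- As `T D` is the colimit of the `T A_j`, the maps `a_j ≫ β_j` induce the action.
  obtain ⟨z, hz⟩ := Tdesc (fun j => (F.obj j).a ≫ β j) (fun h => by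
    rw [← Category.assoc, Hom.w, Category.assoc, hb])
  let Z : T.Algebra :=
    { A := D
      a := z
      unit := by
        refine ext fun j => ?_
        change α j ≫ unitAt T D ≫ z = α j ≫ 𝟙 D
        rw [← Category.assoc, unitAt_naturality, Category.assoc, hz, hub, Category.comp_id]
      assoc := by
        refine TText fun j => ?_
        change T.map (T.map (α j)) ≫ multAt T D ≫ z = T.map (T.map (α j)) ≫ T.map z ≫ z
        rw [← Category.assoc, multAt_naturality, Category.assoc, ← Category.assoc (T.map (T.map _)),
          ← T.map_comp, hz, hβ, T.map_comp, T.map_comp, Category.assoc, Category.assoc, hz,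
          ← Category.assoc (T.map (s j)), ← Category.assoc (T.map (F.obj j).a), hs'' j,
          Category.assoc, Category.assoc, hb, hβ] }
  -- Each `α j` factors through `β j`, so the `β j` are jointly epimorphic because the `α j` are.
  have hbext : ∀ {E : C} {p q : D ⟶ E}, (∀ j, β j ≫ p = β j ≫ q) → p = q := by
    intro E p q h
    refine ext fun j => ?_
    rw [← hub j, Category.assoc, Category.assoc, h, Category.assoc, Category.assoc]
  have key : ∀ t : Cocone F, ∃ l : D ⟶ t.pt.A, ∃ r : D ⟶ t.pt.B,
      (∀ j, α j ≫ l = Hom.f (t.ι.app j)) ∧ (∀ j, β j ≫ r = Hom.g (t.ι.app j)) := by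
    intro t
    have ht : ∀ {i j : J} (h : i ≤ j), F.map (homOfLE h) ≫ t.ι.app j = t.ι.app i :=
      fun h => t.w (homOfLE h)
    have htf : ∀ {i j : J} (h : i ≤ j), Hom.f (F.map (homOfLE h)) ≫ Hom.f (t.ι.app j) =
      Hom.f (t.ι.app i) := fun h => congrArg Hom.f (ht h)
    have htg : ∀ {i j : J} (h : i ≤ j), Hom.g (F.map (homOfLE h)) ≫ Hom.g (t.ι.app j) =
      Hom.g (t.ι.app i) := fun h => congrArg Hom.g (ht h)
    obtain ⟨l, hl⟩ := desc (fun j => Hom.f (t.ι.app j)) htf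
    -- The second component must agree with `η ≫ a_j ≫ g_j` on `A_j`. Evaluating this at `succ j`
    -- after `s j` and using `hs'` recovers `g_j` on `B_j`.
    obtain ⟨r, hr⟩ := desc
      (fun j => (unitAt T (F.obj j).A ≫ (F.obj j).a) ≫ Hom.g (t.ι.app j)) (fun {i j} h => by
        rw [← Category.assoc, unit_square (Hom.w (F.map (homOfLE h))), Category.assoc, htg])
    refine ⟨l, r, hl, fun j => ?_⟩
    rw [hβ, Category.assoc, hr, ← htg (Order.le_succ j), hs', Category.assoc, Category.assoc]
    simp only [Category.assoc]
  choose l r hl hr using key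
  refine ⟨Z, fun j => (⟨α j, β j, hz j⟩ : Hom (F.obj j) (ofAlgebra Z)),
    fun {i j} f => hom_ext ((hα (leOfHom f)).trans (Category.comp_id _).symm)
      ((hb (leOfHom f)).trans (Category.comp_id _).symm), ⟨?_⟩⟩
  refine ⟨fun t => (⟨l t, r t, ?_⟩ : Hom (ofAlgebra Z) t.pt), fun t j => hom_ext (hl t j) (hr t j),
    fun t m hm => hom_ext ?_ ?_⟩
  · refine Text fun j => ?_
    refine (Category.assoc _ _ _).symm.trans ?_
    rw [← T.map_comp, hl]
    refine (Hom.w (t.ι.app j)).trans ?_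
    refine (congrArg ((F.obj j).a ≫ ·) (hr t j).symm).trans ?_
    exact (Category.assoc _ _ _).symm.trans
      ((congrArg (· ≫ r t) (hz j).symm).trans (Category.assoc _ _ _))
  · refine ext fun j => ?_
    exact (congrArg Hom.f (hm j)).trans (hl t j).symm
  · refine hbext fun j => ?_
    exact (congrArg Hom.g (hm j)).trans (hr t j).symm

end

/-- Every partial algebra has a reflection in the category of algebras. -/
theorem exists_reflection [HasColimitsOfSize.{w, w} C] (hT : T.toFunctor.IsAccessible.{w})
    (X : PreAlg T) : ∃ (Z : T.Algebra) (r : X ⟶ ofAlgebra Z), ∀ Y : T.Algebra,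
      Function.Bijective fun p : ofAlgebra Z ⟶ ofAlgebra Y => r ≫ p := by
  obtain ⟨κ, _, _⟩ := hT
  have : HasFiniteColimits C := hasFiniteColimits_of_hasColimitsOfSize.{w, w} C
  have : Nonempty κ.ord.ToType := by simpa using Cardinal.IsRegular.ne_zero Fact.out
  have := WellFoundedLT.toOrderBot κ.ord.ToType
  have : NoMaxOrder κ.ord.ToType :=
    Cardinal.noMaxOrder (Fact.elim inferInstance : κ.IsRegular).aleph0_le
  -- The well-order of the regular cardinal `κ` is `κ`-filtered, so the `κ`-accessible functor `T`
  -- preserves colimits along it.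
  have : PreservesColimitsOfShape κ.ord.ToType T.toFunctor :=
    Functor.preservesColimitsOfShape_of_isCardinalAccessible _ κ _
  have : HasColimitsOfSize.{w, w} (PreAlg T) := ⟨fun J _ => inferInstance⟩
  let Φ : SmallObject.SuccStruct (PreAlg T) := ⟨X, succ, toSucc⟩
  let F := Φ.iterationFunctor κ.ord.ToType
  let e : ∀ j, F.obj (Order.succ j) ≅ succ (F.obj j) :=
    fun j => Φ.iterationFunctorObjSuccIso j (not_isMax j)
  have he : ∀ j, F.map (homOfLE (Order.le_succ j)) = toSucc (F.obj j) ≫ (e j).inv :=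
    fun j => Φ.iterationFunctor_map_succ j (not_isMax j)
  have hg : ∀ j, Hom.g (F.map (homOfLE (Order.le_succ j))) =
      (unitAt T (F.obj j).B ≫ (succ (F.obj j)).a) ≫ Hom.g (e j).inv := fun j =>
    congrArg Hom.g (he j)
  -- The first component of a successor is `B_j` itself, so the connecting map `B_j ⟶ A_{j+1}` is
  -- the first component of the isomorphism `succ (F j) ≅ F (j+1)`.
  obtain ⟨Z, ρ, hρ, ⟨hZ⟩⟩ := exists_isColimit_chain (F := F) (fun j => Hom.f (e j).inv)
    (fun j => (congrArg Hom.f (he j)).symm)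
    (fun j => (hg j).trans (unit_square (Hom.w (e j).inv)).symm) (fun j => by
      have hw : T.map (Hom.f (e j).inv) ≫ (F.obj (Order.succ j)).a =
        (succ (F.obj j)).a ≫ Hom.g (e j).inv := Hom.w (e j).inv
      rw [hg, hw, ← Category.assoc, succ_condition]
      simp only [Category.assoc])
  -- Morphisms inverted by mapping into every algebra are closed under transfinite composition. Each
  -- successor step is of this kind, hence so is the map from `X` to the colimit, which is itself an
  -- algebra.
  let P : ObjectProperty (PreAlg T) := fun Y => ∃ Y', Y = ofAlgebra Y'
  let H : P.isLocal.TransfiniteCompositionOfShape κ.ord.ToType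
      ((Φ.iterationFunctorObjBotIso _).inv ≫ ρ ⊥) :=
    { F := F
      isoBot := Φ.iterationFunctorObjBotIso _
      incl := { app := ρ, naturality := fun _ _ f => hρ f }
      isColimit := hZ
      map_mem := fun j hj => by
        have h := ((Φ.transfiniteCompositionOfShapeιIteration κ.ord.ToType).ofLE
          (W' := P.isLocal) (by
            rintro _ _ _ ⟨_⟩ _ ⟨Y, rfl⟩
            exact toSucc_bijective _ _)).map_mem j hj
        exact h }
  exact ⟨Z, _, fun Y => P.isLocal.transfiniteCompositionsOfShape_le κ.ord.ToType _ ⟨H⟩ _ ⟨Y, rfl⟩⟩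

end PreAlg

end

end EnrichedGraph

namespace EnrichedGraph

/-! ### Multimaps of algebras -/

section

variable {A : Type u} [Category.{w} A] {U : A ⥤ Type w} {T : Monad A}

theorem map_act (B C : T.Algebra) (h : B ⟶ C) : T.map h.f ≫ C.a = B.a ≫ h.f := h.h

namespace MultiMap

/-- The multimap underlying a multimap of algebras. -/
def under {n : ℕ} {B : Fin n → T.Algebra} {C : T.Algebra} (f : MultiMap (T.forget ⋙ U) B C) :
    MultiMap U (fun i => (B i).A) C.A where
  fn := f.fn
  lin i z := (f.lin i z).f
  map_lin := f.map_lin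

variable {n : ℕ} {B : Fin n → T.Algebra} {C : T.Algebra}

theorem under_injective {f g : MultiMap (T.forget ⋙ U) B C} (h : f.under = g.under) : f = g :=
  ext (fun x => congrFun (congrArg fn h) x)
    fun i z => Monad.Algebra.Hom.ext' _ _ _ _ (congrFun (congrFun (congrArg lin h) i) z)

theorem under_post (f : MultiMap (T.forget ⋙ U) B C) {D : T.Algebra} (h : C ⟶ D) :
    (f.post h).under = f.under.post h.f := rfl

theorem under_comp {n N : ℕ} {m : Fin n → ℕ} (β : Blocks m N) {X : Fin N → T.Algebra}
    {B : Fin n → T.Algebra} {C : T.Algebra} (f : MultiMap (T.forget ⋙ U) B C)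
    (g : ∀ i, MultiMap (T.forget ⋙ U) (fun j => X (β i j)) (B i)) :
    (comp β f g).under = comp β f.under (fun i => (g i).under) :=
  ext_along β (fun _ => rfl) fun i j z => by
    rw [comp_lin]
    exact congrArg Monad.Algebra.Hom.f (comp_lin β f g i j z)

/-- A multimap whose linear parts are morphisms of algebras is a multimap of algebras. -/
def ofLinAlg (g : MultiMap U (fun i => (B i).A) C.A)
    (h : ∀ i z, T.map (g.lin i z) ≫ C.a = (B i).a ≫ g.lin i z) : MultiMap (T.forget ⋙ U) B C where
  fn := g.fn
  lin i z := Monad.Algebra.Hom.mk (g.lin i z) (h i z)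
  map_lin := g.map_lin

theorem under_ofLinAlg (g : MultiMap U (fun i => (B i).A) C.A)
    (h : ∀ i z, T.map (g.lin i z) ≫ C.a = (B i).a ≫ g.lin i z) : (ofLinAlg g h).under = g := rfl

end MultiMap

namespace OverSet

variable (θ : OverSet U T)

/-- On elements the unit of `T` is the identification `into`. The unit law makes the action a
retraction of it, hence its inverse. -/
theorem map_act_eq_out (B : T.Algebra) (z : U.obj (T.obj B.A)) : U.map B.a z = θ.out z := by
  have h : U.map (unitAt T B.A) ≫ U.map B.a = 𝟙 _ := by
    rw [← U.map_comp, PreAlg.unitAt_act, U.map_id]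
  have h2 : U.map B.a (U.map (unitAt T B.A) (θ.out z)) = θ.out z :=
    congrArg (fun k => k (θ.out z)) h
  rwa [θ.map_η_eq, θ.into_out] at h2

variable {n : ℕ} {B : Fin n → T.Algebra} {C : T.Algebra}

/-- A multimap between algebras is a multimap of algebras when it commutes with the actions. -/
theorem mapMulti_post_act_iff (g : MultiMap U (fun i => (B i).A) C.A) :
    (θ.mapMulti g).post C.a = g.pre (fun i => (B i).a) ↔
      ∀ i z, T.map (g.lin i z) ≫ C.a = (B i).a ≫ g.lin i z := by
  constructor
  · intro h i z
    have h1 := congrFun (congrFun (congrArg MultiMap.lin h) i) (fun k => θ.into (z k))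
    simpa [MultiMap.post, MultiMap.pre, mapMulti, θ.map_act_eq_out] using h1
  · intro h
    refine MultiMap.ext (fun x => ?_) fun i z => ?_
    · simp [MultiMap.post, MultiMap.pre, mapMulti, θ.map_act_eq_out]
    · simpa [MultiMap.post, MultiMap.pre, mapMulti, θ.map_act_eq_out] using h i _

variable (R : Representation U)

/-- Restricting along the universal multimap turns `φ` into the action of `T` on multimaps, and the
equation into the statement that every linear part is an algebra morphism. `exists_under` is the
converse. -/
theorem φ_desc_under (f : MultiMap (T.forget ⋙ U) B C) :
    θ.φ R (fun i => (B i).A) ≫ T.map (R.desc f.under) ≫ C.a =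
      R.map (fun i => (B i).a) ≫ R.desc f.under := by
  refine R.hom_ext ?_
  rw [← MultiMap.post_post, univ_φ, ← MultiMap.post_post, mapMulti_post, R.univ_desc,
    ← MultiMap.post_post, R.univ_map, MultiMap.pre_post, R.univ_desc]
  exact (θ.mapMulti_post_act_iff f.under).2 fun i z => (f.lin i z).h

theorem exists_under (p : R.tens (fun i => (B i).A) ⟶ C.A)
    (hp : θ.φ R (fun i => (B i).A) ≫ T.map p ≫ C.a = R.map (fun i => (B i).a) ≫ p) :
    ∃ f : MultiMap (T.forget ⋙ U) B C, R.desc f.under = p := by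
  refine ⟨MultiMap.ofLinAlg ((R.univ _).post p) ((θ.mapMulti_post_act_iff _).1 ?_), ?_⟩
  · rw [← mapMulti_post, ← univ_φ θ R, MultiMap.post_post, MultiMap.post_post, hp,
      ← MultiMap.post_post, R.univ_map, MultiMap.pre_post]
  · refine R.hom_ext ?_
    rw [R.univ_desc, MultiMap.under_ofLinAlg]

theorem map_unit_map_act (B : Fin n → T.Algebra) :
    R.map (fun i => unitAt T (B i).A) ≫ R.map (fun i => (B i).a) = 𝟙 _ := by
  rw [← R.map_comp]
  simp only [PreAlg.unitAt_act]
  exact R.map_id _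

/-! ### The partial algebra classifying multimaps of algebras -/

section

variable [HasPushouts A] (B)

/-- The partial algebra whose morphisms to an algebra are the multimaps of algebras. -/
abbrev multiPreAlg : PreAlg T where
  A := R.tens (fun i => (B i).A)
  B := pushout (θ.φ R (fun i => (B i).A)) (R.map (fun i => (B i).a))
  a := pushout.inl _ _

variable {B}

/-- Precomposing the pushout square with `⊗η` turns `φ` into `η` and `⊗b_i` into the identity, so
`inr = η ≫ inl`; then `PreAlg.hom_f` applies. Consequently a morphism to an algebra amounts to its
first component, and the only condition left is the one characterising multimaps of algebras. -/
theorem multiPreAlg_inr {Y : T.Algebra} (k : θ.multiPreAlg B R ⟶ PreAlg.ofAlgebra Y) :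
    pushout.inr (θ.φ R (fun i => (B i).A)) (R.map (fun i => (B i).a)) ≫ PreAlg.Hom.g k =
      PreAlg.Hom.f k := by
  rw [PreAlg.hom_f]
  have h : R.map (fun i => (B i).a) ≫ pushout.inr (θ.φ R (fun i => (B i).A)) _ =
    θ.φ R _ ≫ pushout.inl _ _ := pushout.condition.symm
  have h2 := congrArg (R.map (fun i => unitAt T (B i).A) ≫ ·) h
  simp only [← Category.assoc, map_unit_map_act, Category.id_comp, θ.map_η_φ] at h2
  rw [h2, Category.assoc]

theorem multiPreAlg_hom_ext {Y : T.Algebra} {k k' : θ.multiPreAlg B R ⟶ PreAlg.ofAlgebra Y}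
    (h : PreAlg.Hom.f k = PreAlg.Hom.f k') : k = k' := by
  refine PreAlg.hom_ext h (pushout.hom_ext ?_ ?_)
  · have h1 : T.map (PreAlg.Hom.f k) ≫ Y.a = pushout.inl _ _ ≫ PreAlg.Hom.g k := PreAlg.Hom.w k
    have h2 : T.map (PreAlg.Hom.f k') ≫ Y.a = pushout.inl _ _ ≫ PreAlg.Hom.g k' := PreAlg.Hom.w k'
    exact h1.symm.trans ((congrArg (fun p => T.map p ≫ Y.a) h).trans h2)
  · rw [multiPreAlg_inr, multiPreAlg_inr, h]

theorem φ_multiPreAlg {Y : T.Algebra} (k : θ.multiPreAlg B R ⟶ PreAlg.ofAlgebra Y) :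
    θ.φ R (fun i => (B i).A) ≫ T.map (PreAlg.Hom.f k) ≫ Y.a =
      R.map (fun i => (B i).a) ≫ PreAlg.Hom.f k := by
  have h1 : T.map (PreAlg.Hom.f k) ≫ Y.a = pushout.inl _ _ ≫ PreAlg.Hom.g k := PreAlg.Hom.w k
  rw [← θ.multiPreAlg_inr R k, ← Category.assoc (R.map _), ← pushout.condition, Category.assoc,
    ← h1, multiPreAlg_inr]

end

/-- For an accessible monad over `Set`, there are universal multimaps of algebras. -/
theorem exists_isUniversal (θ : OverSet U T) (R : Representation U) [HasColimitsOfSize.{w, w} A]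
    (hT : T.toFunctor.IsAccessible.{w}) (B : Fin n → T.Algebra) :
    ∃ (Z : T.Algebra) (f : MultiMap (T.forget ⋙ U) B Z), f.IsUniversal := by
  have : HasFiniteColimits A := hasFiniteColimits_of_hasColimitsOfSize.{w, w} A
  obtain ⟨Z, r, hr⟩ := PreAlg.exists_reflection hT (θ.multiPreAlg B R)
  -- The reflection map, read as a multimap of algebras, is the candidate; its universality is that
  -- of the reflection.
  obtain ⟨F, hF⟩ := θ.exists_under R (PreAlg.Hom.f r) (θ.φ_multiPreAlg R r)
  have hF' : F.under = (R.univ _).post (PreAlg.Hom.f r) := by rw [← hF, R.univ_desc]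
  refine ⟨Z, F, fun Y => ⟨fun h h' e => ?_, fun f => ?_⟩⟩
  · have e1 : PreAlg.Hom.f r ≫ h.f = PreAlg.Hom.f r ≫ h'.f := by
      refine R.hom_ext ?_
      rw [← MultiMap.post_post, ← MultiMap.post_post, ← hF']
      exact congrArg MultiMap.under e
    have e2 : r ≫ PreAlg.ofAlgebraHom h = r ≫ PreAlg.ofAlgebraHom h' :=
      θ.multiPreAlg_hom_ext R e1
    exact Monad.Algebra.Hom.ext' _ _ _ _ (congrArg PreAlg.Hom.f ((hr Y).1 e2))
  · obtain ⟨q, hq⟩ := (hr Y).2 (⟨R.desc f.under, pushout.desc (T.map (R.desc f.under) ≫ Y.a)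
      (R.desc f.under) (θ.φ_desc_under R f), (pushout.inl_desc _ _ _).symm⟩ :
        PreAlg.Hom (θ.multiPreAlg B R) (PreAlg.ofAlgebra Y))
    obtain ⟨h, rfl⟩ := PreAlg.ofAlgebraHom_surjective q
    refine ⟨h, MultiMap.under_injective ?_⟩
    refine (MultiMap.under_post F h).trans ?_
    rw [hF', MultiMap.post_post]
    refine Eq.trans ?_ (R.univ_desc f.under)
    exact congrArg (R.univ _).post (congrArg PreAlg.Hom.f hq)

end OverSet

end

end EnrichedGraph

namespace EnrichedGraph

/-! ### Inverse images along functions, and representability for algebras -/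

section

variable {A : Type u} [Category.{w} A]

/-- A morphism of a category over `Set` is cartesian when morphisms lift through it uniquely along
liftings of their underlying functions. -/
def IsCartesianOver (U : A ⥤ Type w) {X Y : A} (c : X ⟶ Y) : Prop :=
  ∀ (W : A) (g : W ⟶ Y) (o : U.obj W → U.obj X), (∀ x, U.map g x = U.map c (o x)) →
    ∃ h : W ⟶ X, h ≫ c = g ∧ (∀ x, U.map h x = o x) ∧
      ∀ h' : W ⟶ X, h' ≫ c = g → (∀ x, U.map h' x = o x) → h' = h

/-- Objects of a category over `Set` have inverse images along functions to their underlying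
sets. -/
def HasInverseImages (U : A ⥤ Type w) : Prop :=
  ∀ (Y : A) (P : Type w) (f : P → U.obj Y), ∃ (X : A) (e : P ≃ U.obj X) (c : X ⟶ Y),
    (∀ p, U.map c (e p) = f p) ∧ IsCartesianOver U c

variable {U : A ⥤ Type w} {T : Monad A}

theorem IsCartesianOver.hom_ext {X Y : A} {c : X ⟶ Y} (hc : IsCartesianOver U c) {W : A}
    {h h' : W ⟶ X} (e : h ≫ c = h' ≫ c) (e' : ∀ x, U.map h x = U.map h' x) : h = h' := by
  obtain ⟨k, -, -, hk⟩ := hc W (h' ≫ c) (fun x => U.map h' x) (fun x => by simp)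
  rw [hk h e e', hk h' rfl fun _ => rfl]

/-- `T X` has the elements of `X`, so `T c ≫ y` lifts through the cartesian `c` over the
identification of elements, and this lift is the action on `X`. The algebra laws and the lifting of
algebra morphisms follow from uniqueness of cartesian lifts. -/
theorem OverSet.hasInverseImages (θ : OverSet U T) (hU : HasInverseImages U) :
    HasInverseImages (T.forget ⋙ U) := by
  intro Y P f
  obtain ⟨X, e, c, hf, hc⟩ := hU Y.A P f
  obtain ⟨a, ha, ha', -⟩ := hc (T.obj X) (T.map c ≫ Y.a) θ.out (fun x => by
    simp [θ.map_act_eq_out, θ.out_map])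
  have hu : unitAt T X ≫ a = 𝟙 X := hc.hom_ext (by
    rw [Category.id_comp, Category.assoc, ha, ← Category.assoc, ← unitAt_naturality,
      Category.assoc, PreAlg.unitAt_act, Category.comp_id]) (fun x => by
    rw [U.map_comp, ConcreteCategory.comp_apply, ha', U.map_id]
    exact θ.out_η x)
  have hm : multAt T X ≫ a = T.map a ≫ a := hc.hom_ext (by
    rw [Category.assoc, Category.assoc, ha, ← Category.assoc (T.map a), ← T.map_comp, ha,
      ← Category.assoc, ← multAt_naturality, Category.assoc, PreAlg.multAt_act, T.map_comp,
      Category.assoc]) (fun x => by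
    rw [U.map_comp, U.map_comp, ConcreteCategory.comp_apply, ConcreteCategory.comp_apply, ha', ha',
      θ.out_map, ha']
    exact θ.out_μ x)
  let X' : T.Algebra := { A := X, a := a, unit := hu, assoc := hm }
  refine ⟨X', e, Monad.Algebra.Hom.mk (A := X') (B := Y) c ha.symm, hf, fun W g o ho => ?_⟩
  obtain ⟨h, h1, h2, h3⟩ := hc W.A g.f o ho
  refine ⟨Monad.Algebra.Hom.mk (A := W) (B := X') h (hc.hom_ext ?_ fun x => ?_),
    Monad.Algebra.Hom.ext' _ _ _ _ h1, h2, fun h' e1 e2 =>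
      Monad.Algebra.Hom.ext' _ _ _ _ (h3 h'.f (congrArg Monad.Algebra.Hom.f e1) e2)⟩
  · rw [Category.assoc, Category.assoc, h1]
    refine (congrArg (T.map h ≫ ·) ha).trans ?_
    rw [← Category.assoc, ← T.map_comp, h1]
    exact g.h
  · rw [U.map_comp, U.map_comp, ConcreteCategory.comp_apply, ConcreteCategory.comp_apply,
      h2, θ.map_act_eq_out, ← h2]
    exact (θ.out_map _ _).trans (congrArg (U.map h) (θ.map_act_eq_out W x).symm)

open VGraph in
theorem MultiMap.map_lin_insertAt {n : ℕ} {X : Fin n → A} {c : A} (F : MultiMap U X c) (i : Fin n)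
    (z : ∀ k : {k // k ≠ i}, U.obj (X k)) (a : U.obj (X i)) :
    U.map (F.lin i z) a = F.fn (insertAt (S := fun i => U.obj (X i)) i z a) := by
  have hz : (fun k : {k // k ≠ i} => insertAt (S := fun i => U.obj (X i)) i z a k) = z :=
    funext fun k => insertAt_ne (S := fun i => U.obj (X i)) i z a k k.2
  rw [← F.map_lin _ i, hz, insertAt_self]

open VGraph in
/-- In the presence of inverse images, universal multimaps are bijective on elements. -/
theorem MultiMap.IsUniversal.bijective_fn (hU : HasInverseImages U) {n : ℕ} {X : Fin n → A} {Z : A}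
    {F : MultiMap U X Z} (hF : F.IsUniversal) : Function.Bijective F.fn := by
  -- Pull `Z` back along `F.fn`, so that the multimap factors as `F'`, bijective on elements,
  -- followed by `c`. Universality of `F` gives `h` with `F.post h = F'`.
  obtain ⟨Y, e, c, hf, hc⟩ := hU Z (∀ i, U.obj (X i)) F.fn
  choose l hl1 hl2 hl3 using fun i (z : ∀ k : {k // k ≠ i}, U.obj (X k)) =>
    hc (X i) (F.lin i z) (fun a => e (insertAt (S := fun i => U.obj (X i)) i z a))
      (fun a => by rw [hf, F.map_lin_insertAt])
  let F' : MultiMap U X Y :=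
    { fn := e
      lin := l
      map_lin := fun x i =>
        (hl2 _ _ _).trans (congrArg e (insertAt_eq (S := fun i => U.obj (X i)) i x)) }
  obtain ⟨h, hh⟩ := (hF _).2 F'
  have hh' : F.post h = F' := hh
  have h1 : F'.post c = F := MultiMap.ext hf hl1
  -- Injectivity of `F.fn` follows from `h` carrying it to the bijection `e`. Surjectivity follows
  -- from this section identity, since `c` restricts to `F.fn` along `e`.
  have h2 : h ≫ c = 𝟙 Z := (hF _).1 (by
    dsimp only
    rw [← MultiMap.post_post, hh', h1, MultiMap.post_id])
  have h3 : ∀ x, U.map h (F.fn x) = e x := fun x => congrFun (congrArg MultiMap.fn hh') x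
  refine ⟨fun x y exy => e.injective ?_, fun z => ⟨e.symm (U.map h z), ?_⟩⟩
  · rw [← h3, exy, h3]
  · rw [← hf, Equiv.apply_symm_apply, ← ConcreteCategory.comp_apply, ← U.map_comp, h2]
    simp

/-- The multicategory of algebras of an accessible monad over `Set` is representable. -/
theorem OverSet.nonempty_representation [HasColimitsOfSize.{w, w} A] (θ : OverSet U T)
    (hT : T.toFunctor.IsAccessible.{w}) (hU : HasInverseImages U) (R : Representation U) :
    Nonempty (Representation (T.forget ⋙ U)) := by
  choose Z f hf using fun (n : ℕ) (B : Fin n → T.Algebra) => θ.exists_isUniversal R hT B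
  exact ⟨{
    tens := fun X => Z _ X
    univ := fun X => f _ X
    universal := fun X => hf _ X
    -- Composites need the inner universal multimaps to be bijective on elements: the linear parts
    -- of a multimap out of tensor products depend on elements of those products.
    comp_universal := fun β X => MultiMap.comp_isUniversal β (hf _ _) (fun _ => hf _ _)
      (fun _ => (hf _ _).bijective_fn (θ.hasInverseImages hU)) }⟩

end

/-! ### Inverse images of enriched graphs -/

namespace VGraph

variable {V : Type u} [Category.{w} V]

theorem comp_eqToHom_eq_iff {X Y Z : V} (f : X ⟶ Y) (g : X ⟶ Z) (h : Y = Z) :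
    f ≫ eqToHom h = g ↔ f = g ≫ eqToHom h.symm := by
  subst h
  simp

/-- The pullback of `Y` along `f` takes the homs of `Y` between images; the cartesian morphism is
the identity on homs. -/
theorem hasInverseImages_objects (V : Type u) [Category.{w} V] : HasInverseImages (objects V) := by
  intro Y P f
  let f' : P → Y.ob := f
  let X : VGraph V := ⟨P, fun p q => Y.hom (f' p) (f' q)⟩
  let c : X ⟶ Y := (⟨f', fun _ _ => 𝟙 _⟩ : Hom X Y)
  refine ⟨X, Equiv.refl _, c, fun _ => rfl, fun W g o ho => ?_⟩
  let o' : W.ob → P := o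
  have ho' : ∀ x, Hom.ob g x = f' (o' x) := ho
  refine ⟨(⟨o', fun a b => Hom.hom g a b ≫ eqToHom (congrArg₂ Y.hom (ho' a) (ho' b))⟩ : Hom W X),
    hom_ext (fun a => (ho' a).symm) fun a b => ?_, fun _ => rfl, fun h' e1 e2 => ?_⟩
  · refine (comp_eqToHom_eq_iff _ _ _).2 ?_
    exact Category.comp_id _
  · refine hom_ext e2 fun a b => ?_
    refine (comp_eqToHom_eq_iff _ _ _).2 ?_
    have h1 : Hom.hom h' a b ≫ 𝟙 _ = Hom.hom g a b ≫ eqToHom _ := hom_congr e1 a b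
    refine (Category.comp_id _).symm.trans (h1.trans ?_)
    refine Eq.trans ?_ (Category.assoc _ _ _).symm
    exact congrArg (_ ≫ ·) (eqToHom_trans _ _).symm

end VGraph

end EnrichedGraph

namespace EnrichedGraph

/-! ### Distributivity of free products -/

section

variable {A : Type u} [Category.{w} A] {U : A ⥤ Type w}

/-- In the presence of inverse images, coproduct inclusions are jointly bijective on elements. -/
theorem HasInverseImages.bijective_inj (hU : HasInverseImages U) {J : Type w} {Y : J → A}
    {c : Cofan Y} (hc : IsColimit c) :
    Function.Bijective (fun p : Σ j, U.obj (Y j) => U.map (c.inj p.1) p.2) := by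
  -- Pull the coproduct back along the joint map from the disjoint union of elements. The inclusions
  -- lift to this pullback, and the induced map from the coproduct is a section of `d`, as for
  -- universal multimaps.
  obtain ⟨X, e, d, hf, hd⟩ := hU c.pt (Σ j, U.obj (Y j)) (fun p => U.map (c.inj p.1) p.2)
  choose l hl1 hl2 hl3 using fun j => hd (Y j) (c.inj j) (fun y => e ⟨j, y⟩)
    fun y => (hf ⟨j, y⟩).symm
  have h1 : Cofan.IsColimit.desc hc l ≫ d = 𝟙 c.pt := Cofan.IsColimit.hom_ext hc _ _ fun j => by
    rw [← Category.assoc, Cofan.IsColimit.fac, hl1]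
    exact (Category.comp_id _).symm
  have h2 : ∀ p : Σ j, U.obj (Y j),
      U.map (Cofan.IsColimit.desc hc l) (U.map (c.inj p.1) p.2) = e p := fun p => by
    rw [← ConcreteCategory.comp_apply, ← U.map_comp, Cofan.IsColimit.fac, hl2]
  refine ⟨fun p q epq => e.injective ?_, fun x =>
    ⟨e.symm (U.map (Cofan.IsColimit.desc hc l) x), ?_⟩⟩
  · exact (h2 p).symm.trans ((congrArg (U.map (Cofan.IsColimit.desc hc l)) epq).trans (h2 q))
  · dsimp only
    rw [← hf, Equiv.apply_symm_apply, ← ConcreteCategory.comp_apply, ← U.map_comp, h1]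
    simp

variable {n : ℕ} {J : Fin n → Type w} {Y : ∀ i, J i → A} {c : ∀ i, Cofan (Y i)}

-- Puts every restricted linear part over a choice of summand in each variable: the elements `z`
-- determine the summands of the other variables, and `j` is inserted at position `i`.
open VGraph in
theorem exists_summands
    (hb : ∀ i, Function.Bijective (fun p : Σ j, U.obj (Y i j) => U.map ((c i).inj p.1) p.2))
    (i : Fin n) (z : ∀ k : {k // k ≠ i}, U.obj (c k).pt) (j : J i) :
    ∃ (f : ∀ k, J k) (w : ∀ k : {k // k ≠ i}, U.obj (Y k (f k))),
      f i = j ∧ z = fun k : {k // k ≠ i} => U.map ((c k).inj (f k)) (w k) := by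
  choose q hq using fun k : {k // k ≠ i} => (hb k).2 (z k)
  let f := insertAt (S := J) i (fun k => (q k).1) j
  have hf : ∀ k : {k // k ≠ i}, ∃ w : U.obj (Y k (f k)), z k = U.map ((c k).inj (f k)) w := by
    intro k
    have h : f k = (q k).1 := insertAt_ne (S := J) i _ j k k.2
    rw [h]
    exact ⟨(q k).2, (hq k).symm⟩
  choose w hw using hf
  exact ⟨f, w, insertAt_self (S := J) i _ j, funext hw⟩

/-- Multimaps out of coproducts are determined by their restrictions to summands. -/
theorem MultiMap.cofan_ext (hc : ∀ i, IsColimit (c i))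
    (hb : ∀ i, Function.Bijective (fun p : Σ j, U.obj (Y i j) => U.map ((c i).inj p.1) p.2))
    {D : A} {M M' : MultiMap U (fun i => (c i).pt) D}
    (h : ∀ f : ∀ i, J i, M.pre (fun i => (c i).inj (f i)) = M'.pre (fun i => (c i).inj (f i))) :
    M = M' := by
  refine MultiMap.ext (fun x => ?_) fun i z => Cofan.IsColimit.hom_ext (hc i) _ _ fun j => ?_
  · choose q hq using fun k => (hb k).2 (x k)
    obtain rfl : (fun k => U.map ((c k).inj (q k).1) (q k).2) = x := funext hq
    exact congrFun (congrArg MultiMap.fn (h fun k => (q k).1)) fun k => (q k).2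
  · obtain ⟨f, w, rfl, rfl⟩ := exists_summands hb i z j
    exact congrFun (congrFun (congrArg MultiMap.lin (h f)) i) w

/-- Multimaps on summands assemble to a multimap out of coproducts. -/
theorem MultiMap.exists_cofan_desc (hc : ∀ i, IsColimit (c i))
    (hb : ∀ i, Function.Bijective (fun p : Σ j, U.obj (Y i j) => U.map ((c i).inj p.1) p.2))
    {D : A} (m : ∀ f : ∀ i, J i, MultiMap U (fun i => Y i (f i)) D) :
    ∃ M : MultiMap U (fun i => (c i).pt) D, ∀ f, M.pre (fun i => (c i).inj (f i)) = m f := by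
  -- The linear part on the summand `j` is dictated by any pair `(f, w)` lying over `(z, j)`. Joint
  -- bijectivity of the inclusions makes that pair unique, so there is no conflict; the transport
  -- appears because `f i = j` need not hold by definition.
  have hg : ∀ i (z : ∀ k : {k // k ≠ i}, U.obj (c k).pt) (j : J i), ∃ g : Y i j ⟶ D,
      ∀ (f : ∀ k, J k) (w : ∀ k : {k // k ≠ i}, U.obj (Y k (f k))) (h : f i = j),
        (z = fun k : {k // k ≠ i} => U.map ((c k).inj (f k)) (w k)) →
          eqToHom (by rw [h]) ≫ g = (m f).lin i w := by
    intro i z j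
    obtain ⟨f₀, w₀, rfl, rfl⟩ := exists_summands hb i z j
    refine ⟨(m f₀).lin i w₀, fun f w h hw => ?_⟩
    have h1 : ∀ k : {k // k ≠ i}, (⟨f₀ k, w₀ k⟩ : Σ j, U.obj (Y k j)) = ⟨f k, w k⟩ := fun k =>
      (hb k).1 (congrFun hw k)
    obtain rfl : f = f₀ := by
      funext k
      by_cases hk : k = i
      · subst hk
        exact h
      · exact (congrArg Sigma.fst (h1 ⟨k, hk⟩)).symm
    obtain rfl : w = w₀ := funext fun k => (eq_of_heq (Sigma.mk.inj (h1 k)).2).symm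
    rw [eqToHom_refl, Category.id_comp]
  choose g hg using hg
  have hg' : ∀ i f (w : ∀ k : {k // k ≠ i}, U.obj (Y k (f k))),
      g i (fun k : {k // k ≠ i} => U.map ((c k).inj (f k)) (w k)) (f i) = (m f).lin i w :=
    fun i f w => by simpa using hg i _ (f i) f w rfl rfl
  -- `q i` locates an element of the `i`-th coproduct in its summand, and thereby selects which `m
  -- f` gives the underlying function.
  choose q hq using fun i => (hb i).2
  have hq' : ∀ i p, q i (U.map ((c i).inj p.1) p.2) = p := fun i p => (hb i).1 (hq i _)
  let M : MultiMap U (fun i => (c i).pt) D :=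
    { fn := fun x => (m fun i => (q i (x i)).1).fn fun i => (q i (x i)).2
      lin := fun i z => Cofan.IsColimit.desc (hc i) (g i z)
      map_lin := fun x i => by
        have h1 := fun i => hq i (x i)
        have h2 : U.map (Cofan.IsColimit.desc (hc i) (g i fun k => x k))
            (U.map ((c i).inj (q i (x i)).1) (q i (x i)).2) =
              (m fun i => (q i (x i)).1).fn fun i => (q i (x i)).2 := by
          rw [← ConcreteCategory.comp_apply, ← U.map_comp, Cofan.IsColimit.fac,
            ← (m _).map_lin _ i, ← hg']
          have h3 : (fun k : {k // k ≠ i} => x k) = fun k : {k // k ≠ i} =>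
            U.map ((c k).inj (q k (x k)).1) (q k (x k)).2 := funext fun k => (h1 k).symm
          rw [← h3]
        exact (congrArg (U.map (Cofan.IsColimit.desc (hc i) (g i fun k => x k))) (h1 i)).symm.trans
          h2 }
  refine ⟨M, fun f => MultiMap.ext (fun x => ?_) fun i z => ?_⟩
  · have h1 : ∀ (p : ∀ i, Σ j, U.obj (Y i j)), (p = fun i => ⟨f i, x i⟩) →
        ((m fun i => (p i).1).fn fun i => (p i).2) = (m f).fn x := by
      rintro _ rfl
      rfl
    exact h1 (fun i => q i (U.map ((c i).inj (f i)) (x i))) (funext fun i => hq' i ⟨f i, x i⟩)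
  · exact (Cofan.IsColimit.fac _ _ _).trans (hg' i f z)

/-- In the presence of inverse images, tensor products given by universal multimaps preserve
coproducts in each variable. -/
theorem Representation.isDistributive (R : Representation U) (hU : HasInverseImages U) :
    R.multitensor.IsDistributive := by
  intro n J Y c hc
  have hc' : ∀ i, IsColimit (c i) := fun i => (hc i).some
  have hb := fun i => hU.bijective_inj (hc' i)
  choose M hM using fun s : Cofan (fun f : ∀ i, J i => R.multitensor.obj fun i => Y i (f i)) =>
    MultiMap.exists_cofan_desc hc' hb fun f => (R.univ _).post (s.inj f)
  refine ⟨Cofan.IsColimit.mk _ (fun s => R.desc (M s)) (fun s f => R.hom_ext ?_)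
    fun s g hg => R.hom_ext (MultiMap.cofan_ext hc' hb fun f => ?_)⟩
  · refine (MultiMap.post_post _ _ _).symm.trans ?_
    refine (congrArg (fun q => MultiMap.post q (R.desc (M s))) (R.univ_map _)).trans ?_
    rw [MultiMap.pre_post, R.univ_desc, hM]
  · let g' : R.tens (fun i => (c i).pt) ⟶ s.pt := g
    have hg' : R.map (fun i => (c i).inj (f i)) ≫ g' = s.inj f := hg f
    rw [R.univ_desc, hM]
    change ((R.univ _).post g').pre _ = _
    rw [← MultiMap.pre_post, ← R.univ_map, MultiMap.post_post, hg']

/-- The multitensor `T⊗` is distributive when `T` preserves coproducts. -/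
theorem OverSet.isDistributive {T : Monad A} (θ : OverSet U T) (R : Representation U)
    (hU : HasInverseImages U)
    (hT : ∀ J : Type w, PreservesColimitsOfShape (Discrete J) T.toFunctor) :
    (θ.multitensor R).IsDistributive := by
  intro n J Y c hc
  obtain ⟨h⟩ := R.isDistributive hU J Y c hc
  have := hT (∀ i, J i)
  exact ⟨isColimitCofanMkObjOfIsColimit T.toFunctor _ _ h⟩

end

end EnrichedGraph

namespace EnrichedGraph

/-! ### Isomorphisms of categories -/

section

variable {C : Type u} [Category.{v} C] {D : Type u'} [Category.{v'} D]

/-- The inverse takes the unique preimage of each object, and on morphisms conjugates by the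
resulting equalities before using full faithfulness. -/
theorem isIsoOfCategories_of_bijective (F : C ⥤ D) [F.Full] [F.Faithful]
    (h : Function.Bijective F.obj) : IsIsoOfCategories F := by
  choose o ho using h.2
  let G : D ⥤ C :=
    { obj := o
      map := fun {x y} f => F.preimage (eqToHom (ho x) ≫ f ≫ eqToHom (ho y).symm)
      map_id := fun x => F.map_injective (by simp)
      map_comp := fun f g => F.map_injective (by simp) }
  refine ⟨G, CategoryTheory.Functor.ext (fun x => h.1 (ho _)) fun x y f => F.map_injective ?_,
    CategoryTheory.Functor.ext ho fun x y f => ?_⟩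
  · simp [G, eqToHom_map]
  · simp [G]

theorem functor_ext_of_faithful {E : Type*} [Category E] {F G : C ⥤ D} (H : D ⥤ E)
    [H.Faithful] (h : ∀ x, F.obj x = G.obj x) (h' : F ⋙ H = G ⋙ H) : F = G :=
  CategoryTheory.Functor.ext h fun x y f => H.map_injective (by
    have := Functor.congr_hom h' f
    simpa [eqToHom_map] using this)

end

namespace VGraph

variable {V : Type u} [Category.{w} V] {W : Type u'} [Category.{w} W]

instance mapHoms_faithful (F : V ⥤ W) [F.Faithful] : (mapHoms F).Faithful where
  map_injective {X Y} f g h := by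
    obtain ⟨fo, fh⟩ := f
    obtain ⟨go, gh⟩ := g
    have h1 : fo = go := funext fun a => congrArg (fun k : (mapHoms F).obj X ⟶ (mapHoms F).obj Y =>
      Hom.ob k a) h
    subst h1
    have h2 : ∀ a b, fh a b = gh a b := fun a b => F.map_injective (by
      have h3 : F.map (fh a b) = F.map (gh a b) ≫ eqToHom _ := hom_congr h a b
      exact h3.trans (Category.comp_id _))
    obtain rfl : fh = gh := funext fun a => funext (h2 a)
    rfl

end VGraph

theorem algebra_ext {A : Type u} [Category.{v} A] {T : Monad A} {B C : T.Algebra} (h : B.A = C.A)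
    (h' : B.a ≫ eqToHom h = T.map (eqToHom h) ≫ C.a) : B = C := by
  obtain ⟨B, b, _, _⟩ := B
  obtain ⟨C, c, _, _⟩ := C
  dsimp at h
  subst h
  obtain rfl : b = c := by simpa using h'
  rfl

/-! ### Multimaps and the induced multitensor -/

namespace Representation

variable {A : Type u} [Category.{w} A] {U : A ⥤ Type w} (R : Representation U)

/-- The multimap corresponding to a morphism out of a tensor product. -/
def multi {n : ℕ} {X : Fin n → A} {c : A} (g : R.multitensor.obj X ⟶ c) : MultiMap U X c :=
  (R.univ X).post g

theorem multi_bijective {n : ℕ} (X : Fin n → A) (c : A) :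
    Function.Bijective (fun g : R.multitensor.obj X ⟶ c => R.multi g) := R.universal X c

variable {n : ℕ} {X : Fin n → A} {c d : A}

theorem multi_comp (g : R.multitensor.obj X ⟶ c) (h : c ⟶ d) :
    R.multi (g ≫ h) = (R.multi g).post h := (MultiMap.post_post _ _ _).symm

theorem multi_map {Y : Fin n → A} (f : ∀ i, X i ⟶ Y i) (g : R.multitensor.obj Y ⟶ c) :
    R.multi (R.multitensor.map f ≫ g) = (R.multi g).pre f := by
  refine (MultiMap.post_post _ _ _).symm.trans ?_
  refine (congrArg (fun q => MultiMap.post q g) (R.univ_map f)).trans ?_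
  exact MultiMap.pre_post _ _ _

theorem unit_comp_eq {a : A} (g : R.multitensor.obj (fun _ : Fin 1 => a) ⟶ c) (i : Fin 1)
    (z : {k // k ≠ i} → U.obj a) : R.multitensor.unit a ≫ g = (R.multi g).lin i z :=
  congrArg (· ≫ g) (R.univ_lin a i z).symm

/-- Translates the associativity axiom of enriched categories into an equation of multimaps. Both
sides are maps out of an iterated tensor product, so they may be compared after the composite
universal multimap. -/
theorem map_comp_eq_subst_comp_iff {N : ℕ} {m : Fin n → ℕ} (β : Blocks m N) (X : Fin N → A)
    {a : Fin n → A} (h : ∀ i, R.multitensor.obj (fun j => X (β i j)) ⟶ a i)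
    (g : R.multitensor.obj a ⟶ c) (g' : R.multitensor.obj X ⟶ c) :
    R.multitensor.map h ≫ g = R.multitensor.subst β X ≫ g' ↔
      MultiMap.comp β (R.multi g) (fun i => R.multi (h i)) = R.multi g' := by
  have h1 : (MultiMap.comp β (R.univ fun i => R.tens fun j => X (β i j))
      (fun i => R.univ fun j => X (β i j))).post (R.multitensor.map h ≫ g) =
        MultiMap.comp β (R.multi g) (fun i => R.multi (h i)) := by
    refine (MultiMap.comp_post β _ _ _).trans ?_
    refine (congrArg (fun q => MultiMap.comp β q _) (R.multi_map h g)).trans ?_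
    exact MultiMap.comp_pre β _ _ _
  have h2 : (MultiMap.comp β (R.univ fun i => R.tens fun j => X (β i j))
      (fun i => R.univ fun j => X (β i j))).post (R.multitensor.subst β X ≫ g') = R.multi g' := by
    refine (MultiMap.post_post _ _ _).symm.trans ?_
    exact congrArg (fun q => MultiMap.post q g') (R.comp_subst β X)
  rw [← h1, ← h2]
  exact (R.comp_universal β X c).1.eq_iff.symm

theorem subst_comp_injective {N : ℕ} {m : Fin n → ℕ} (β : Blocks m N) (X : Fin N → A)
    {g g' : R.tens X ⟶ c} (h : R.subst β X ≫ g = R.subst β X ≫ g') : g = g' := by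
  refine R.hom_ext ?_
  rw [← R.comp_subst β X, MultiMap.post_post, MultiMap.post_post, h]

theorem desc_post (f : MultiMap U X c) (h : c ⟶ d) : R.desc f ≫ h = R.desc (f.post h) :=
  R.hom_ext (by rw [← MultiMap.post_post, R.univ_desc, R.univ_desc])

theorem map_desc {Y : Fin n → A} (h : ∀ i, X i ⟶ Y i) (f : MultiMap U Y c) :
    R.map h ≫ R.desc f = R.desc (f.pre h) :=
  R.hom_ext (by
    rw [← MultiMap.post_post, R.univ_map, R.univ_desc, MultiMap.pre_post, R.univ_desc])

theorem map_desc_desc {N : ℕ} {m : Fin n → ℕ} (β : Blocks m N) {X : Fin N → A} {a : Fin n → A}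
    (f : MultiMap U a c) (g : ∀ i, MultiMap U (fun j => X (β i j)) (a i)) :
    R.map (fun i => R.desc (g i)) ≫ R.desc f = R.subst β X ≫ R.desc (MultiMap.comp β f g) := by
  refine (R.map_comp_eq_subst_comp_iff β X (fun i => R.desc (g i)) (R.desc f) _).2 ?_
  refine (congrArg₂ (MultiMap.comp β) (R.univ_desc f) (funext fun i => R.univ_desc (g i))).trans ?_
  exact (R.univ_desc _).symm

end Representation

/-! ### Multimaps of algebras as morphisms out of `T⊗` -/

namespace OverSet

variable {A : Type u} [Category.{w} A] {U : A ⥤ Type w} {T : Monad A} (θ : OverSet U T)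
  (S : Representation U)

section

variable {n : ℕ} {B : Fin n → T.Algebra} {C D : T.Algebra}

/-- The morphism out of `T ⊗_i B_i` corresponding to a multimap of algebras. -/
def extend (f : MultiMap (T.forget ⋙ U) B C) :
    (θ.multitensor S).obj (fun i => (B i).A) ⟶ C.A :=
  T.map (S.desc f.under) ≫ C.a

theorem unitAt_extend (f : MultiMap (T.forget ⋙ U) B C) :
    unitAt T (S.tens fun i => (B i).A) ≫ θ.extend S f = S.desc f.under := by
  refine (Category.assoc _ _ _).symm.trans ?_
  rw [← unitAt_naturality, Category.assoc, PreAlg.unitAt_act, Category.comp_id]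

theorem under_desc_injective {f g : MultiMap (T.forget ⋙ U) B C}
    (h : S.desc f.under = S.desc g.under) : f = g :=
  MultiMap.under_injective (by rw [← S.univ_desc f.under, h, S.univ_desc])

theorem extend_injective {f g : MultiMap (T.forget ⋙ U) B C}
    (h : θ.extend S f = θ.extend S g) : f = g :=
  under_desc_injective S (by rw [← unitAt_extend θ, h, unitAt_extend])

theorem extend_post (f : MultiMap (T.forget ⋙ U) B C) (h : C ⟶ D) :
    θ.extend S (f.post h) = θ.extend S f ≫ h.f := by
  have h1 : S.desc f.under ≫ h.f = S.desc (f.post h).under := S.desc_post _ _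
  change T.map (S.desc (f.post h).under) ≫ D.a = (T.map (S.desc f.under) ≫ C.a) ≫ h.f
  rw [Category.assoc, ← map_act C D h, ← Category.assoc, ← T.map_comp, h1]

theorem extend_pre {B' : Fin n → T.Algebra} (f : MultiMap (T.forget ⋙ U) B C)
    (h : ∀ i, B' i ⟶ B i) :
    θ.extend S (f.pre h) = (θ.multitensor S).map (fun i => (h i).f) ≫ θ.extend S f := by
  have h1 : S.map (fun i => (h i).f) ≫ S.desc f.under = S.desc (f.pre h).under := S.map_desc _ _
  refine (congrArg (fun q => T.map q ≫ C.a) h1.symm).trans ?_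
  rw [T.map_comp]
  exact Category.assoc _ _ _

theorem unit_extend {B : T.Algebra} (f : MultiMap (T.forget ⋙ U) (fun _ : Fin 1 => B) C) (i : Fin 1)
    (z : {k // k ≠ i} → (T.forget ⋙ U).obj B) :
    (θ.multitensor S).unit B.A ≫ θ.extend S f = (f.lin i z).f := by
  refine (Category.assoc _ _ _).trans ?_
  refine (congrArg (S.unit B.A ≫ ·) (θ.unitAt_extend S f)).trans ?_
  refine (S.unit_comp_eq (S.desc f.under) i z).trans ?_
  exact congrArg (fun q => MultiMap.lin q i z) (S.univ_desc f.under)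

/-- Since `f` is a multimap of algebras, `φ_desc_under` replaces the actions on the `B_i` by `φ` and
the action on `C`. Naturality of `φ` and `μ` and associativity of that action then produce the
substitution of `T⊗`. -/
theorem extend_comp {N : ℕ} {m : Fin n → ℕ} (β : Blocks m N) {X : Fin N → T.Algebra}
    (f : MultiMap (T.forget ⋙ U) B C)
    (g : ∀ i, MultiMap (T.forget ⋙ U) (fun j => X (β i j)) (B i)) :
    (θ.multitensor S).map (fun i => θ.extend S (g i)) ≫ θ.extend S f =
      (θ.multitensor S).subst β (fun r => (X r).A) ≫ θ.extend S (MultiMap.comp β f g) := by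
  have h1 : S.map (fun i => S.desc (g i).under) ≫ S.desc f.under =
      S.subst β (fun r => (X r).A) ≫ S.desc (MultiMap.comp β f g).under := by
    rw [MultiMap.under_comp]
    exact S.map_desc_desc β (X := fun r => (X r).A) f.under fun i => (g i).under
  change T.map (S.map fun i => T.map (S.desc (g i).under) ≫ (B i).a) ≫
      T.map (S.desc f.under) ≫ C.a =
    (T.map (θ.φ S (fun i => S.tens (fun j => (X (β i j)).A))) ≫ multAt T _ ≫
      T.map (S.subst β fun r => (X r).A)) ≫ T.map (S.desc (MultiMap.comp β f g).under) ≫ C.a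
  rw [S.map_comp, ← Category.assoc, ← T.map_comp, Category.assoc, ← θ.φ_desc_under,
    ← Category.assoc, φ_naturality]
  simp only [T.map_comp, Category.assoc]
  rw [← PreAlg.multAt_act, ← Category.assoc (T.map (T.map (S.desc _))), multAt_naturality,
    ← Category.assoc (T.map (T.map _)), ← Category.assoc (T.map (T.map _)), multAt_naturality]
  simp only [Category.assoc]
  rw [← Category.assoc (T.map (S.map _)), ← T.map_comp, h1, T.map_comp, Category.assoc]

theorem extend_subst_injective {N : ℕ} {m : Fin n → ℕ} (β : Blocks m N) {X : Fin N → T.Algebra}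
    {f g : MultiMap (T.forget ⋙ U) X C}
    (h : (θ.multitensor S).subst β (fun r => (X r).A) ≫ θ.extend S f =
      (θ.multitensor S).subst β (fun r => (X r).A) ≫ θ.extend S g) : f = g := by
  -- Precomposing with the units of `T`, outside and inside the outer tensor, removes `φ` and `μ`.
  -- What remains is the substitution of `⊗` alone, which is known to be cancellable against maps.
  have key : ∀ f : MultiMap (T.forget ⋙ U) X C,
      unitAt T _ ≫ T.map (S.map fun i => unitAt T (S.tens fun j => (X (β i j)).A)) ≫
        (T.map (θ.φ S (fun i => S.tens (fun j => (X (β i j)).A))) ≫ multAt T _ ≫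
          T.map (S.subst β fun r => (X r).A)) ≫ T.map (S.desc f.under) ≫ C.a =
        S.subst β (fun r => (X r).A) ≫ S.desc f.under := by
    intro f
    have h1 := θ.map_η_φ S (fun i => S.tens (fun j => (X (β i j)).A))
    simp only [Category.assoc]
    rw [← Category.assoc (T.map (S.map _)), ← T.map_comp, h1, ← Category.assoc (T.map (unitAt T _)),
      map_unitAt_multAt, Category.id_comp, ← Category.assoc (unitAt T _), ← unitAt_naturality,
      Category.assoc]
    exact congrArg (_ ≫ ·) (θ.unitAt_extend S f)
  refine under_desc_injective S (S.subst_comp_injective β _ ?_)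
  rw [← key f, ← key g]
  exact congrArg (fun q => _ ≫ T.map (S.map _) ≫ q) h

end

end OverSet

end EnrichedGraph

namespace EnrichedGraph

/-! ### Algebras of the unary part of `T⊗` -/

namespace OverSet

variable {A : Type u} [Category.{w} A] {U : A ⥤ Type w} {T : Monad A} (θ : OverSet U T)
  (S : Representation U)

/-- The inverse of `OverSet.unaryHom`. -/
def unaryInv : T ⟶ (θ.multitensor S).unary where
  app X := T.map (S.unit X)
  naturality X Y f := by
    show T.map f ≫ T.map (S.unit Y) = T.map (S.unit X) ≫ T.map (S.map fun _ => f)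
    rw [← T.map_comp, ← T.map_comp]
    exact congrArg T.map (S.multitensor.unit_naturality f).symm
  app_η X := (unitAt_naturality T (S.unit X)).symm
  app_μ X := by
    show multAt T X ≫ T.map (S.unit X) = (T.map (T.map (S.unit X)) ≫
      T.map (S.unit (T.obj (S.tens fun _ : Fin 1 => X)))) ≫
      T.map (θ.φ S (fun _ : Fin 1 => S.tens fun _ : Fin 1 => X)) ≫ multAt T _ ≫
        T.map (S.subst (Blocks.single 1) fun _ => X)
    have h1 : S.unit (S.tens fun _ : Fin 1 => X) ≫ S.subst (Blocks.single 1) (fun _ => X) = 𝟙 _ :=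
      S.multitensor.unit_subst (fun _ : Fin 1 => X)
    rw [← Category.assoc, Category.assoc (T.map (T.map _)), ← T.map_comp (S.unit _), unit_φ,
      Category.assoc, ← Category.assoc (T.map (T.map (S.unit (S.tens _)))), multAt_naturality,
      Category.assoc, ← T.map_comp, h1, T.map_id, Category.comp_id, multAt_naturality]

/-- The inverse of `OverSet.toUnaryAlgebra`. -/
def ofUnaryAlgebra : (θ.multitensor S).unary.Algebra ⥤ T.Algebra :=
  Monad.algebraFunctorOfMonadHom (θ.unaryInv S)

theorem toUnaryAlgebra_ofUnaryAlgebra : θ.toUnaryAlgebra S ⋙ θ.ofUnaryAlgebra S = 𝟭 _ :=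
  functor_ext_of_faithful T.forget (fun B => algebra_ext rfl (by
    show (T.map (S.unit B.A) ≫ T.map (S.unitInv B.A) ≫ B.a) ≫ 𝟙 _ = T.map (𝟙 _) ≫ B.a
    rw [← Category.assoc, ← T.map_comp, S.unit_unitInv, Category.comp_id])) rfl

/-- The two sides of the comparison of actions on the homs of a category enriched in the free
product of algebras. -/
theorem extend_multi_of_unit {R : Representation (T.forget ⋙ U)} {B : T.Algebra}
    (g : R.multitensor.obj (fun _ : Fin 1 => B) ⟶ B) (hg : R.multitensor.unit B ≫ g = 𝟙 B) :
    θ.extend S (R.multi g) = ((θ.toUnaryAlgebra S).obj B).a := by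
  -- The unit axiom makes every linear part of a unary composition the identity, and linear parts
  -- determine the underlying function. Hence the unary composition carries no data beyond the
  -- algebra structure of the hom.
  have h1 : (R.multi g).under = MultiMap.ofId U B.A := by
    have h2 : ∀ i z, ((R.multi g).lin i z).f = 𝟙 B.A := fun i z => by
      rw [← R.unit_comp_eq g i z, hg]
      rfl
    refine MultiMap.ext (fun x => ?_) h2
    refine ((R.multi g).under.map_lin x 0).symm.trans ?_
    refine (congrArg (fun k => U.map k (x 0)) (h2 0 _)).trans ?_
    simp [MultiMap.ofId]
  show T.map (S.desc (R.multi g).under) ≫ B.a = T.map (S.unitInv B.A) ≫ B.a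
  rw [h1]
  rfl

variable (R : Representation (T.forget ⋙ U))

/-- A category enriched in the free product of algebras is a category enriched in `T⊗`. -/
def toECatObj (X : ECat R.multitensor) : ECat (θ.multitensor S) where
  graph := (VGraph.mapHoms T.forget).obj X.graph
  comp s t a b h := θ.extend S (R.multi (X.comp s t a b h))
  unit_comp a b := by
    refine (θ.unit_extend S (R.multi (X.comp _ _ a b (IsPath.single a b))) 0
      (fun k => absurd (Subsingleton.elim _ _) k.2)).trans ?_
    rw [← R.unit_comp_eq]
    exact congrArg Monad.Algebra.Hom.f (X.unit_comp a b)
  subst_comp β s t s' t' a b h h' hβ := by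
    refine (θ.extend_comp S β (X := fun r => X.graph.hom (s r) (t r))
      (R.multi (X.comp s' t' a b h')) (fun i => R.multi (X.comp _ _ _ _ (hβ i)))).trans ?_
    refine congrArg (fun q => _ ≫ θ.extend S q) ?_
    exact (R.map_comp_eq_subst_comp_iff β (fun r => X.graph.hom (s r) (t r)) _ _ _).1
      (X.subst_comp β s t s' t' a b h h' hβ)

/-- Categories enriched in the free product of algebras are categories enriched in `T⊗`. -/
def toECat : ECat R.multitensor ⥤ ECat (θ.multitensor S) where
  obj X := θ.toECatObj S R X
  map {X Y} f := ECat.Hom.mk (X := θ.toECatObj S R X) (Y := θ.toECatObj S R Y)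
    ((VGraph.mapHoms T.forget).map (ECat.Hom.toHom (X := X) (Y := Y) f)) fun s t a b h => by
      refine (θ.extend_pre S (R.multi (Y.comp _ _ _ _ (h.map
        (VGraph.Hom.ob (X := X.graph) (Y := Y.graph) (ECat.Hom.toHom (X := X) (Y := Y) f)))))
        (fun i => VGraph.Hom.hom (X := X.graph) (Y := Y.graph)
          (ECat.Hom.toHom (X := X) (Y := Y) f) (s i) (t i))).symm.trans ?_
      refine Eq.trans ?_ (θ.extend_post S (R.multi (X.comp s t a b h)) _)
      rw [← R.multi_map, ← R.multi_comp]
      exact congrArg (fun q => θ.extend S (R.multi q))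
        (ECat.Hom.comp_hom (X := X) (Y := Y) f s t a b h)
  map_id X := ECat.Hom.ext ((VGraph.mapHoms T.forget).map_id X.graph)
  map_comp f g := ECat.Hom.ext ((VGraph.mapHoms T.forget).map_comp _ _)

/-- Only objects need an argument: the algebra structure which the unary composition puts on a hom
is the original one, by `extend_multi_of_unit`. Morphisms agree on underlying graphs, which suffices
by faithfulness. -/
theorem toECat_forgetToUnary :
    θ.toECat S R ⋙ ECat.forgetToUnary _ = ECat.forget _ ⋙ VGraph.mapHoms (θ.toUnaryAlgebra S) :=
  functor_ext_of_faithful (VGraph.mapHoms (Monad.forget _)) (fun X => by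
    refine congrArg (VGraph.mk X.graph.ob) ?_
    funext a b
    refine algebra_ext rfl ?_
    refine (Category.comp_id _).trans ?_
    refine (θ.extend_multi_of_unit S _ (X.unit_comp a b)).trans ?_
    refine (Category.id_comp _).symm.trans ?_
    exact congrArg (· ≫ ((θ.toUnaryAlgebra S).obj (X.graph.hom a b)).a)
      ((θ.multitensor S).unary.map_id _).symm) rfl

instance : (θ.toECat S R).Faithful where
  map_injective h := ECat.Hom.ext
    ((VGraph.mapHoms T.forget).map_injective (congrArg ECat.Hom.toHom h))

variable {R}

/-- Compatibility with unary composition is compatibility with the actions up to the invertible map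
`⊗X ⟶ X`, which cancels. This lifts hom maps of `T⊗`-functors to algebra morphisms, as fullness
requires. -/
theorem isAlgebraHom_of_unary {X Y : ECat R.multitensor} {a b : X.graph.ob} {a' b' : Y.graph.ob}
    (k : (X.graph.hom a b).A ⟶ (Y.graph.hom a' b').A)
    (h : (θ.multitensor S).map (fun _ => k) ≫
        θ.extend S (R.multi (Y.comp _ _ a' b' (IsPath.single a' b'))) =
      θ.extend S (R.multi (X.comp _ _ a b (IsPath.single a b))) ≫ k) :
    T.map k ≫ (Y.graph.hom a' b').a = (X.graph.hom a b).a ≫ k := by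
  rw [θ.extend_multi_of_unit S _ (X.unit_comp a b),
    θ.extend_multi_of_unit S _ (Y.unit_comp a' b')] at h
  have h4 : T.map (S.map fun _ => k) ≫ T.map (S.unitInv _) ≫ (Y.graph.hom a' b').a =
    (T.map (S.unitInv _) ≫ (X.graph.hom a b).a) ≫ k := h
  have h5 : IsIso (S.unitInv (X.graph.hom a b).A) := ⟨S.unit _, S.unitInv_unit _, S.unit_unitInv _⟩
  rw [← Category.assoc, ← T.map_comp, S.unitInv_naturality, T.map_comp, Category.assoc,
    Category.assoc] at h4
  exact (cancel_epi _).1 h4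

instance : (θ.toECat S R).Full where
  map_surjective {X Y} := by
    rintro ⟨⟨o, k⟩, hk⟩
    let o' : X.graph.ob → Y.graph.ob := o
    let k' : ∀ a b : X.graph.ob, X.graph.hom a b ⟶ Y.graph.hom (o' a) (o' b) := fun a b =>
      Monad.Algebra.Hom.mk (A := X.graph.hom a b) (B := Y.graph.hom (o' a) (o' b)) (k a b)
        (θ.isAlgebraHom_of_unary S (a := a) (b := b) (a' := o' a) (b' := o' b) (k a b)
          (hk (fun _ => a) (fun _ => b) a b (IsPath.single a b)))
    refine ⟨ECat.Hom.mk (X := X) (Y := Y) (VGraph.Hom.mk (X := X.graph) (Y := Y.graph) o' k')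
      fun s t a b h => (R.multi_bijective _ _).1 ?_, rfl⟩
    dsimp only
    rw [R.multi_map, R.multi_comp]
    refine θ.extend_injective S ?_
    rw [extend_pre, extend_post]
    exact hk s t a b h

end OverSet

end EnrichedGraph

namespace EnrichedGraph

/-! ### Categories enriched in the free product of algebras and in `T⊗` -/

namespace VGraph

variable {V : Type u} [Category.{w} V] {W : Type u'} [Category.{w} W]

theorem mapHoms_obj_injective {F : V ⥤ W} (hF : Function.Injective F.obj) :
    Function.Injective (mapHoms F).obj := by
  rintro ⟨o, h⟩ ⟨o', h'⟩ e
  obtain ⟨rfl, e2⟩ := VGraph.mk.inj e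
  have e3 := eq_of_heq e2
  obtain rfl : h = h' := funext fun a => funext fun b => hF (congrFun (congrFun e3 a) b)
  rfl

end VGraph

namespace OverSet

variable {A : Type u} [Category.{w} A] {U : A ⥤ Type w} {T : Monad A} (θ : OverSet U T)
  (S : Representation U)

theorem toUnaryAlgebra_obj_injective : Function.Injective (θ.toUnaryAlgebra S).obj := fun B C h =>
  (congrArg (fun F => F.obj B) (θ.toUnaryAlgebra_ofUnaryAlgebra S)).symm.trans
    ((congrArg (θ.ofUnaryAlgebra S).obj h).trans
      (congrArg (fun F => F.obj C) (θ.toUnaryAlgebra_ofUnaryAlgebra S)))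

/-- The graph of algebras is recovered from the unary compositions, and then all compositions,
because both `multi` and `extend` are injective. -/
theorem toECat_obj_injective (R : Representation (T.forget ⋙ U)) :
    Function.Injective (θ.toECat S R).obj := by
  intro X Y e
  have e1 : (VGraph.mapHoms (θ.toUnaryAlgebra S)).obj X.graph =
      (VGraph.mapHoms (θ.toUnaryAlgebra S)).obj Y.graph :=
    (congrArg (fun F => F.obj X) (θ.toECat_forgetToUnary S R)).symm.trans
      ((congrArg (ECat.forgetToUnary _).obj e).trans
        (congrArg (fun F => F.obj Y) (θ.toECat_forgetToUnary S R)))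
  have e2 := VGraph.mapHoms_obj_injective (θ.toUnaryAlgebra_obj_injective S) e1
  obtain ⟨G, c, hc, hc'⟩ := X
  obtain ⟨G', c', _, _⟩ := Y
  dsimp at e2
  subst e2
  have e3 := eq_of_heq (ECat.mk.inj e).2
  have e4 : @c = @c' := by
    funext n s t a b h
    refine (R.multi_bijective _ _).1 (θ.extend_injective S ?_)
    have := congrArg (fun k : (∀ {n : ℕ} (s t : Fin n → G.ob) (a b : G.ob), IsPath s t a b →
      ((θ.multitensor S).obj (fun i => (G.hom (s i) (t i)).A) ⟶ (G.hom a b).A)) => k s t a b h) e3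
    exact this
  subst e4
  rfl

/-! ### Compositions of a `T⊗`-category as multimaps of algebras -/

variable (Z : ECat (θ.multitensor S))

/-- The homs of a category enriched in `T⊗` are algebras. -/
def homAlg (a b : Z.graph.ob) : T.Algebra := (θ.ofUnaryAlgebra S).obj (Z.homAlgebra a b)

variable {n : ℕ} (s t : Fin n → Z.graph.ob) (a b : Z.graph.ob) (h : IsPath s t a b)

/-- Composition in a category enriched in `T⊗`. -/
def compAt : T.obj (S.tens fun i => Z.graph.hom (s i) (t i)) ⟶ Z.graph.hom a b := Z.comp s t a b h

/-- The action of the monad on the homs of a category enriched in `T⊗`. -/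
def actAt : T.obj (Z.graph.hom a b) ⟶ Z.graph.hom a b :=
  T.map (S.unit (Z.graph.hom a b)) ≫
    θ.compAt S Z (fun _ : Fin 1 => a) (fun _ => b) a b (IsPath.single a b)

/-- The associativity axiom for a single block: composition is an algebra morphism out of the free
algebra on the tensor product, hence is determined by its restriction along the unit. -/
theorem map_compAt_actAt : T.map (θ.compAt S Z s t a b h) ≫ θ.actAt S Z a b =
    multAt T _ ≫ θ.compAt S Z s t a b h := by
  have h1 : T.map (S.map fun _ : Fin 1 => θ.compAt S Z s t a b h) ≫
      θ.compAt S Z (fun _ : Fin 1 => a) (fun _ => b) a b (IsPath.single a b) =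
      (T.map (θ.φ S fun _ : Fin 1 => S.tens fun i => Z.graph.hom (s i) (t i)) ≫ multAt T _ ≫
        T.map (S.subst (Blocks.single n) fun i => Z.graph.hom (s i) (t i))) ≫
          θ.compAt S Z s t a b h :=
    Z.subst_comp (Blocks.single n) s t (fun _ => a) (fun _ => b) a b h (IsPath.single a b)
      (fun _ => h)
  have h2 : S.unit _ ≫ S.map (fun _ : Fin 1 => θ.compAt S Z s t a b h) =
    θ.compAt S Z s t a b h ≫ S.unit _ := S.multitensor.unit_naturality _
  have h3 : S.unit (S.tens fun i => Z.graph.hom (s i) (t i)) ≫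
      S.subst (Blocks.single n) (fun i => Z.graph.hom (s i) (t i)) = 𝟙 _ :=
    S.multitensor.unit_subst fun i => Z.graph.hom (s i) (t i)
  rw [actAt, ← Category.assoc, ← T.map_comp, ← h2, T.map_comp, Category.assoc, h1]
  simp only [← Category.assoc]
  rw [← T.map_comp, unit_φ, multAt_naturality]
  simp only [Category.assoc]
  rw [← Category.assoc (T.map (S.unit _)), ← T.map_comp, h3, T.map_id, Category.id_comp]

/-- The associativity axiom for blocks of length one: acting on each variable before composing is
the same as applying `φ` and multiplying in `T`. -/
theorem map_actAt_compAt : T.map (S.map fun i => θ.actAt S Z (s i) (t i)) ≫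
    θ.compAt S Z s t a b h =
      T.map (θ.φ S fun i => Z.graph.hom (s i) (t i)) ≫ multAt T _ ≫ θ.compAt S Z s t a b h := by
  have h1 : T.map (S.map fun i => θ.compAt S Z (fun _ : Fin 1 => s i) (fun _ => t i) (s i) (t i)
      (IsPath.single _ _)) ≫ θ.compAt S Z s t a b h =
      (T.map (θ.φ S fun i => S.tens fun _ : Fin 1 => Z.graph.hom (s i) (t i)) ≫ multAt T _ ≫
        T.map (S.subst (Blocks.ones n) fun i => Z.graph.hom (s i) (t i))) ≫
          θ.compAt S Z s t a b h :=
    Z.subst_comp (Blocks.ones n) s t s t a b h h (fun i => IsPath.single (s i) (t i))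
  have h3 : S.map (fun i => S.unit (Z.graph.hom (s i) (t i))) ≫
    S.subst (Blocks.ones n) (fun i => Z.graph.hom (s i) (t i)) = 𝟙 _ :=
    S.multitensor.map_unit_subst _
  simp only [actAt]
  rw [S.map_comp, T.map_comp, Category.assoc, h1]
  simp only [← Category.assoc]
  rw [← T.map_comp, φ_naturality, T.map_comp]
  simp only [Category.assoc]
  rw [← Category.assoc (T.map (T.map _)), multAt_naturality, Category.assoc,
    ← Category.assoc (T.map (S.map _)), ← T.map_comp, h3, T.map_id, Category.id_comp]

theorem map_unitAt_compAt_actAt : T.map (unitAt T _ ≫ θ.compAt S Z s t a b h) ≫ θ.actAt S Z a b =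
    θ.compAt S Z s t a b h := by
  rw [T.map_comp, Category.assoc, map_compAt_actAt, ← Category.assoc, map_unitAt_multAt,
    Category.id_comp]

/-- Combining the two preceding laws, the restriction of composition along the unit satisfies the
equation that characterises multimaps of algebras. -/
theorem φ_unitAt_compAt : θ.φ S (fun i => Z.graph.hom (s i) (t i)) ≫
    T.map (unitAt T _ ≫ θ.compAt S Z s t a b h) ≫ θ.actAt S Z a b =
      S.map (fun i => θ.actAt S Z (s i) (t i)) ≫ unitAt T _ ≫ θ.compAt S Z s t a b h := by
  rw [map_unitAt_compAt_actAt, ← Category.assoc (S.map _), unitAt_naturality, Category.assoc,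
    map_actAt_compAt, ← Category.assoc, ← unitAt_naturality, Category.assoc,
    ← Category.assoc (unitAt T _), unitAt_multAt, Category.id_comp]

theorem exists_extend_eq : ∃ f : MultiMap (T.forget ⋙ U) (fun i => θ.homAlg S Z (s i) (t i))
    (θ.homAlg S Z a b), θ.extend S f = Z.comp s t a b h := by
  obtain ⟨f, hf⟩ := θ.exists_under S (B := fun i => θ.homAlg S Z (s i) (t i))
    (C := θ.homAlg S Z a b) (unitAt T _ ≫ θ.compAt S Z s t a b h) (θ.φ_unitAt_compAt S Z s t a b h)
  exact ⟨f, (congrArg (fun q => T.map q ≫ (θ.homAlg S Z a b).a) hf).trans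
    (θ.map_unitAt_compAt_actAt S Z s t a b h)⟩

variable (R : Representation (T.forget ⋙ U))

theorem toECat_obj_surjective : Function.Surjective (θ.toECat S R).obj := by
  intro Z
  choose f hf using fun (n : ℕ) (s t : Fin n → Z.graph.ob) a b h =>
    θ.exists_extend_eq S Z s t a b h
  have hR : ∀ (n : ℕ) (s t : Fin n → Z.graph.ob) a b h, R.multi (R.desc (f n s t a b h)) =
    f n s t a b h := fun _ _ _ _ _ _ => R.univ_desc _
  let X : ECat R.multitensor :=
    { graph := { ob := Z.graph.ob, hom := fun a b => θ.homAlg S Z a b }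
      comp := fun s t a b h => R.desc (f _ s t a b h)
      unit_comp := fun a b => by
        refine (R.unit_comp_eq _ 0 (fun k => absurd (Subsingleton.elim _ _) k.2)).trans ?_
        rw [hR]
        refine Monad.Algebra.Hom.ext' _ _ _ _ ?_
        rw [← θ.unit_extend S, hf]
        exact Z.unit_comp a b
      subst_comp := fun β s t s' t' a b h h' hβ => by
        refine (R.map_comp_eq_subst_comp_iff β (fun r => θ.homAlg S Z (s r) (t r)) _ _ _).2 ?_
        simp only [hR]
        refine θ.extend_subst_injective S β ?_
        rw [← extend_comp, hf, hf]
        simp only [hf]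
        exact Z.subst_comp β s t s' t' a b h h' hβ }
  refine ⟨X, ?_⟩
  obtain ⟨⟨o, k⟩, c, _, _⟩ := Z
  have hc : @((θ.toECat S R).obj X).comp = @c := by
    funext n s t a b h
    exact (congrArg (θ.extend S) (hR n s t a b h)).trans (hf n s t a b h)
  show ECat.mk _ ((θ.toECat S R).obj X).comp _ _ = ECat.mk _ c _ _
  congr 1

theorem isIsoOfCategories_toECat : IsIsoOfCategories (θ.toECat S R) :=
  isIsoOfCategories_of_bijective _ ⟨θ.toECat_obj_injective S R, θ.toECat_obj_surjective S R⟩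

end OverSet

end EnrichedGraph

namespace EnrichedGraph

/-! ### Enriched categories as algebras of `gamma` -/

namespace Multitensor

variable {V : Type u} [Category.{w} V] [HasCoproducts.{w} V] {E : Multitensor V}

open VGraph

/-- The hom maps of the action of `gamma` on the graph of an enriched category. -/
def gammaActHom (X : ECat E) (a b : X.graph.ob) : (E.gammaObj X.graph).hom a b ⟶ X.graph.hom a b :=
  gammaDesc fun s t h => X.comp s t a b h

theorem gammaInj_gammaActHom (X : ECat E) {n : ℕ} (s t : Fin n → X.graph.ob) (a b : X.graph.ob)
    (h : IsPath s t a b) :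
    E.gammaInj X.graph s t a b h ≫ gammaActHom X a b = X.comp s t a b h :=
  gammaInj_desc (fun s t h => X.comp s t a b h) s t h

/-- The action of `gamma` on the graph of an enriched category. -/
abbrev gammaAct (X : ECat E) : E.gammaObj X.graph ⟶ X.graph :=
  Hom.mk (X := E.gammaObj X.graph) (Y := X.graph) (fun a => a) (gammaActHom X)

/-- By distributivity it suffices to test on a path of paths, where `gammaMul` is substitution along
concatenation and the equation is the associativity axiom. -/
theorem gammaMul_gammaActHom (hd : E.IsDistributive) (X : ECat E) (a b : X.graph.ob) :
    E.gammaMul hd X.graph a b ≫ gammaActHom X a b =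
      gammaMapHom (X := E.gammaObj X.graph) (Y := X.graph) ⟨fun a => a, gammaActHom X⟩ a b ≫
        gammaActHom X a b := by
  refine gamma_hom_ext (X := E.gammaObj X.graph) fun s' t' h' => ?_
  refine gamma_tensor_hom_ext hd fun β s t hβ => ?_
  have h := IsPath.concat β h' hβ
  rw [E.gammaMul_spec' hd X.graph β s t s' t' a b h' hβ h, gammaInj_gammaActHom, gammaInj_mapHom',
    map_map, gammaInj_gammaActHom]
  simp only [gammaInj_gammaActHom]
  exact (X.subst_comp β s t s' t' a b h h' hβ).symm

variable (hd : E.IsDistributive)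

/-- The algebra of `gamma` on the graph of an enriched category. -/
def gammaAlgebra (X : ECat E) : (E.gamma hd).Algebra where
  A := X.graph
  a := gammaAct X
  unit := by
    refine hom_ext (fun _ => rfl) fun a b => ?_
    refine (Category.comp_id _).trans ?_
    refine (Category.assoc _ _ _).trans ?_
    refine (congrArg (E.unit _ ≫ ·) (gammaInj_gammaActHom X _ _ a b _)).trans ?_
    exact X.unit_comp a b
  assoc := by
    refine hom_ext (fun _ => rfl) fun a b => ?_
    refine (Category.comp_id _).trans ?_
    exact gammaMul_gammaActHom hd X a b

/-- Enriched categories are algebras of `gamma`. -/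
def toGammaAlgebra : ECat E ⥤ (E.gamma hd).Algebra where
  obj X := gammaAlgebra hd X
  map {X Y} f := Monad.Algebra.Hom.mk (A := gammaAlgebra hd X) (B := gammaAlgebra hd Y)
    (ECat.Hom.toHom (X := X) (Y := Y) f) (by
      refine hom_ext (fun _ => rfl) fun a b => ?_
      refine (Category.comp_id _).trans ?_
      refine gamma_hom_ext (X := X.graph) fun s t h => ?_
      refine (gammaInj_mapHom' _ s t a b h _).trans ?_
      refine (congrArg (_ ≫ ·) (gammaInj_gammaActHom Y _ _ _ _ _)).trans ?_
      refine (ECat.Hom.comp_hom (X := X) (Y := Y) f s t a b h).trans ?_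
      refine Eq.trans ?_ (Category.assoc _ _ _)
      exact congrArg (· ≫ _) (gammaInj_gammaActHom X s t a b h).symm)
  map_id _ := rfl
  map_comp _ _ := rfl

theorem toGammaAlgebra_forget : toGammaAlgebra hd ⋙ (E.gamma hd).forget = ECat.forget E := rfl

instance : (toGammaAlgebra hd).Faithful where
  map_injective h := ECat.Hom.ext (congrArg Monad.Algebra.Hom.f h)

instance : (toGammaAlgebra hd).Full where
  map_surjective {X Y} := by
    rintro ⟨f, hf⟩
    refine ⟨ECat.Hom.mk (X := X) (Y := Y) f fun s t a b h => ?_, rfl⟩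
    have h1 : gammaMapHom f a b ≫ gammaActHom Y _ _ = (gammaActHom X a b ≫
      Hom.hom f a b) ≫ eqToHom _ := hom_congr hf a b
    have h2 := congrArg (E.gammaInj X.graph s t a b h ≫ ·) (h1.trans (Category.comp_id _))
    refine Eq.trans ?_ (h2.trans ?_)
    · refine Eq.trans ?_ (gammaInj_mapHom' _ s t a b h _).symm
      exact congrArg (_ ≫ ·) (gammaInj_gammaActHom Y _ _ _ _ _).symm
    · refine (Category.assoc _ _ _).symm.trans ?_
      exact congrArg (· ≫ _) (gammaInj_gammaActHom X s t a b h)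

theorem toGammaAlgebra_obj_injective : Function.Injective (toGammaAlgebra hd).obj := by
  intro X Y e
  have e1 : X.graph = Y.graph := congrArg Monad.Algebra.A e
  obtain ⟨G, c, hc, hc'⟩ := X
  obtain ⟨G', c', hc₂, hc₂'⟩ := Y
  dsimp at e1
  subst e1
  have e2 : gammaAct ⟨G, c, hc, hc'⟩ = gammaAct ⟨G, c', hc₂, hc₂'⟩ :=
    eq_of_heq (Monad.Algebra.mk.inj e).2
  have e4 : @c = @c' := by
    funext n s t a b h
    have h1 : gammaActHom ⟨G, c, hc, hc'⟩ a b =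
      gammaActHom ⟨G, c', hc₂, hc₂'⟩ a b ≫ eqToHom _ := hom_congr e2 a b
    exact (gammaInj_gammaActHom ⟨G, c, hc, hc'⟩ s t a b h).symm.trans
      ((congrArg (E.gammaInj G s t a b h ≫ ·) (h1.trans (Category.comp_id _))).trans
        (gammaInj_gammaActHom ⟨G, c', hc₂, hc₂'⟩ s t a b h))
  subst e4
  rfl

theorem toGammaAlgebra_obj_surjective : Function.Surjective (toGammaAlgebra hd).obj := by
  rintro ⟨X, ⟨o, k⟩, hu, hm⟩
  -- The unit law forces an action to be the identity on objects. What is left is a family of maps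
  -- out of coproducts over paths, that is, composition maps.
  have ho : o = fun x => x := funext fun x => congrArg (fun f : X ⟶ X => Hom.ob f x) hu
  subst ho
  let k' : ∀ a b, (E.gammaObj X).hom a b ⟶ X.hom a b := k
  have hu' : ∀ a b, E.unit (X.hom a b) ≫ E.gammaInj X _ _ a b (IsPath.single a b) ≫ k' a b = 𝟙 _ :=
    fun a b => (Category.assoc _ _ _).symm.trans ((hom_congr hu a b).trans (Category.comp_id _))
  have hm' : ∀ a b, E.gammaMul hd X a b ≫ k' a b =
      gammaMapHom (X := E.gammaObj X) (Y := X) ⟨fun x => x, k'⟩ a b ≫ k' a b :=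
    fun a b => (hom_congr hm a b).trans (Category.comp_id _)
  let Z : ECat E :=
    { graph := X
      comp := fun s t a b h => E.gammaInj X s t a b h ≫ k' a b
      unit_comp := hu'
      subst_comp := fun β s t s' t' a b h h' hβ => by
        rw [← E.gammaMul_spec' hd X β s t s' t' a b h' hβ h, hm', gammaInj_mapHom', map_map] }
  refine ⟨Z, ?_⟩
  have ha : gammaAct Z = Hom.mk (X := E.gammaObj X) (Y := X) (fun x => x) k' := by
    refine hom_ext (fun _ => rfl) fun a b => (Category.comp_id _).trans ?_
    exact gamma_hom_ext (X := X) fun s t h => gammaInj_gammaActHom Z s t a b h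
  show Monad.Algebra.mk (T := E.gamma hd) X (gammaAct Z) _ _ = _
  congr 1

theorem isIsoOfCategories_toGammaAlgebra : IsIsoOfCategories (toGammaAlgebra hd) :=
  isIsoOfCategories_of_bijective _
    ⟨toGammaAlgebra_obj_injective hd, toGammaAlgebra_obj_surjective hd⟩

end Multitensor

section

variable {C : Type*} [Category C] {D : Type*} [Category D] {D' : Type*} [Category D']

theorem IsIsoOfCategories.comp {F : C ⥤ D} {G : D ⥤ D'} (hF : IsIsoOfCategories F)
    (hG : IsIsoOfCategories G) : IsIsoOfCategories (F ⋙ G) := by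
  obtain ⟨F', h1, h2⟩ := hF
  obtain ⟨G', h3, h4⟩ := hG
  refine ⟨G' ⋙ F', ?_, ?_⟩
  · rw [Functor.assoc, ← Functor.assoc G, h3, Functor.id_comp, h1]
  · rw [Functor.assoc, ← Functor.assoc F', h2, Functor.id_comp, h4]

theorem IsIsoOfCategories.exists_inverse {F : C ⥤ D} (hF : IsIsoOfCategories F) :
    ∃ G : D ⥤ C, IsIsoOfCategories G ∧ F ⋙ G = 𝟭 C ∧ G ⋙ F = 𝟭 D := by
  obtain ⟨G, h1, h2⟩ := hF
  exact ⟨G, ⟨F, h2, h1⟩, h1, h2⟩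

end

end EnrichedGraph

namespace EnrichedGraph

/-! ### Functors between categories of algebras over the base -/

section

variable {C : Type u} [Category.{v} C] {T₁ T₂ : Monad C}

section

variable (G : T₁.Algebra ⥤ T₂.Algebra) (hG : G ⋙ T₂.forget = T₁.forget)

include hG in
theorem obj_A_eq (B : T₁.Algebra) : (G.obj B).A = B.A := congrArg (fun F => F.obj B) hG

include hG in
theorem map_f_eq {B B' : T₁.Algebra} (h : B ⟶ B') :
    (G.map h).f = eqToHom (obj_A_eq G hG B) ≫ h.f ≫ eqToHom (obj_A_eq G hG B').symm :=
  Functor.congr_hom hG h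

/-- The action, on the underlying object of an algebra, of the monad of the target of a functor over
the base. -/
def transportAct (B : T₁.Algebra) : T₂.obj B.A ⟶ B.A :=
  T₂.map (eqToHom (obj_A_eq G hG B).symm) ≫ (G.obj B).a ≫ eqToHom (obj_A_eq G hG B)

theorem transportAct_naturality {B B' : T₁.Algebra} (h : B ⟶ B') :
    T₂.map h.f ≫ transportAct G hG B' = transportAct G hG B ≫ h.f := by
  have h1 := map_act _ _ (G.map h)
  have h2 : h.f = eqToHom (obj_A_eq G hG B).symm ≫ (G.map h).f ≫ eqToHom (obj_A_eq G hG B') := by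
    rw [map_f_eq G hG]
    simp
  have h3 : h.f ≫ eqToHom (obj_A_eq G hG B').symm =
      eqToHom (obj_A_eq G hG B).symm ≫ (G.map h).f := by
    rw [map_f_eq G hG]
    simp
  rw [transportAct, transportAct, ← Category.assoc, ← T₂.map_comp, h3, T₂.map_comp, Category.assoc,
    ← Category.assoc (T₂.map (G.map h).f), h1, Category.assoc, Category.assoc, Category.assoc,
    h2, ← Category.assoc (eqToHom (obj_A_eq G hG B)), eqToHom_trans, eqToHom_refl, Category.id_comp]

theorem unitAt_transportAct (B : T₁.Algebra) : unitAt T₂ B.A ≫ transportAct G hG B = 𝟙 _ := by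
  rw [transportAct, ← Category.assoc, ← unitAt_naturality, Category.assoc,
    ← Category.assoc (unitAt T₂ _), PreAlg.unitAt_act, Category.id_comp, eqToHom_trans,
    eqToHom_refl]

theorem multAt_transportAct (B : T₁.Algebra) : multAt T₂ B.A ≫ transportAct G hG B =
    T₂.map (transportAct G hG B) ≫ transportAct G hG B := by
  simp only [transportAct, T₂.map_comp, Category.assoc]
  rw [← Category.assoc (multAt T₂ _), ← multAt_naturality, Category.assoc,
    ← Category.assoc (multAt T₂ _), PreAlg.multAt_act, Category.assoc,
    ← Category.assoc (T₂.map (eqToHom _)) (T₂.map (eqToHom _)), ← T₂.map_comp, eqToHom_trans,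
    eqToHom_refl, T₂.map_id, Category.id_comp]

/-- The action of the second monad on the free algebras of the first. -/
def freeAct (X : C) : T₂.obj (T₁.obj X) ⟶ T₁.obj X := transportAct G hG ((Monad.free T₁).obj X)

theorem freeAct_naturality {X Y : C} (f : X ⟶ Y) :
    T₂.map (T₁.map f) ≫ freeAct G hG Y = freeAct G hG X ≫ T₁.map f :=
  transportAct_naturality G hG ((Monad.free T₁).map f)

theorem unitAt_freeAct (X : C) : unitAt T₂ (T₁.obj X) ≫ freeAct G hG X = 𝟙 _ :=
  unitAt_transportAct G hG ((Monad.free T₁).obj X)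

theorem multAt_freeAct (X : C) : multAt T₂ (T₁.obj X) ≫ freeAct G hG X =
    T₂.map (freeAct G hG X) ≫ freeAct G hG X :=
  multAt_transportAct G hG ((Monad.free T₁).obj X)

/-- The action `B.a` is itself a morphism of algebras from the free algebra on `B.A`, so naturality
of the transported action applies to it. -/
theorem freeAct_act (B : T₁.Algebra) :
    freeAct G hG B.A ≫ B.a = T₂.map B.a ≫ transportAct G hG B :=
  (transportAct_naturality G hG
    (Monad.Algebra.Hom.mk (A := (Monad.free T₁).obj B.A) (B := B) B.a B.assoc.symm)).symm

/-- The component of the morphism of monads corresponding to a functor over the base. -/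
def monadComp (X : C) : T₂.obj X ⟶ T₁.obj X := T₂.map (unitAt T₁ X) ≫ freeAct G hG X

/-- The functor is restriction along `monadComp`: every algebra is a retract of the free algebra on
it, at the level of underlying objects, so its transported action is determined by the free case. -/
theorem transportAct_eq (B : T₁.Algebra) :
    transportAct G hG B = monadComp G hG B.A ≫ B.a := by
  rw [monadComp, Category.assoc, freeAct_act, ← Category.assoc, ← T₂.map_comp, PreAlg.unitAt_act,
    T₂.map_id, Category.id_comp]

theorem freeAct_eq (X : C) : freeAct G hG X = monadComp G hG (T₁.obj X) ≫ multAt T₁ X :=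
  transportAct_eq G hG ((Monad.free T₁).obj X)

theorem monadComp_naturality {X Y : C} (f : X ⟶ Y) :
    T₂.map f ≫ monadComp G hG Y = monadComp G hG X ≫ T₁.map f := by
  rw [monadComp, monadComp, Category.assoc, ← freeAct_naturality, ← Category.assoc, ← T₂.map_comp,
    unitAt_naturality, T₂.map_comp, Category.assoc]

theorem unitAt_monadComp (X : C) : unitAt T₂ X ≫ monadComp G hG X = unitAt T₁ X := by
  rw [monadComp, ← Category.assoc, ← unitAt_naturality, Category.assoc, unitAt_freeAct,
    Category.comp_id]

theorem multAt_monadComp (X : C) : multAt T₂ X ≫ monadComp G hG X =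
    T₂.map (monadComp G hG X) ≫ monadComp G hG (T₁.obj X) ≫ multAt T₁ X := by
  rw [← freeAct_eq, monadComp, ← Category.assoc, ← multAt_naturality, Category.assoc,
    multAt_freeAct, T₂.map_comp, Category.assoc]

end

theorem eqToHom_act {B B' : T₁.Algebra} (h : B = B') (h' : B.A = B'.A) :
    T₁.map (eqToHom h'.symm) ≫ B.a ≫ eqToHom h' = B'.a := by
  subst h
  simp

/-- Transporting an action there and back returns it, so the composite of the two components acts on
every algebra as the identity does. Evaluating on free algebras at the unit gives the identity. -/
theorem monadComp_comp_monadComp (G : T₁.Algebra ⥤ T₂.Algebra) (hG : G ⋙ T₂.forget = T₁.forget)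
    (G' : T₂.Algebra ⥤ T₁.Algebra) (hG' : G' ⋙ T₁.forget = T₂.forget) (h : G ⋙ G' = 𝟭 _) (X : C) :
    monadComp G' hG' X ≫ monadComp G hG X = 𝟙 (T₁.obj X) := by
  have key : ∀ B : T₁.Algebra, monadComp G' hG' B.A ≫ monadComp G hG B.A ≫ B.a = B.a := by
    intro B
    have h1 : transportAct G' hG' (G.obj B) = T₁.map (eqToHom (obj_A_eq G hG B)) ≫ B.a ≫
        eqToHom (obj_A_eq G hG B).symm := by
      have e : G'.obj (G.obj B) = B := congrArg (fun F => F.obj B) h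
      rw [transportAct, ← eqToHom_act e (congrArg Monad.Algebra.A e)]
      simp only [Category.assoc, eqToHom_trans]
      rw [← Category.assoc (T₁.map _) (T₁.map _), ← T₁.map_comp, eqToHom_trans]
    have h2 := transportAct_eq G' hG' (G.obj B)
    rw [h1] at h2
    rw [← transportAct_eq G hG, transportAct, ← Category.assoc, ← monadComp_naturality,
      Category.assoc, ← Category.assoc (monadComp G' hG' _), ← h2]
    simp only [Category.assoc, eqToHom_trans, eqToHom_refl, Category.comp_id]
    rw [← Category.assoc, ← T₁.map_comp, eqToHom_trans, eqToHom_refl, T₁.map_id, Category.id_comp]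
  have h1 : monadComp G' hG' (T₁.obj X) ≫ monadComp G hG (T₁.obj X) ≫ multAt T₁ X = multAt T₁ X :=
    key ((Monad.free T₁).obj X)
  -- Naturality moves the unit past both components, where it cancels the multiplication.
  have h2 : T₁.map (unitAt T₁ X) ≫ monadComp G' hG' (T₁.obj X) ≫ monadComp G hG (T₁.obj X) ≫
    multAt T₁ X = T₁.map (unitAt T₁ X) ≫ multAt T₁ X := congrArg _ h1
  rw [map_unitAt_multAt, ← Category.assoc, monadComp_naturality, Category.assoc,
    ← Category.assoc (T₂.map _), monadComp_naturality, Category.assoc, map_unitAt_multAt,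
    Category.comp_id] at h2
  exact h2

end

end EnrichedGraph

namespace EnrichedGraph

/-! ### Decomposition of paths -/

theorem ListPath.of_append {S : Type w} {l l' : List (S × S)} {a b : S}
    (h : ListPath (l ++ l') a b) : ∃ c, ListPath l a c ∧ ListPath l' c b := by
  induction l generalizing a with
  | nil => exact ⟨a, rfl, h⟩
  | cons p l ih =>
    obtain ⟨c, hc, hc'⟩ := ih h.2
    exact ⟨c, ⟨h.1, hc⟩, hc'⟩

theorem ListPath.of_flatten {S : Type w} {n : ℕ} (L : Fin n → List (S × S)) (a b : S)
    (h : ListPath (List.ofFn L).flatten a b) :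
    ∃ s t : Fin n → S, IsPath s t a b ∧ ∀ i, ListPath (L i) (s i) (t i) := by
  induction n generalizing a with
  | zero =>
    refine ⟨fun i => i.elim0, fun i => i.elim0, (isPath_iff _ _ _ _).2 ?_, fun i => i.elim0⟩
    simpa using h
  | succ n ih =>
    rw [List.ofFn_succ, List.flatten_cons] at h
    obtain ⟨c, hc, hc'⟩ := h.of_append
    obtain ⟨s, t, hp, hL⟩ := ih _ _ hc'
    refine ⟨Fin.cons a s, Fin.cons c t, ?_, Fin.cases hc hL⟩
    rw [isPath_iff] at hp ⊢
    rw [List.ofFn_succ]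
    exact ⟨rfl, hp⟩

/-- Cut the path at the ends of the blocks; an empty block contributes a constant path. This lets
the formula for `gammaMul` be used when comparing substitutions. -/
theorem IsPath.exists_decomposition {S : Type w} {n N : ℕ} {m : Fin n → ℕ} (β : Blocks m N)
    {s t : Fin N → S} {a b : S} (h : IsPath s t a b) :
    ∃ s' t' : Fin n → S, IsPath s' t' a b ∧
      ∀ i, IsPath (fun j => s (β i j)) (fun j => t (β i j)) (s' i) (t' i) := by
  rw [isPath_iff, β.ofFn_eq_flatten] at h
  obtain ⟨s', t', h1, h2⟩ := ListPath.of_flatten _ a b h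
  exact ⟨s', t', h1, fun i => (isPath_iff _ _ _ _).2 (h2 i)⟩

theorem IsPath.eq_of_unary {S : Type w} {s t : Fin 1 → S} {a b : S} (h : IsPath s t a b) :
    s = (fun _ => a) ∧ t = fun _ => b := by
  obtain ⟨x, rfl, rfl, hx⟩ := h
  constructor <;> funext i <;> obtain rfl : i = 0 := Subsingleton.elim _ _
  · exact (hx 0).1
  · exact (hx 0).2

/-! ### The graph of a path -/

namespace VGraph

variable {V : Type u} [Category.{w} V] [HasCoproducts.{w} V] {n : ℕ}

/-- The indices of the hom from `i` to `j` in the graph of a path. -/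
abbrev PathIdx (n : ℕ) (i j : ULift.{w} (Fin (n + 1))) : Type w :=
  ULift.{w} {k : Fin n // i.down = k.castSucc ∧ j.down = k.succ}

/-- The graph freely generated by a path with edges `X 0, …, X (n - 1)`. -/
abbrev pathGraph (X : Fin n → V) : VGraph V where
  ob := ULift (Fin (n + 1))
  hom i j := ∐ fun k : PathIdx.{w} n i j => X k.down.1

/-- The sources of the edges. -/
abbrev pathSrc (n : ℕ) (k : Fin n) : ULift.{w} (Fin (n + 1)) := ⟨k.castSucc⟩

/-- The targets of the edges. -/
abbrev pathTgt (n : ℕ) (k : Fin n) : ULift.{w} (Fin (n + 1)) := ⟨k.succ⟩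

theorem isPath_pathSrc (n : ℕ) : IsPath (pathSrc.{w} n) (pathTgt n) ⟨0⟩ ⟨Fin.last n⟩ :=
  ⟨fun i => ⟨i⟩, rfl, rfl, fun _ => ⟨rfl, rfl⟩⟩

/-- The only path from one end to the other. -/
abbrev fullPath (n : ℕ) : GPath (ULift.{w} (Fin (n + 1))) ⟨0⟩ ⟨Fin.last n⟩ :=
  ⟨pathSrc n, pathTgt n, isPath_pathSrc n⟩

/-- Every step over an actual edge raises the vertex by one, so a path from `0` to `n` made of such
steps is at vertex `i` after `i` steps and has length `n`. -/
theorem eq_fullPath (p : GPath (ULift.{w} (Fin (n + 1))) ⟨0⟩ ⟨Fin.last n⟩)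
    (f : ∀ i, PathIdx n (p.s i) (p.t i)) : p = fullPath n := by
  obtain ⟨s, t, x, hx0, hxl, hx⟩ := p
  rename_i m
  have h1 : ∀ i : Fin m, ((x i.succ).down : ℕ) = (x i.castSucc).down + 1 := fun i => by
    obtain ⟨k, hk, hk'⟩ : ∃ k : Fin n, (s i).down = k.castSucc ∧ (t i).down = k.succ :=
      ⟨_, (f i).down.2⟩
    rw [(hx i).1] at hk
    rw [(hx i).2] at hk'
    rw [hk, hk']
    simp
  have h2 : ∀ i : Fin (m + 1), ((x i).down : ℕ) = i := fun i => by
    induction i using Fin.induction with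
    | zero => rw [hx0]; rfl
    | succ i ih => rw [h1, ih]; simp
  have h3 : m = n := by
    have := h2 (Fin.last m)
    rw [hxl] at this
    simpa using this.symm
  subst h3
  have hs : s = pathSrc m := funext fun i => by
    rw [(hx i).1]
    exact ULift.ext _ _ (Fin.ext (h2 _))
  have ht : t = pathTgt m := funext fun i => by
    rw [(hx i).2]
    exact ULift.ext _ _ (Fin.ext (h2 _))
  subst hs ht
  rfl

/-- The inclusion of an edge. -/
def pathLeg (X : Fin n → V) (k : Fin n) :
    X k ⟶ (pathGraph X).hom (pathSrc n k) (pathTgt n k) :=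
  Sigma.ι (fun l : PathIdx.{w} n (pathSrc n k) (pathTgt n k) => X l.down.1) ⟨⟨k, rfl, rfl⟩⟩

/-- The inverse of the inclusion of an edge. -/
def pathLegInv (X : Fin n → V) (k : Fin n) :
    (pathGraph X).hom (pathSrc n k) (pathTgt n k) ⟶ X k :=
  Sigma.desc fun l : PathIdx.{w} n (pathSrc n k) (pathTgt n k) =>
    eqToHom (congrArg X (Fin.castSucc_injective n l.down.2.1).symm)

theorem pathLeg_inv (X : Fin n → V) (k : Fin n) : pathLeg X k ≫ pathLegInv X k = 𝟙 _ :=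
  Sigma.ι_desc _ _

theorem pathLegInv_leg (X : Fin n → V) (k : Fin n) : pathLegInv X k ≫ pathLeg X k = 𝟙 _ := by
  refine Sigma.hom_ext _ _ fun l => ?_
  obtain ⟨l, h1, h2⟩ := l
  obtain rfl : k = l := Fin.castSucc_injective n h1
  rw [pathLegInv, Sigma.ι_desc_assoc, eqToHom_refl, Category.id_comp, Category.comp_id]
  rfl

variable {Y : VGraph V}

/-- The hom maps of morphisms out of the graph of a path. -/
def pathDescHom {X : Fin n → V} (x : Fin (n + 1) → Y.ob)
    (f : ∀ i, X i ⟶ Y.hom (x i.castSucc) (x i.succ)) (i j : ULift.{w} (Fin (n + 1))) :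
    (pathGraph X).hom i j ⟶ Y.hom (x i.down) (x j.down) :=
  Sigma.desc fun k : PathIdx.{w} n i j => f k.down.1 ≫
    eqToHom (congrArg₂ (fun p q => Y.hom (x p) (x q)) k.down.2.1.symm k.down.2.2.symm)

theorem pathLeg_pathDescHom {X : Fin n → V} (x : Fin (n + 1) → Y.ob)
    (f : ∀ i, X i ⟶ Y.hom (x i.castSucc) (x i.succ)) (k : Fin n) :
    pathLeg X k ≫ pathDescHom x f (pathSrc n k) (pathTgt n k) = f k :=
  (Sigma.ι_desc _ _).trans (Category.comp_id _)

/-- Morphisms out of the graph of a path. -/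
abbrev pathDesc {X : Fin n → V} (x : Fin (n + 1) → Y.ob)
    (f : ∀ i, X i ⟶ Y.hom (x i.castSucc) (x i.succ)) : Hom (pathGraph X) Y :=
  Hom.mk (X := pathGraph X) (Y := Y) (fun i => x i.down) (pathDescHom x f)

end VGraph

namespace Multitensor

open VGraph

variable {V : Type u} [Category.{w} V] [HasCoproducts.{w} V] {n : ℕ}

/-- The map exhibiting `E_i X_i` as a hom of `gamma` of the graph of a path. -/
def pathInj (E : Multitensor V) (X : Fin n → V) :
    E.obj X ⟶ (E.gammaObj (pathGraph X)).hom ⟨0⟩ ⟨Fin.last n⟩ :=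
  E.map (pathLeg X) ≫
    E.gammaInj (pathGraph X) (pathSrc n) (pathTgt n) ⟨0⟩ ⟨Fin.last n⟩ (isPath_pathSrc n)

variable {E : Multitensor V}

theorem map_pathLegInv_leg (X : Fin n → V) :
    E.map (pathLegInv X) ≫ E.map (pathLeg X) = 𝟙 _ := by
  rw [← E.map_comp]
  simp only [pathLegInv_leg]
  exact E.map_id _

theorem map_pathLeg_inv (X : Fin n → V) :
    E.map (pathLeg X) ≫ E.map (pathLegInv X) = 𝟙 _ := by
  rw [← E.map_comp]
  simp only [pathLeg_inv]
  exact E.map_id _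

/-- Among the summands of the hom from `0` to `n`, any path but the full one contains a pair of
vertices with no edge. Its summand is initial by distributivity, so only `E_i X_i` survives. -/
theorem isIso_pathInj (hd : E.IsDistributive) (X : Fin n → V) : IsIso (E.pathInj X) := by
  classical
  -- Distributivity presents the summand of `p` as a coproduct indexed by choices of an edge at each
  -- step. By `eq_fullPath` there are none, whence exactly one map to each `Z`.
  have hc : ∀ p : GPath (ULift.{w} (Fin (n + 1))) ⟨0⟩ ⟨Fin.last n⟩, p ≠ fullPath n →
      ∀ Z : V, (∃ _ : E.obj (fun i => (pathGraph X).hom (p.s i) (p.t i)) ⟶ Z, True) ∧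
        ∀ g g' : E.obj (fun i => (pathGraph X).hom (p.s i) (p.t i)) ⟶ Z, g = g' := by
    intro p hp Z
    obtain ⟨h⟩ := hd (fun i => PathIdx.{w} n (p.s i) (p.t i)) (fun i k => X k.down.1)
      (fun i => colimit.cocone _) (fun i => ⟨colimit.isColimit _⟩)
    exact ⟨⟨Cofan.IsColimit.desc h fun f => absurd (eq_fullPath p f) hp, trivial⟩, fun g g' =>
      Cofan.IsColimit.hom_ext h _ _ fun f => absurd (eq_fullPath p f) hp⟩
  let r : (E.gammaObj (pathGraph X)).hom ⟨0⟩ ⟨Fin.last n⟩ ⟶ E.obj X := Sigma.desc fun p =>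
    if hp : p = fullPath n then eqToHom (by rw [hp]) ≫ E.map (pathLegInv X)
    else (hc p hp _).1.choose
  have h1 : E.pathInj X ≫ r = 𝟙 _ := by
    rw [pathInj, Category.assoc]
    refine (congrArg (E.map (pathLeg X) ≫ ·) ((Sigma.ι_desc _ (fullPath n)).trans
      (dif_pos rfl))).trans ?_
    rw [eqToHom_refl, Category.id_comp, map_pathLeg_inv]
  refine ⟨r, h1, Sigma.hom_ext _ _ fun p => ?_⟩
  by_cases hp : p = fullPath n
  · subst hp
    have h2 : Sigma.ι (fun p : GPath (pathGraph X).ob ⟨0⟩ ⟨Fin.last n⟩ =>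
        E.obj (fun i => (pathGraph X).hom (p.s i) (p.t i))) (fullPath n) =
        E.map (pathLegInv X) ≫ E.pathInj X := by
      rw [pathInj, ← Category.assoc, map_pathLegInv_leg, Category.id_comp]
      rfl
    rw [h2, Category.comp_id, Category.assoc, ← Category.assoc (E.pathInj X), h1, Category.id_comp]
  · exact (hc p hp _).2 _ _

theorem pathInj_mapHom {X : Fin n → V} {Y : VGraph V} (x : Fin (n + 1) → Y.ob)
    (f : ∀ i, X i ⟶ Y.hom (x i.castSucc) (x i.succ))
    (h : IsPath (fun i => x i.castSucc) (fun i => x i.succ) (x 0) (x (Fin.last n))) :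
    E.pathInj X ≫ gammaMapHom (pathDesc x f) ⟨0⟩ ⟨Fin.last n⟩ =
      E.map f ≫ E.gammaInj Y (fun i => x i.castSucc) (fun i => x i.succ) _ _ h := by
  rw [pathInj, Category.assoc, gammaInj_mapHom, ← Category.assoc, ← E.map_comp]
  simp only [pathLeg_pathDescHom]

/-! ### Multitensors are determined by their monads -/

variable {E' : Multitensor V}
  {r : ∀ (X : VGraph V) (a b : X.ob), (E.gammaObj X).hom a b ≅ (E'.gammaObj X).hom a b}

/-- The natural isomorphism extracted from a natural isomorphism of monads. -/
def pathIso (hd' : E'.IsDistributive) (hd : E.IsDistributive)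
    (r : ∀ (X : VGraph V) (a b : X.ob), (E.gammaObj X).hom a b ≅ (E'.gammaObj X).hom a b)
    (X : Fin n → V) : E.obj X ≅ E'.obj X :=
  have := isIso_pathInj (@hd) X
  have := isIso_pathInj (@hd') X
  asIso (E.pathInj X) ≪≫ r (pathGraph X) ⟨0⟩ ⟨Fin.last n⟩ ≪≫ (asIso (E'.pathInj X)).symm

theorem pathIso_pathInj (hd' : E'.IsDistributive) (hd : E.IsDistributive) (X : Fin n → V) :
    (pathIso (@hd') (@hd) r X).hom ≫ E'.pathInj X =
      E.pathInj X ≫ (r (pathGraph X) ⟨0⟩ ⟨Fin.last n⟩).hom := by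
  simp [pathIso]

/-- A path in `Y` with maps into its homs is a morphism from the graph of a path. Naturality of `r`
along it reduces every summand to the universal one, so `r` is everywhere given by `pathIso`. -/
theorem map_gammaInj_comp (hd' : E'.IsDistributive) (hd : E.IsDistributive)
    (hr : ∀ {X Y : VGraph V} (f : VGraph.Hom X Y) (a b : X.ob),
      gammaMapHom f a b ≫ (r Y (f.ob a) (f.ob b)).hom = (r X a b).hom ≫ gammaMapHom f a b)
    {X : Fin n → V} {Y : VGraph V} {s t : Fin n → Y.ob} {a b : Y.ob}
    (f : ∀ i, X i ⟶ Y.hom (s i) (t i)) (h : IsPath s t a b) :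
    E.map f ≫ E.gammaInj Y s t a b h ≫ (r Y a b).hom =
      (pathIso (@hd') (@hd) r X).hom ≫ E'.map f ≫ E'.gammaInj Y s t a b h := by
  obtain ⟨x, rfl, rfl, hx⟩ := id h
  obtain rfl : s = fun i => x i.castSucc := funext fun i => (hx i).1
  obtain rfl : t = fun i => x i.succ := funext fun i => (hx i).2
  rw [← pathInj_mapHom x f h, ← Category.assoc (pathIso _ _ _ _).hom, pathIso_pathInj,
    Category.assoc, ← hr, ← Category.assoc, ← Category.assoc, pathInj_mapHom x f h]

/-- The maps into homs of `Γ E'` include `pathInj`, which is invertible, so equations into `E'_i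
X_i` can be checked inside the monad. -/
theorem gamma_cancel (hd' : E'.IsDistributive) {X : Fin n → V} {Z : V} {g g' : Z ⟶ E'.obj X}
    (h : ∀ (Y : VGraph V) (s t : Fin n → Y.ob) (a b : Y.ob) (f : ∀ i, X i ⟶ Y.hom (s i) (t i))
      (h : IsPath s t a b), g ≫ E'.map f ≫ E'.gammaInj Y s t a b h =
        g' ≫ E'.map f ≫ E'.gammaInj Y s t a b h) : g = g' := by
  have := isIso_pathInj (@hd') X
  exact (cancel_mono (E'.pathInj X)).1 (h _ _ _ _ _ (pathLeg X) (isPath_pathSrc n))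

/-- Distributive multitensors inducing isomorphic monads are isomorphic. -/
theorem nonempty_iso_of_gamma (hd' : E'.IsDistributive) (hd : E.IsDistributive)
    (hr : ∀ {X Y : VGraph V} (f : VGraph.Hom X Y) (a b : X.ob),
      gammaMapHom f a b ≫ (r Y (f.ob a) (f.ob b)).hom = (r X a b).hom ≫ gammaMapHom f a b)
    (hu : ∀ (X : VGraph V) (a b : X.ob), E.unit _ ≫ E.gammaInj X _ _ a b (IsPath.single a b) ≫
      (r X a b).hom = E'.unit _ ≫ E'.gammaInj X _ _ a b (IsPath.single a b))
    (hm : ∀ (X : VGraph V) (a b : X.ob), E.gammaMul hd X a b ≫ (r X a b).hom =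
      gammaMapHom (X := E.gammaObj X) (Y := E'.gammaObj X)
          ⟨fun x => x, fun a b => (r X a b).hom⟩ a b ≫
        (r (E'.gammaObj X) a b).hom ≫ E'.gammaMul hd' X a b) :
    Nonempty (E.Iso E') := by
  refine ⟨⟨pathIso (@hd') (@hd) r, fun {n X Y} f => ?_, fun X => ?_, fun {n N m} β X => ?_⟩⟩
  · refine gamma_cancel (@hd') fun Z s t a b g h => ?_
    rw [Category.assoc, ← map_gammaInj_comp (@hd') (@hd) hr g h, Category.assoc, map_map, map_map,
      map_gammaInj_comp (@hd') (@hd) hr _ h]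
  · refine gamma_cancel (@hd') fun Z s t a b f h => ?_
    obtain ⟨rfl, rfl⟩ := h.eq_of_unary
    obtain ⟨f, rfl⟩ : ∃ f' : X ⟶ Z.hom a b, f = fun _ => f' :=
      ⟨f 0, funext fun i => by obtain rfl : i = 0 := Subsingleton.elim _ _; rfl⟩
    rw [Category.assoc, ← map_gammaInj_comp (@hd') (@hd) hr _ h, ← unit_naturality_assoc, hu,
      unit_naturality_assoc]
  · refine gamma_cancel (@hd') fun Y s t a b f h => ?_
    -- Cutting the path along `β` expresses both substitutions through `gammaMul`; the
    -- multiplicativity of `r` then compares them, with `r` used once on the inner paths and once on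
    -- the outer one.
    obtain ⟨s', t', h', hβ⟩ := h.exists_decomposition β
    have e1 := E.gammaMul_spec' hd Y β s t s' t' a b h' hβ h (r Y a b).hom
    have e2 := E'.gammaMul_spec hd' Y β s t s' t' a b h' hβ h
    have e3 : ∀ i, (E.map (fun j => f (β i j)) ≫ E.gammaInj Y _ _ _ _ (hβ i)) ≫ (r Y _ _).hom =
        (pathIso (@hd') (@hd) r _).hom ≫ E'.map (fun j => f (β i j)) ≫
          E'.gammaInj Y _ _ _ _ (hβ i) :=
      fun i => (Category.assoc _ _ _).trans (map_gammaInj_comp (@hd') (@hd) hr _ _)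
    have e4 := map_gammaInj_comp (@hd') (@hd) hr (Y := E'.gammaObj Y)
      (fun i => E'.map (fun j => f (β i j)) ≫ E'.gammaInj Y _ _ _ _ (hβ i)) h'
    rw [Category.assoc, ← map_gammaInj_comp (@hd') (@hd) hr _ h, subst_naturality_assoc, ← e1, hm,
      gammaInj_mapHom', map_map, map_map]
    simp only [e3]
    rw [E.map_comp, Category.assoc, reassoc_of% e4, ← map_map, e2]
    simp only [Category.assoc]
    rw [subst_naturality_assoc]

end Multitensor

end EnrichedGraph

namespace EnrichedGraph

/-! ### Uniqueness of lifted multitensors -/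

theorem VGraph.exists_eq_mk {V : Type u} [Category.{w} V] {O : Type w} {h h' : O → O → V}
    (f : (VGraph.mk O h : VGraph V) ⟶ VGraph.mk O h') (hf : ∀ x, Hom.ob f x = x) :
    ∃ k : ∀ a b, h a b ⟶ h' a b, f = Hom.mk (X := VGraph.mk O h) (Y := VGraph.mk O h')
      (fun x => x) k := by
  obtain ⟨o, k⟩ := f
  obtain rfl : o = fun x => x := funext hf
  exact ⟨k, rfl⟩

theorem VGraph.hom_eq_of_mk_eq {V : Type u} [Category.{w} V] {X Y : VGraph V} {o : X.ob → Y.ob}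
    {k k' : ∀ a b, X.hom a b ⟶ Y.hom (o a) (o b)}
    (h : (Hom.mk (X := X) (Y := Y) o k) = Hom.mk o k') (a b : X.ob) : k a b = k' a b :=
  (hom_congr (f := (Hom.mk (X := X) (Y := Y) o k : X ⟶ Y)) h a b).trans (Category.comp_id _)

-- An isomorphism of enriched categories over graphs is one of `Γ`-algebras over graphs, hence comes
-- from an isomorphism of monads, and this determines the multitensors.
open VGraph Multitensor in
theorem Multitensor.nonempty_iso_of_eCat {V : Type u} [Category.{w} V] [HasCoproducts.{w} V]
    {E E' : Multitensor V} (hd : E.IsDistributive) (hd' : E'.IsDistributive)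
    (G : ECat E ⥤ ECat E') (hG : IsIsoOfCategories G) (hG' : G ⋙ ECat.forget E' = ECat.forget E) :
    Nonempty (E.Iso E') := by
  obtain ⟨H, hH, hH'⟩ := hG
  obtain ⟨W, hW, hW'⟩ := isIsoOfCategories_toGammaAlgebra (E := E) hd
  obtain ⟨W', hW₂, hW₂'⟩ := isIsoOfCategories_toGammaAlgebra (E := E') hd'
  have hHf : H ⋙ ECat.forget E = ECat.forget E' := by
    rw [← hG', ← Functor.assoc, hH', Functor.id_comp]
  let F : (E.gamma hd).Algebra ⥤ (E'.gamma hd').Algebra := W ⋙ G ⋙ toGammaAlgebra hd'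
  let F' : (E'.gamma hd').Algebra ⥤ (E.gamma hd).Algebra := W' ⋙ H ⋙ toGammaAlgebra hd
  have hF : F ⋙ (E'.gamma hd').forget = (E.gamma hd).forget := by
    show W ⋙ G ⋙ ECat.forget E' = _
    rw [hG', ← toGammaAlgebra_forget hd, ← Functor.assoc, hW', Functor.id_comp]
  have hF' : F' ⋙ (E.gamma hd).forget = (E'.gamma hd').forget := by
    show W' ⋙ H ⋙ ECat.forget E = _
    rw [hHf, ← toGammaAlgebra_forget hd', ← Functor.assoc, hW₂', Functor.id_comp]
  have hFF' : F ⋙ F' = 𝟭 _ := by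
    show W ⋙ G ⋙ (toGammaAlgebra hd' ⋙ W') ⋙ H ⋙ toGammaAlgebra hd = _
    rw [hW₂, Functor.id_comp, ← Functor.assoc G, hH, Functor.id_comp, hW']
  have hF'F : F' ⋙ F = 𝟭 _ := by
    show W' ⋙ H ⋙ (toGammaAlgebra hd ⋙ W) ⋙ G ⋙ toGammaAlgebra hd' = _
    rw [hW, Functor.id_comp, ← Functor.assoc H, hH', Functor.id_comp, hW₂']
  -- Functors over the base induce monad morphisms in the opposite direction, so `F'` gives the map
  -- from `Γ E` to `Γ E'`. Compatibility with units makes it the identity on objects, so it is a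
  -- family of hom maps.
  choose p hp using fun X : VGraph V => exists_eq_mk (h := (E.gammaObj X).hom)
    (h' := (E'.gammaObj X).hom) (monadComp F' hF' X) (fun x =>
      congrArg (fun f : X ⟶ E'.gammaObj X => Hom.ob f x) (unitAt_monadComp F' hF' X))
  choose q hq using fun X : VGraph V => exists_eq_mk (h := (E'.gammaObj X).hom)
    (h' := (E.gammaObj X).hom) (monadComp F hF X) (fun x =>
      congrArg (fun f : X ⟶ E.gammaObj X => Hom.ob f x) (unitAt_monadComp F hF X))
  have hpq : ∀ X a b, p X a b ≫ q X a b = 𝟙 _ := fun X a b => by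
    have h := monadComp_comp_monadComp F hF F' hF' hFF' X
    rw [hp, hq] at h
    exact hom_eq_of_mk_eq (X := E.gammaObj X) (Y := E.gammaObj X) h a b
  have hqp : ∀ X a b, q X a b ≫ p X a b = 𝟙 _ := fun X a b => by
    have h := monadComp_comp_monadComp F' hF' F hF hF'F X
    rw [hp, hq] at h
    exact hom_eq_of_mk_eq (X := E'.gammaObj X) (Y := E'.gammaObj X) h a b
  refine nonempty_iso_of_gamma (r := fun X a b => ⟨p X a b, q X a b, hpq X a b, hqp X a b⟩) hd' hd
    (fun {X Y} f a b => ?_) (fun X a b => ?_) (fun X a b => ?_)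
  · have h := monadComp_naturality F' hF' (X := X) (Y := Y) f
    rw [hp, hp] at h
    exact hom_eq_of_mk_eq (X := E.gammaObj X) (Y := E'.gammaObj Y) h a b
  · have h := unitAt_monadComp F' hF' X
    rw [hp] at h
    exact (Category.assoc _ _ _).symm.trans
      (hom_eq_of_mk_eq (X := X) (Y := E'.gammaObj X) h a b)
  · have h := multAt_monadComp F' hF' X
    have hp' := hp (E'.gammaObj X)
    rw [hp] at h
    replace h := h.trans (congrArg (fun k => (E.gamma hd).map (Hom.mk (X := E.gammaObj X)
      (Y := E'.gammaObj X) (fun x => x) (p X)) ≫ k ≫ multAt (E'.gamma hd') X) hp')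
    exact hom_eq_of_mk_eq (X := E.gammaObj (E.gammaObj X)) (Y := E'.gammaObj X) h a b

/-- Both lifts have the enriched categories of `E`, over graphs in the algebras of its unary part.
Because `K` has a strict retraction, so does its effect on graphs, and the comparison lies over
graphs in `B` itself. -/
theorem IsLift.nonempty_iso {V : Type u} [Category.{w} V] {E : Multitensor V} {B : Type u'}
    [Category.{w} B] [HasCoproducts.{w} B] {K : B ⥤ E.unary.Algebra} {K' : E.unary.Algebra ⥤ B}
    (hK : K ⋙ K' = 𝟭 B) {E₁ E₂ : Multitensor B} (h₁ : IsLift E K E₁) (h₂ : IsLift E K E₂) :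
    Nonempty (E₁.Iso E₂) := by
  obtain ⟨-, hd₁, Φ₁, hΦ₁, e₁⟩ := h₁
  obtain ⟨-, hd₂, Φ₂, hΦ₂, e₂⟩ := h₂
  obtain ⟨Ψ, hΨ, -, hΨ'⟩ := hΦ₂.exists_inverse
  have h : (Φ₁ ⋙ Ψ) ⋙ ECat.forget E₂ ⋙ VGraph.mapHoms K = ECat.forget E₁ ⋙ VGraph.mapHoms K := by
    rw [← e₁, ← e₂, Functor.assoc, ← Functor.assoc Ψ, hΨ', Functor.id_comp]
  have hmap : VGraph.mapHoms K ⋙ VGraph.mapHoms K' = 𝟭 _ :=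
    (rfl : _ = VGraph.mapHoms (K ⋙ K')).trans (by rw [hK]; rfl)
  refine Multitensor.nonempty_iso_of_eCat hd₁ hd₂ (Φ₁ ⋙ Ψ) (hΦ₁.comp hΨ) ?_
  have h' := congrArg (· ⋙ VGraph.mapHoms K') h
  simpa only [Functor.assoc, hmap, Functor.comp_id] using h'

/-! ### The free product of algebras -/

theorem hasCoproducts_algebra {C : Type u} [Category.{w} C] [HasCoproducts.{w} C] (T : Monad C)
    (hT : ∀ J : Type w, PreservesColimitsOfShape (Discrete J) T.toFunctor) :
    HasCoproducts.{w} T.Algebra := fun J => by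
  have := hT J
  exact hasColimitsOfShape_of_hasColimitsOfShape_createsColimitsOfShape T.forget

theorem isNormal_multitensor {A : Type u} [Category.{w} A] {U : A ⥤ Type w} (R : Representation U) :
    R.multitensor.IsNormal := fun X => ⟨R.unitInv X, R.unit_unitInv X, R.unitInv_unit X⟩

theorem OverSet.isLift {A : Type u} [Category.{w} A] {U : A ⥤ Type w} (hU : HasInverseImages U)
    {T : Monad A} (θ : OverSet U T) (S : Representation U) (R : Representation (T.forget ⋙ U)) :
    IsLift (θ.multitensor S) (θ.toUnaryAlgebra S) R.multitensor :=
  ⟨isNormal_multitensor R, R.isDistributive (θ.hasInverseImages hU), θ.toECat S R,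
    θ.isIsoOfCategories_toECat S R, θ.toECat_forgetToUnary S R⟩

end EnrichedGraph

end

/-! ### The free product of algebras as a lifted multitensor, and sesqui-algebras -/

theorem mainTheorem6 {V : Type u} [Category.{w} V] [IsLocallyPresentable.{w} V]
    (T : Monad (VGraph V)) (θ : OverSet (VGraph.objects V) T)
    (hacc : T.toFunctor.IsAccessible.{w})
    (hcoprod : ∀ J : Type w, PreservesColimitsOfShape (Discrete J) T.toFunctor) :
    Nonempty (EnrichedGraph.Representation (T.forget ⋙ VGraph.objects V)) ∧
    ∀ R : EnrichedGraph.Representation (T.forget ⋙ VGraph.objects V),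
      (IsLift (θ.multitensor (VGraph.representation V)) (θ.toUnaryAlgebra (VGraph.representation V))
          R.multitensor ∧
        ∀ E : Multitensor T.Algebra,
          IsLift (θ.multitensor (VGraph.representation V))
            (θ.toUnaryAlgebra (VGraph.representation V)) E →
          Nonempty (E.Iso R.multitensor)) ∧
      ∃ hd : (θ.multitensor (VGraph.representation V)).IsDistributive,
        ∃ Ψ : ECat R.multitensor ⥤ ((θ.multitensor (VGraph.representation V)).gamma hd).Algebra,
          IsIsoOfCategories Ψ ∧
          Ψ ⋙ ((θ.multitensor (VGraph.representation V)).gamma hd).forget =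
            ECat.forget R.multitensor ⋙ VGraph.mapHoms T.forget := by
  have : HasColimitsOfSize.{w, w} V := by
    obtain ⟨κ, _, _⟩ := IsLocallyPresentable.exists_cardinal.{w} V
    infer_instance
  have hU := VGraph.hasInverseImages_objects V
  refine ⟨θ.nonempty_representation hacc hU (VGraph.representation V), fun R => ?_⟩
  have hR := θ.isLift hU (VGraph.representation V) R
  -- Lifts are compared through monads on graphs enriched in algebras, which require coproducts of
  -- algebras; these are created by the forgetful functor since `T` preserves them.
  have hT := hasCoproducts_algebra T hcoprod
  have hd : (θ.multitensor (VGraph.representation V)).IsDistributive :=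
    θ.isDistributive (VGraph.representation V) hU hcoprod
  exact ⟨⟨hR, fun E hE => hE.nonempty_iso (θ.toUnaryAlgebra_ofUnaryAlgebra _) hR⟩, hd,
    θ.toECat _ R ⋙ Multitensor.toGammaAlgebra hd,
    (θ.isIsoOfCategories_toECat _ R).comp (Multitensor.isIsoOfCategories_toGammaAlgebra hd), rfl⟩
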